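/- Let $G$ be a finite simple graph with $n$ vertices. A \emph{witness} is the edge set of a Hamiltonian cycle of $G$ (a simple cycle through all $n$ vertices). A \emph{certificate} is a set of edges of $G$ that is the union of the edge sets of pairwise vertex-disjoint paths, or is a witness. For $X \subseteq V(G)$ let $\mathrm{cert}(X)$ be the set of all certificates contained in $E(G[X])$. For disjoint $A, B \subseteq V(G)$ let $G[A,B]$ be the bipartite graph of the edges of $G$ between $A$ and $B$, and for $S_A \subseteq \mathrm{cert}(A)$, $S_B \subseteq \mathrm{cert}(B)$ let $\mathrm{conc}(S_A, S_B)$ be the set of all certificates in $\mathrm{cert}(A \cup B)$ of the form $s_a \cup s_b \cup E'$ with $s_a \in S_A$, $s_b \in S_B$ and $E' \subseteq E(G[A,B])$. For $S_1, S_2 \subseteq \mathrm{cert}(A)$, say that $S_1$ \emph{preserves} $S_2$ if for every $b \in \mathrm{cert}(V(G) \setminus A)$: whenever $\mathrm{conc}(S_2, \{b\})$ contains a witness, so does $\mathrm{conc}(S_1, \{b\})$. \textbf{Corollary.} There are an algorithm and absolute constants $c, d \in \mathbb{N}$ such that the following holds. Given a graph $G$ on $n$ vertices, a set $A \subseteq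 V(G)$, a set $S \subseteq \mathrm{cert}(A)$ (listed without repetition), and a vertex cover $C \subseteq V(G)$ of $G[A, V(G) \setminus A]$ with $3 \le |C| = k$, the algorithm computes, in at most $n^{c} \cdot \max(1,|S|) \cdot 2^{dk}$ steps, that is, in $n^{O(1)} \cdot |S| \cdot 2^{O(k)}$ time, a subset $\hat S \subseteq S$ with $|\hat S| \le 6^k$ that preserves $S$. Here algorithms are programs of a random access machine over the natural numbers with unit-cost addition, (truncated) subtraction, comparison with zero and indirect array access. Vertices are $0,\dots,n-1$, graphs and edge sets are given by adjacency matrices, and vertex sets by $0/1$ vectors. -/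

import Mathlib

/-! ### Certificates, witnesses and preservation

Graphs are finite simple graphs on a vertex type `V`; a set of edges is a finite set of unordered
pairs of vertices. -/

/-- `H` is the edge set of a Hamiltonian cycle of `G`: a *witness*. -/
def IsWitness {V : Type*} [DecidableEq V] (G : SimpleGraph V) (H : Finset (Sym2 V)) : Prop :=
  ∃ (v : V) (p : G.Walk v v), p.IsHamiltonianCycle ∧ p.edges.toFinset = H

/-- `F` is the union of the edge sets of a collection of pairwise vertex-disjoint paths of `G`. -/
def IsDisjointPaths {V : Type*} (G : SimpleGraph V) (F : Finset (Sym2 V)) : Prop :=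
  ∃ Q : Set (Σ u : V, Σ v : V, G.Walk u v),
    (∀ p ∈ Q, p.2.2.IsPath) ∧
    (Q.Pairwise fun p q => p.2.2.support.Disjoint q.2.2.support) ∧
    ∀ e : Sym2 V, e ∈ F ↔ ∃ p ∈ Q, e ∈ p.2.2.edges

/-- A *certificate* is a set of edges forming vertex-disjoint paths or a Hamiltonian cycle. -/
def IsCertificate {V : Type*} [DecidableEq V] (G : SimpleGraph V) (F : Finset (Sym2 V)) : Prop :=
  IsDisjointPaths G F ∨ IsWitness G F

/-- `cert G X`: the certificates contained in the edge set of the induced subgraph `G[X]`. -/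
def cert {V : Type*} [DecidableEq V] (G : SimpleGraph V) (X : Set V) :
    Set (Finset (Sym2 V)) :=
  {F | IsCertificate G F ∧ ∀ e ∈ F, e ∈ G.edgeSet ∧ ∀ v ∈ e, v ∈ X}

/-- `conc G A B SA SB`: the certificates in `cert (A ∪ B)` of the form `sa ∪ sb ∪ E'` with
`sa ∈ SA`, `sb ∈ SB` and `E'` a set of edges of the bipartite graph `G[A, B]`. -/
def conc {V : Type*} [DecidableEq V] (G : SimpleGraph V) (A B : Set V)
    (SA SB : Set (Finset (Sym2 V))) : Set (Finset (Sym2 V)) :=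
  {F | F ∈ cert G (A ∪ B) ∧ ∃ sa ∈ SA, ∃ sb ∈ SB, ∃ E' : Finset (Sym2 V),
    (∀ e ∈ E', e ∈ (G.between A B).edgeSet) ∧ F = sa ∪ sb ∪ E'}

/-- `S₁` preserves `S₂` (both subsets of `cert G A`): every certificate of the complement of `A`
that can be completed to a Hamiltonian cycle with a member of `S₂` can be completed to a
Hamiltonian cycle with a member of `S₁`. -/
def Preserves {V : Type*} [DecidableEq V] (G : SimpleGraph V) (A : Set V)
    (S₁ S₂ : Set (Finset (Sym2 V))) : Prop :=
  ∀ b ∈ cert G Aᶜ,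
    (∃ H ∈ conc G A Aᶜ S₂ {b}, IsWitness G H) → ∃ H ∈ conc G A Aᶜ S₁ {b}, IsWitness G H

/-! ### The machine model: structured programs for a unit-cost random access machine

A program uses finitely many integer registers and finitely many one-dimensional arrays of natural
numbers. The operations are addition, truncated subtraction and (indirect) array access. -/

namespace RAM

/-- A memory state: the contents of the registers and of the arrays. -/
structure State where
  reg : ℕ → ℕ
  arr : ℕ → ℕ → ℕ

/-- Expressions. `get a i` is the entry of array `a` at the index given by `i`. -/
inductive Expr where
  | const (c : ℕ)
  | reg (x : ℕ)
  | get (a : ℕ) (i : Expr)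
  | add (e f : Expr)
  | sub (e f : Expr)

/-- The value of an expression. -/
def Expr.eval (σ : State) : Expr → ℕ
  | .const c => c
  | .reg x => σ.reg x
  | .get a i => σ.arr a (i.eval σ)
  | .add e f => e.eval σ + f.eval σ
  | .sub e f => e.eval σ - f.eval σ

/-- The number of elementary operations in the evaluation of an expression. -/
def Expr.cost : Expr → ℕ
  | .const _ => 1
  | .reg _ => 1
  | .get _ i => i.cost + 1
  | .add e f => e.cost + f.cost + 1
  | .sub e f => e.cost + f.cost + 1

/-- Programs. A guard holds when its value is nonzero. -/
inductive Program where
  | skip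
  | assign (x : ℕ) (e : Expr)
  | store (a : ℕ) (i e : Expr)
  | seq (P Q : Program)
  | ite (e : Expr) (P Q : Program)
  | loop (e : Expr) (P : Program)

/-- Overwriting a register. -/
def State.setReg (σ : State) (x v : ℕ) : State :=
  { σ with reg := Function.update σ.reg x v }

/-- Overwriting an array entry. -/
def State.setArr (σ : State) (a i v : ℕ) : State :=
  { σ with arr := Function.update σ.arr a (Function.update (σ.arr a) i v) }

/-- `Exec P σ τ t`: the program `P`, started in state `σ`, halts in state `τ` after exactly `t`
elementary steps. -/
inductive Exec : Program → State → State → ℕ → Prop where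
  | skip (σ : State) : Exec .skip σ σ 1
  | assign (x : ℕ) (e : Expr) (σ : State) :
      Exec (.assign x e) σ (σ.setReg x (e.eval σ)) (e.cost + 1)
  | store (a : ℕ) (i e : Expr) (σ : State) :
      Exec (.store a i e) σ (σ.setArr a (i.eval σ) (e.eval σ)) (i.cost + e.cost + 1)
  | seq {P Q : Program} {σ τ υ : State} {s t : ℕ} :
      Exec P σ τ s → Exec Q τ υ t → Exec (.seq P Q) σ υ (s + t)
  | iteTrue {e : Expr} {P Q : Program} {σ τ : State} {t : ℕ} :
      e.eval σ ≠ 0 → Exec P σ τ t → Exec (.ite e P Q) σ τ (e.cost + 1 + t)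
  | iteFalse {e : Expr} {P Q : Program} {σ τ : State} {t : ℕ} :
      e.eval σ = 0 → Exec Q σ τ t → Exec (.ite e P Q) σ τ (e.cost + 1 + t)
  | loopDone {e : Expr} {P : Program} {σ : State} :
      e.eval σ = 0 → Exec (.loop e P) σ σ (e.cost + 1)
  | loopStep {e : Expr} {P : Program} {σ τ υ : State} {s t : ℕ} :
      e.eval σ ≠ 0 → Exec P σ τ s → Exec (.loop e P) τ υ t →
      Exec (.loop e P) σ υ (e.cost + 1 + s + t)

end RAM

/-! ### Input and output encoding

Vertices are `0, …, n - 1`; vertex sets are 0/1 vectors of length `n`, and sets of edges are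
0/1 adjacency matrices stored row by row. A list of edge sets is stored as the concatenation of its
matrices. -/

open Classical in
/-- The 0/1 array with ones exactly at the indices in `T`. -/
noncomputable def bitArray (T : Set ℕ) (j : ℕ) : ℕ := if j ∈ T then 1 else 0

/-- The array that stores a vertex set. -/
noncomputable def vertexSetArray {n : ℕ} (X : Finset (Fin n)) : ℕ → ℕ :=
  bitArray {j | ∃ v ∈ X, j = (v : ℕ)}

/-- The array that stores the adjacency matrix of a graph. -/
noncomputable def graphArray {n : ℕ} (G : SimpleGraph (Fin n)) : ℕ → ℕ :=
  bitArray {j | ∃ u v : Fin n, G.Adj u v ∧ j = (u : ℕ) * n + v}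

/-- The array that stores a list of edge sets, `n * n` entries for each of them. -/
noncomputable def familyArray {n : ℕ} (L : List (Finset (Sym2 (Fin n)))) : ℕ → ℕ :=
  bitArray {j | ∃ (i : Fin L.length) (u v : Fin n),
    s(u, v) ∈ L.get i ∧ j = ((i : ℕ) * n + u) * n + v}

/-- The initial memory: register 0 holds `n`, register 1 the number of certificates in `L`;
arrays 0, 1, 2, 3 hold the graph, the set `A`, the set `C` and the list `L`; all else is zero. -/
noncomputable def inputState {n : ℕ} (G : SimpleGraph (Fin n)) (A C : Finset (Fin n))
    (L : List (Finset (Sym2 (Fin n)))) : RAM.State where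
  reg x := match x with
    | 0 => n
    | 1 => L.length
    | _ => 0
  arr a := match a with
    | 0 => graphArray G
    | 1 => vertexSetArray A
    | 2 => vertexSetArray C
    | 3 => familyArray L
    | _ => fun _ => 0

/-- The memory `τ` outputs the family `S`: register 2 holds `|S|`, and array 4 stores a list of the
members of `S` without repetition. -/
def OutputsFamily {n : ℕ} (τ : RAM.State) (S : Finset (Finset (Sym2 (Fin n)))) : Prop :=
  ∃ L : List (Finset (Sym2 (Fin n))), L.Nodup ∧ L.toFinset = S ∧
    τ.reg 2 = S.card ∧ ∀ j < S.card * n * n, τ.arr 4 j = familyArray L j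

/-! The argument is the rank-based method over the field with two elements, with connectivity tested
by counting cuts modulo two. By the cover property, every edge across the cut between `A` and its
complement either runs from `A \ C` to `C \ A` (a cover edge) or has its end in `A` inside `C` (a
dual cover edge). A completion of `s ∈ cert(A)` by `b` is therefore a union `p ∪ q`, where `p` is
`s` plus cover edges, `q` is `b` plus dual cover edges, and `p` and `q` have only vertices of `C` in
common.

Each vertex of `C` receives one of six states, a degree 0, 1, 2 and a side of a cut. The state
vector of `p` is the 0/1 vector of the states that have the degrees of `p` and whose sides come from
a cut not crossed by `p`; `q` defines a linear functional by summation over the states with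
complementary degrees whose sides come from a cut not crossed by `q`, with the side of `z 0` fixed.
If all degrees in `p ∪ q` are two, the value of the functional counts uncrossed cuts of `p ∪ q`.
Certificates contain no proper closed cycles, so every component of `p ∪ q` meets `C`, and the count
is 2 to the power (components minus one). It is odd exactly for a Hamiltonian cycle
(`pairing_stateVec_ne_zero_iff`). Let `coverSpan` of `s` be the span of the state vectors of all
admissible `p` built from `s`. A functional that is nonzero on the span of a family is nonzero on a
generator, so a subfamily with the same total span preserves the family
(`preserves_of_coverSpan_le`). Keeping `s` only if its space enlarges the span so far leaves at most
`6 ^ k` members.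

There may be too many choices of cover edges to list them all, so the space of `s` is computed
differently. The vertices of `A \ C` that `s` leaves without degree two each need a cover edge, and
each vertex of `C` takes at most two; with more than `2 * k` such deficient vertices `s` has no
completion and is skipped. Otherwise cover and deficient vertices form a boundary of size `m ≤ 3 *
k`, with at most `216 ^ k` states. There the insertion of an edge is the linear map `attach`, so the
span over all edge subsets arises from one vector by steps `W ↦ W + attach W`, one for each edge
(`extSpan_insert`). The map `project` then imposes degree two on the deficient vertices and forgets
them; it is faithful because each of them is connected to the cover, which determines its side
(`project_stateVec`, `map_project_extSpan`).

The rest implements this. Programs are written in a language with bounded loops, whose translation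
to the machine is correct and has running time polynomial in the loop limits (`Code.compile_exec`,
`Code.time_le`). Spans are kept as rows in echelon form (`insertCode_spec`), and states are coded as
numbers in base six, on which `attach` and `project` become `shift` and `foldMap`. -/

/-! ### Degrees and connectivity of edge sets -/

/-- The number of neighbours of `v` along the edges of `F`. -/
def edgeDeg {V : Type*} [Fintype V] [DecidableEq V] (F : Finset (Sym2 V)) (v : V) : ℕ :=
  (Finset.univ.filter fun u => s(v, u) ∈ F).card

/-- `K` is a union of connected components of the graph with edge set `F`. -/
def EdgeClosed {V : Type*} (F : Finset (Sym2 V)) (K : Set V) : Prop :=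
  ∀ u v, s(u, v) ∈ F → u ∈ K → v ∈ K

/-- The graph with edge set `F` on all of `V` is connected. -/
def EdgeConnected {V : Type*} (F : Finset (Sym2 V)) : Prop :=
  ∀ K : Set V, K.Nonempty → EdgeClosed F K → K = Set.univ

section Graph

variable {V : Type*} [Fintype V] [DecidableEq V] {G : SimpleGraph V} {F : Finset (Sym2 V)}

theorem EdgeClosed.compl {V : Type*} {F : Finset (Sym2 V)} {K : Set V} (h : EdgeClosed F K) :
    EdgeClosed F Kᶜ := by
  intro u v huv hu hv
  exact hu (h v u (by rwa [Sym2.eq_swap]) hv)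

theorem EdgeClosed.mem_iff_of_walk {V : Type*} {G : SimpleGraph V} {F : Finset (Sym2 V)}
    {K : Set V} (h : EdgeClosed F K) {u v : V} (p : G.Walk u v) (hp : ∀ e ∈ p.edges, e ∈ F) :
    ∀ x ∈ p.support, (x ∈ K ↔ u ∈ K) := by
  induction p with
  | nil => simp
  | cons hadj p ih =>
    rename_i a b c
    intro x hx
    rw [SimpleGraph.Walk.support_cons, List.mem_cons] at hx
    have hab : s(a, b) ∈ F := hp _ (by simp)
    have hba : s(b, a) ∈ F := by rwa [Sym2.eq_swap]
    rcases hx with rfl | hx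
    · rfl
    · rw [ih (fun e he => hp e (by simp [he])) x hx]
      exact ⟨h b a hba, h a b hab⟩

theorem edgeDeg_eq_ncard (F : Finset (Sym2 V)) (v : V) :
    edgeDeg F v = {u | s(v, u) ∈ F}.ncard := by
  rw [edgeDeg, ← Set.ncard_coe_finset]
  simp

theorem edgeDeg_mono {F H : Finset (Sym2 V)} (h : F ⊆ H) (v : V) : edgeDeg F v ≤ edgeDeg H v :=
  Finset.card_le_card fun u hu => by simp at hu ⊢; exact h hu

theorem edgeDeg_union {F H : Finset (Sym2 V)} (h : Disjoint F H) (v : V) :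
    edgeDeg (F ∪ H) v = edgeDeg F v + edgeDeg H v := by
  rw [edgeDeg, edgeDeg, edgeDeg, ← Finset.card_union_of_disjoint]
  · congr 1
    ext u
    simp
  · rw [Finset.disjoint_left]
    intro u hu hu'
    simp at hu hu'
    exact Finset.disjoint_left.1 h hu hu'

theorem edgeDeg_congr {F H : Finset (Sym2 V)} {v : V} (h : ∀ u, s(v, u) ∈ F ↔ s(v, u) ∈ H) :
    edgeDeg F v = edgeDeg H v := by
  simp only [edgeDeg, h]

theorem edgeDeg_eq_zero {F : Finset (Sym2 V)} {v : V} (h : ∀ u, s(v, u) ∉ F) :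
    edgeDeg F v = 0 := by
  simp [edgeDeg, h]

theorem edgeDeg_insert {a b : V} (hab : a ≠ b) (h : s(a, b) ∉ F) (v : V) :
    edgeDeg (insert s(a, b) F) v =
      edgeDeg F v + (if v = a then 1 else 0) + (if v = b then 1 else 0) := by
  have h1 : edgeDeg ({s(a, b)} : Finset (Sym2 V)) v =
      (if v = a then 1 else 0) + (if v = b then 1 else 0) := by
    by_cases ha : v = a
    · subst ha
      rw [if_pos rfl, if_neg hab, edgeDeg, Finset.card_eq_one]
      refine ⟨b, ?_⟩
      ext u
      simp only [Finset.mem_filter, Finset.mem_univ, true_and, Finset.mem_singleton, Sym2.eq_iff]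
      grind
    · by_cases hb : v = b
      · subst hb
        rw [if_neg ha, if_pos rfl, edgeDeg, Finset.card_eq_one]
        refine ⟨a, ?_⟩
        ext u
        simp only [Finset.mem_filter, Finset.mem_univ, true_and, Finset.mem_singleton, Sym2.eq_iff]
        grind
      · rw [if_neg ha, if_neg hb]
        apply edgeDeg_eq_zero
        intro u
        simp only [Finset.mem_singleton, Sym2.eq_iff]
        grind
  rw [Finset.insert_eq, Finset.union_comm, edgeDeg_union (by simpa using h), h1, add_assoc]

theorem IsWitness.edgeConnected {V : Type*} [DecidableEq V] {G : SimpleGraph V}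
    {F : Finset (Sym2 V)} (h : IsWitness G F) : EdgeConnected F := by
  obtain ⟨v, p, hp, rfl⟩ := h
  intro K hK hcl
  obtain ⟨x, hx⟩ := hK
  have key := hcl.mem_iff_of_walk p (by simp)
  ext y
  simp only [Set.mem_univ, iff_true]
  rw [key y (hp.mem_support y), ← key x (hp.mem_support x)]
  exact hx

theorem IsWitness.subset_edgeSet {V : Type*} [DecidableEq V] {G : SimpleGraph V}
    {F : Finset (Sym2 V)} (h : IsWitness G F) : ∀ e ∈ F, e ∈ G.edgeSet := by
  obtain ⟨v, p, hp, rfl⟩ := h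
  intro e he
  exact p.edges_subset_edgeSet (by simpa using he)

theorem IsWitness.edgeDeg_eq (h : IsWitness G F) (v : V) : edgeDeg F v = 2 := by
  obtain ⟨w, p, hp, rfl⟩ := h
  rw [edgeDeg_eq_ncard, ← hp.isCycle.ncard_neighborSet_toSubgraph_eq_two (hp.mem_support v)]
  congr 1
  ext u
  rw [SimpleGraph.Subgraph.mem_neighborSet, ← SimpleGraph.Subgraph.mem_edgeSet,
    SimpleGraph.Walk.mem_edges_toSubgraph]
  simp

/-- With all degrees equal to two every component is a cycle, and connectedness leaves a single
component, so the cycle through one vertex visits all. -/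
theorem isWitness_of_edgeConnected [Nonempty V] (hF : ∀ e ∈ F, e ∈ G.edgeSet)
    (hdeg : ∀ v, edgeDeg F v = 2) (hc : EdgeConnected F) : IsWitness G F := by
  classical
  set K : SimpleGraph V := SimpleGraph.fromEdgeSet (F : Set (Sym2 V)) with hK
  have hadj : ∀ u v, K.Adj u v ↔ s(u, v) ∈ F := by
    intro u v
    rw [hK, SimpleGraph.fromEdgeSet_adj]
    refine ⟨fun h => h.1, fun h => ⟨h, ?_⟩⟩
    exact (SimpleGraph.mem_edgeSet G).1 (hF _ h) |>.ne
  have hle : K ≤ G := by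
    intro u v huv
    exact (SimpleGraph.mem_edgeSet G).1 (hF _ ((hadj u v).1 huv))
  have hnb : ∀ v, (K.neighborSet v).ncard = 2 := by
    intro v
    rw [← hdeg v, edgeDeg_eq_ncard]
    congr 1
    ext u
    exact hadj v u
  have hcyc : K.IsCycles := fun v _ => hnb v
  obtain ⟨v⟩ := ‹Nonempty V›
  obtain ⟨p, hp, hverts⟩ := hcyc.exists_cycle_toSubgraph_verts_eq_connectedComponentSupp
    (c := K.connectedComponentMk v) (v := v) rfl
    (Set.nonempty_of_ncard_ne_zero (by rw [hnb v]; norm_num))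
  have huniv : (K.connectedComponentMk v).supp = Set.univ := by
    refine hc (K.connectedComponentMk v).supp ⟨v, rfl⟩ ?_
    intro a b hab ha
    rw [SimpleGraph.ConnectedComponent.mem_supp_iff] at ha ⊢
    rw [← ha]
    exact (SimpleGraph.ConnectedComponent.connectedComponentMk_eq_of_adj ((hadj a b).2 hab)).symm
  have hsup : ∀ x, x ∈ p.support := by
    intro x
    rw [← SimpleGraph.Walk.mem_verts_toSubgraph, hverts, huniv]
    trivial
  have hham : p.IsHamiltonianCycle := by
    refine ⟨hp, ?_⟩
    apply hp.isPath_tail.isHamiltonian_of_mem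
    intro w
    have := hsup w
    rw [← SimpleGraph.Walk.cons_support_tail hp.not_nil, List.mem_cons] at this
    rcases this with rfl | h
    · exact SimpleGraph.Walk.end_mem_support _
    · exact h
  refine ⟨v, p.mapLe hle, ?_, ?_⟩
  · exact hham.map (f := SimpleGraph.Hom.ofLE hle) Function.bijective_id
  · ext e
    rw [List.mem_toFinset, SimpleGraph.Walk.edges_mapLe_eq_edges]
    constructor
    · intro he
      have := p.edges_subset_edgeSet he
      induction e using Sym2.ind with
      | _ a b => exact (hadj a b).1 this
    -- The cycle visits `a` and already uses two edges there, so every edge of `F` at `a` belongs to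
    -- it.
    · induction e using Sym2.ind with
      | _ a b =>
        intro he
        have := (hp.adj_toSubgraph_iff_of_isCycles hcyc
          ((SimpleGraph.Walk.mem_verts_toSubgraph p).2 (hsup a)) b).2 ((hadj a b).2 he)
        rwa [← SimpleGraph.Subgraph.mem_edgeSet, SimpleGraph.Walk.mem_edges_toSubgraph] at this

/-- A certificate has no proper closed cycle: a nonempty union of components in which all degrees
are two is everything. -/
theorem IsCertificate.eq_univ_of_edgeDeg_eq_two (h : IsCertificate G F) {K : Set V}
    (hne : K.Nonempty) (hcl : EdgeClosed F K) (hdeg : ∀ v ∈ K, edgeDeg F v = 2) :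
    K = Set.univ := by
  rcases h with ⟨Q, hpath, hdisj, hF⟩ | h
  · exfalso
    obtain ⟨x, hx⟩ := hne
    have : 0 < edgeDeg F x := by rw [hdeg x hx]; norm_num
    rw [edgeDeg, Finset.card_pos] at this
    obtain ⟨y, hy⟩ := this
    simp only [Finset.mem_filter, Finset.mem_univ, true_and] at hy
    obtain ⟨⟨u, v, p⟩, hpQ, hep⟩ := (hF _).1 hy
    simp only at hep
    have hxs : x ∈ p.support := p.fst_mem_support_of_mem_edges hep
    -- The contradiction comes from the first vertex `u` of the path through `x`: it lies in `K`,
    -- but no other path of the collection meets `u`, so its degree is at most one.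
    have hu : u ∈ K := (hcl.mem_iff_of_walk p (fun e he => (hF e).2 ⟨_, hpQ, he⟩) x hxs).1 hx
    have h2 := hdeg u hu
    have hle : edgeDeg F u ≤ 1 := by
      rw [edgeDeg, Finset.card_le_one]
      have hsnd : ∀ a, s(u, a) ∈ F → p.snd = a := by
        intro a ha
        obtain ⟨q, hq, heq⟩ := (hF _).1 ha
        have hqp : q = ⟨u, v, p⟩ := by
          by_contra hne
          exact hdisj hq hpQ hne (q.2.2.fst_mem_support_of_mem_edges heq) p.start_mem_support
        subst hqp
        apply (hpath _ hpQ).snd_of_toSubgraph_adj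
        rw [← SimpleGraph.Subgraph.mem_edgeSet, SimpleGraph.Walk.mem_edges_toSubgraph]
        exact heq
      intro a ha b hb
      simp only [Finset.mem_filter, Finset.mem_univ, true_and] at ha hb
      rw [← hsnd a ha, ← hsnd b hb]
    omega
  · exact h.edgeConnected K hne hcl

end Graph

/-! ### State vectors

Vertices `z 0, …, z (m - 1)` form a boundary. A state `g : Fin m → Fin 6` prescribes for each of
them a degree `g i % 3` and a side `g i / 3` of a cut. -/

/-- No edge of `F` crosses the partition into the fibres of `c`. -/
def Consistent {V : Type*} (F : Finset (Sym2 V)) (c : V → ℕ) : Prop :=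
  ∀ u v, s(u, v) ∈ F → c u = c v

/-- The edge set `F` has the degrees prescribed by `g`, and a cut that `F` does not cross has the
sides prescribed by `g`. -/
def Fits {V : Type*} [Fintype V] [DecidableEq V] (z : ℕ → V) (m : ℕ) (F : Finset (Sym2 V))
    (g : Fin m → Fin 6) : Prop :=
  (∀ i : Fin m, edgeDeg F (z i) = (g i).val % 3) ∧
    ∃ c, Consistent F c ∧ ∀ i : Fin m, c (z i) = (g i).val / 3

open Classical in
/-- The indicator vector of the states that `F` fits. -/
noncomputable def stateVec {V : Type*} [Fintype V] [DecidableEq V] (z : ℕ → V) (m : ℕ)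
    (F : Finset (Sym2 V)) : (Fin m → Fin 6) → ZMod 2 :=
  fun g => if Fits z m F g then 1 else 0

/-- Lowering the prescribed degrees at two positions. -/
def lowerAt {m : ℕ} (a b : Fin m) (g : Fin m → Fin 6) : Fin m → Fin 6 :=
  fun i => if i = a ∨ i = b then g i - 1 else g i

/-- Both positions have positive prescribed degree and they are on the same side. -/
def CanLower {m : ℕ} (a b : Fin m) (g : Fin m → Fin 6) : Prop :=
  (g a).val / 3 = (g b).val / 3 ∧ 1 ≤ (g a).val % 3 ∧ 1 ≤ (g b).val % 3

open Classical in
/-- The effect on state vectors of the insertion of an edge between two boundary vertices. -/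
noncomputable def attach {m : ℕ} (a b : Fin m) :
    ((Fin m → Fin 6) → ZMod 2) →ₗ[ZMod 2] ((Fin m → Fin 6) → ZMod 2) where
  toFun v g := if CanLower a b g then v (lowerAt a b g) else 0
  map_add' v w := by ext g; by_cases h : CanLower a b g <;> simp [h]
  map_smul' r v := by ext g; by_cases h : CanLower a b g <;> simp [h]

/-- The state `g` on a longer boundary extends `h` and has degree two at all further positions. -/
def Extends {k m : ℕ} (hkm : k ≤ m) (h : Fin k → Fin 6) (g : Fin m → Fin 6) : Prop :=
  (∀ i : Fin k, g (Fin.castLE hkm i) = h i) ∧ ∀ i : Fin m, k ≤ i.val → (g i).val % 3 = 2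

open Classical in
/-- Summation over all sides of the boundary vertices from position `k` on, whose degree must be
two. -/
noncomputable def project {k m : ℕ} (hkm : k ≤ m) :
    ((Fin m → Fin 6) → ZMod 2) →ₗ[ZMod 2] ((Fin k → Fin 6) → ZMod 2) where
  toFun v h := ∑ g with Extends hkm h g, v g
  map_add' v w := by ext g; simp [Finset.sum_add_distrib]
  map_smul' r v := by ext g; simp [Finset.mul_sum]

section StateVec

variable {V : Type*} [Fintype V] [DecidableEq V] {z : ℕ → V} {m k : ℕ} {F : Finset (Sym2 V)}

/-- A state is three times the side plus the degree, so subtracting one lowers a positive degree and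
keeps the side. The new edge raises the degrees of its two ends and forces every uncrossed cut to
put them on the same side. -/
theorem fits_insert_iff (hz : ∀ i < m, ∀ j < m, z i = z j → i = j) {a b : Fin m} (hab : a ≠ b)
    (he : s(z a, z b) ∉ F) (g : Fin m → Fin 6) :
    Fits z m (insert s(z a, z b) F) g ↔ CanLower a b g ∧ Fits z m F (lowerAt a b g) := by
  have hinj : ∀ i j : Fin m, z i = z j ↔ i = j := fun i j =>
    ⟨fun h => Fin.ext (hz i i.2 j j.2 h), fun h => by rw [h]⟩
  have hne : z a ≠ z b := fun h => hab ((hinj a b).1 h)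
  have key : ∀ x : Fin 6, 1 ≤ x.val % 3 → (x - 1).val % 3 + 1 = x.val % 3 ∧
      (x - 1).val / 3 = x.val / 3 := by decide
  have hdeg : ∀ i : Fin m, edgeDeg (insert s(z a, z b) F) (z i) =
      edgeDeg F (z i) + if i = a ∨ i = b then 1 else 0 := by
    intro i
    rw [edgeDeg_insert hne he]
    simp only [hinj]
    by_cases h1 : i = a
    · subst h1; simp [hab]
    · simp [h1]
  constructor
  · rintro ⟨h1, c, hc, h2⟩
    have hca : c (z a) = c (z b) := hc _ _ (Finset.mem_insert_self _ _)
    have hcan : CanLower a b g := by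
      refine ⟨?_, ?_, ?_⟩
      · rw [← h2, ← h2, hca]
      · rw [← h1, hdeg]; simp
      · rw [← h1, hdeg]; simp
    refine ⟨hcan, ?_, c, fun u v huv => hc u v (Finset.mem_insert_of_mem huv), ?_⟩
    · intro i
      have h3 := h1 i
      rw [hdeg] at h3
      unfold lowerAt
      split_ifs with hi
      · rw [if_pos hi] at h3
        have := key (g i) (by omega)
        omega
      · simpa [hi] using h3
    · intro i
      rw [h2]
      unfold lowerAt
      split_ifs with hi
      · exact (key (g i) (by rcases hi with rfl | rfl; exacts [hcan.2.1, hcan.2.2])).2.symm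
      · rfl
  · rintro ⟨hcan, h1, c, hc, h2⟩
    have h2' : ∀ i : Fin m, c (z i) = (g i).val / 3 := by
      intro i
      rw [h2]
      unfold lowerAt
      split_ifs with hi
      · exact (key (g i) (by rcases hi with rfl | rfl; exacts [hcan.2.1, hcan.2.2])).2
      · rfl
    refine ⟨?_, c, ?_, h2'⟩
    · intro i
      rw [hdeg, h1 i]
      unfold lowerAt
      split_ifs with hi
      · exact (key (g i) (by rcases hi with rfl | rfl; exacts [hcan.2.1, hcan.2.2])).1
      · rfl
    · intro u v huv
      rcases Finset.mem_insert.1 huv with h | h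
      · have hca : c (z a) = c (z b) := by rw [h2', h2', hcan.1]
        rcases Sym2.eq_iff.1 h with ⟨rfl, rfl⟩ | ⟨rfl, rfl⟩
        · exact hca
        · exact hca.symm
      · exact hc u v h

theorem stateVec_insert (hz : ∀ i < m, ∀ j < m, z i = z j → i = j) {a b : Fin m} (hab : a ≠ b)
    (he : s(z a, z b) ∉ F) :
    stateVec z m (insert s(z a, z b) F) = attach a b (stateVec z m F) := by
  ext g
  have hiff := fits_insert_iff hz hab he g
  simp only [stateVec, attach, LinearMap.coe_mk, AddHom.coe_mk]
  by_cases h : CanLower a b g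
  · by_cases hf : Fits z m F (lowerAt a b g)
    · rw [if_pos (hiff.2 ⟨h, hf⟩), if_pos h, if_pos hf]
    · rw [if_neg fun h' => hf (hiff.1 h').2, if_pos h, if_neg hf]
  · rw [if_neg fun h' => h (hiff.1 h').1, if_neg h]

/-- This discards the edge subsets that leave some deficient vertex without degree two. -/
theorem project_stateVec_eq_zero (hkm : k ≤ m) {i : ℕ} (hki : k ≤ i) (him : i < m)
    (hdeg : edgeDeg F (z i) ≠ 2) : project hkm (stateVec z m F) = 0 := by
  ext h
  simp only [project, LinearMap.coe_mk, AddHom.coe_mk, Pi.zero_apply]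
  apply Finset.sum_eq_zero
  intro g hg
  simp only [Finset.mem_filter, Finset.mem_univ, true_and] at hg
  rw [stateVec, if_neg]
  intro hf
  exact hdeg (by rw [hf.1 ⟨i, him⟩, hg.2 ⟨i, him⟩ hki])

/-- By `hconn` each forgotten vertex lies in the component of some remaining one, so its side is
determined by the state there. Hence the sum has exactly one nonzero term if `F` fits the shorter
state, and none otherwise; no cancellation modulo two can occur. -/
theorem project_stateVec (hkm : k ≤ m)
    (hdeg : ∀ i, k ≤ i → i < m → edgeDeg F (z i) = 2)
    (hconn : ∀ i, k ≤ i → i < m → ∀ K, EdgeClosed F K → z i ∈ K → ∃ j < k, z j ∈ K) :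
    project hkm (stateVec z m F) = stateVec z k F := by
  ext h
  simp only [project, LinearMap.coe_mk, AddHom.coe_mk]
  by_cases hf : Fits z k F h
  · obtain ⟨h1, c, hc, h2⟩ := hf
    have hlt : ∀ x : Fin 6, x.val / 3 ≤ 1 := by decide
    -- Cuts take values in `ℕ`; on a forgotten vertex the value is one prescribed at a remaining
    -- position, hence 0 or 1. This makes the state `3 * c (z i) + 2` (side `c`, degree two)
    -- legitimate below.
    have hc1 : ∀ i, k ≤ i → i < m → c (z i) ≤ 1 := by
      intro i hki him
      obtain ⟨j, hj, hj'⟩ := hconn i hki him {v | c v = c (z i)}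
        (fun u v huv hu => by
          simp only [Set.mem_ofPred_eq] at hu ⊢; rw [← hc u v huv, hu]) rfl
      simp only [Set.mem_ofPred_eq] at hj'
      rw [← hj', h2 ⟨j, hj⟩]
      exact hlt _
    let g0 : Fin m → Fin 6 := fun i => if hi : i.val < k then h ⟨i, hi⟩ else
      ⟨3 * c (z i) + 2, by have := hc1 i (by omega) i.2; omega⟩
    have hg0 : Extends hkm h g0 := by
      refine ⟨fun i => ?_, fun i hi => ?_⟩
      · simp [g0]
      · simp [g0, Nat.not_lt.2 hi]
    have hfit : Fits z m F g0 := by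
      refine ⟨fun i => ?_, c, hc, fun i => ?_⟩
      · by_cases hi : i.val < k
        · simp only [g0, hi, dif_pos]
          exact h1 ⟨i, hi⟩
        · rw [hg0.2 i (by omega), hdeg i (by omega) i.2]
      · by_cases hi : i.val < k
        · simp only [g0, hi, dif_pos]
          exact h2 ⟨i, hi⟩
        · simp only [g0, hi, dif_neg, not_false_eq_true]
          omega
    rw [Finset.sum_eq_single g0]
    · simp only [stateVec]
      rw [if_pos hfit, if_pos ⟨h1, c, hc, h2⟩]
    · intro g hg hne
      simp only [Finset.mem_filter, Finset.mem_univ, true_and] at hg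
      rw [stateVec, if_neg]
      rintro ⟨h3, c', hc', h4⟩
      apply hne
      funext i
      by_cases hi : i.val < k
      · have := hg.1 ⟨i, hi⟩
        simp only [g0, hi, dif_pos, ← this]
        rfl
      · have hi' : k ≤ i.val := by omega
        obtain ⟨j, hj, hj1, hj2⟩ := hconn i hi' i.2
          {v | c v = c (z i) ∧ c' v = c' (z i)}
          (fun u v huv hu => by
            simp only [Set.mem_ofPred_eq] at hu ⊢; rw [← hc u v huv, ← hc' u v huv]; exact hu)
          ⟨rfl, rfl⟩
        have h5 : c' (z i) = c (z i) := by
          rw [← hj1, ← hj2, h2 ⟨j, hj⟩, h4 ⟨j, by omega⟩, ← hg.1 ⟨j, hj⟩]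
          rfl
        have h6 := h4 i
        have h7 := hg.2 i hi'
        apply Fin.ext
        simp only [g0, hi, dif_neg, not_false_eq_true]
        omega
    · intro hn
      exact absurd (by simpa using hg0) hn
  · rw [stateVec, if_neg hf]
    apply Finset.sum_eq_zero
    intro g hg
    simp only [Finset.mem_filter, Finset.mem_univ, true_and] at hg
    rw [stateVec, if_neg]
    rintro ⟨h3, c', hc', h4⟩
    apply hf
    refine ⟨fun i => ?_, c', hc', fun i => ?_⟩
    · rw [← hg.1 i, ← h3]; rfl
    · rw [← hg.1 i, ← h4]; rfl

/-- All state vectors of extensions of `s` by edges of `E`. -/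
noncomputable def extSpan (z : ℕ → V) (m : ℕ) (s : Finset (Sym2 V)) (E : Finset (Sym2 V)) :
    Submodule (ZMod 2) ((Fin m → Fin 6) → ZMod 2) :=
  Submodule.span (ZMod 2) {v | ∃ J ⊆ E, v = stateVec z m (s ∪ J)}

theorem extSpan_empty (z : ℕ → V) (m : ℕ) (s : Finset (Sym2 V)) :
    extSpan z m s ∅ = Submodule.span (ZMod 2) {stateVec z m s} := by
  unfold extSpan
  congr 1
  ext v
  simp [Finset.subset_empty]

/-- A subset of the enlarged edge set either omits the new edge or arises from a subset of `E` by
adding it, and adding it acts linearly on state vectors. One linear step per edge thus replaces an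
enumeration of all subsets. -/
theorem extSpan_insert (hz : ∀ i < m, ∀ j < m, z i = z j → i = j) {a b : Fin m} (hab : a ≠ b)
    {s E : Finset (Sym2 V)} (hs : s(z a, z b) ∉ s) (hE : s(z a, z b) ∉ E) :
    extSpan z m s (insert s(z a, z b) E) =
      extSpan z m s E ⊔ (extSpan z m s E).map (attach a b) := by
  have hins : ∀ J ⊆ E, attach a b (stateVec z m (s ∪ J)) =
      stateVec z m (s ∪ insert s(z a, z b) J) := by
    intro J hJ
    rw [Finset.union_insert, stateVec_insert hz hab]
    simp only [Finset.mem_union, not_or]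
    exact ⟨hs, fun h => hE (hJ h)⟩
  unfold extSpan
  rw [Submodule.map_span, ← Submodule.span_union]
  congr 1
  ext v
  constructor
  · rintro ⟨J, hJ, rfl⟩
    by_cases he : s(z a, z b) ∈ J
    · right
      have hJ' : J.erase s(z a, z b) ⊆ E := by
        intro e he'
        rw [Finset.mem_erase] at he'
        exact (Finset.mem_insert.1 (hJ he'.2)).resolve_left he'.1
      refine ⟨_, ⟨J.erase s(z a, z b), hJ', rfl⟩, ?_⟩
      rw [hins _ hJ', Finset.insert_erase he]
    · left
      refine ⟨J, fun e he' => ?_, rfl⟩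
      exact (Finset.mem_insert.1 (hJ he')).resolve_left (fun h => he (h ▸ he'))
  · rintro (⟨J, hJ, rfl⟩ | ⟨_, ⟨J, hJ, rfl⟩, rfl⟩)
    · exact ⟨J, hJ.trans (Finset.subset_insert _ _), rfl⟩
    · exact ⟨_, Finset.insert_subset_insert _ hJ, hins J hJ⟩

end StateVec

/-! ### Completions of certificates across a vertex cover -/

set_option linter.unusedSectionVars false

section Cover

variable {V : Type*} [Fintype V] [DecidableEq V] {G : SimpleGraph V} {A C : Finset V}
  {z : ℕ → V} {m k : ℕ}

/-- `z 0, …, z (m - 1)` is an enumeration of `C` without repetition. -/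
structure Enumerates (z : ℕ → V) (m : ℕ) (C : Finset V) : Prop where
  inj : ∀ i < m, ∀ j < m, z i = z j → i = j
  mem_iff : ∀ v, v ∈ C ↔ ∃ i < m, z i = v

theorem Enumerates.card_eq (h : Enumerates z m C) : C.card = m := by
  have : C = (Finset.range m).image z := by
    ext v
    rw [h.mem_iff]
    simp
  rw [this, Finset.card_image_of_injOn, Finset.card_range]
  intro i hi j hj hij
  exact h.inj i (by simpa using hi) j (by simpa using hj) hij

/-- The edges from `A \ C` to `C \ A`. -/
def IsCoverEdge (G : SimpleGraph V) (A C : Finset V) (e : Sym2 V) : Prop :=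
  ∃ u y, e = s(u, y) ∧ u ∈ A ∧ u ∉ C ∧ y ∈ C ∧ y ∉ A ∧ G.Adj u y

/-- The edges from `A ∩ C` to the complement of `A`. -/
def IsDualCoverEdge (G : SimpleGraph V) (A C : Finset V) (e : Sym2 V) : Prop :=
  ∃ x w, e = s(x, w) ∧ x ∈ A ∧ x ∈ C ∧ w ∉ A ∧ G.Adj x w

/-- The vertices of `A` outside the cover that `s` leaves without degree two. -/
def deficient (A C : Finset V) (s : Finset (Sym2 V)) : Finset V :=
  A.filter fun u => u ∉ C ∧ edgeDeg s u ≠ 2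

/-- The span of the state vectors on the cover of all extensions of `s` by edges from `A \ C` to
`C \ A` that complete the degrees in `A \ C`. -/
noncomputable def coverSpan (G : SimpleGraph V) (A C : Finset V) (z : ℕ → V) (k : ℕ)
    (s : Finset (Sym2 V)) : Submodule (ZMod 2) ((Fin k → Fin 6) → ZMod 2) :=
  Submodule.span (ZMod 2) {v | ∃ J : Finset (Sym2 V), (∀ e ∈ J, IsCoverEdge G A C e) ∧
    (∀ u ∈ A, u ∉ C → edgeDeg (s ∪ J) u = 2) ∧ v = stateVec z k (s ∪ J)}

theorem not_mem_left_of_mem_cert {X : Set V} {s : Finset (Sym2 V)} (hs : s ∈ cert G X) {u v : V}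
    (h : s(u, v) ∈ s) : u ∈ X ∧ v ∈ X ∧ G.Adj u v := by
  have := hs.2 _ h
  exact ⟨this.2 u (by simp), this.2 v (by simp), this.1⟩

/-- A union of components of a completed certificate meets the cover. -/
theorem exists_mem_cover_of_edgeClosed (hC : C.Nonempty) {X : Set V} {s J : Finset (Sym2 V)}
    (hs : s ∈ cert G X) (hJ : ∀ u v, s(u, v) ∈ J → u ∈ C ∨ v ∈ C)
    {K : Set V} (hK : EdgeClosed (s ∪ J) K) (hne : (K ∩ X).Nonempty)
    (hdeg : ∀ v ∈ K, v ∈ X → v ∉ C → edgeDeg (s ∪ J) v = 2) : ∃ v ∈ K, v ∈ C := by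
  by_contra! hcon
  -- If `K` avoids the cover, no edge of `J` touches it, so the degrees two on `K ∩ X` come from `s`
  -- alone. A certificate admits this only if `K ∩ X` is everything, but then `K` contains the
  -- cover.
  have huniv : K ∩ X = Set.univ := by
    apply hs.1.eq_univ_of_edgeDeg_eq_two hne
    · intro u v huv hu
      exact ⟨hK u v (Finset.mem_union_left _ huv) hu.1, (not_mem_left_of_mem_cert hs huv).2.1⟩
    · intro v hv
      rw [← hdeg v hv.1 hv.2 (hcon v hv.1)]
      apply edgeDeg_congr
      intro u
      rw [Finset.mem_union]
      refine ⟨Or.inl, fun h => h.resolve_right fun h' => ?_⟩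
      rcases hJ v u h' with h1 | h1
      · exact hcon v hv.1 h1
      · exact hcon u (hK v u (Finset.mem_union_right _ h') hv.1) h1
  obtain ⟨c, hc⟩ := hC
  have : c ∈ K ∩ X := by rw [huniv]; trivial
  exact hcon c this.1 hc

theorem IsCoverEdge.mem_cover {u v : V} (h : IsCoverEdge G A C s(u, v)) : u ∈ C ∨ v ∈ C := by
  obtain ⟨a, b, hab, -, -, hb, -⟩ := h
  rcases Sym2.eq_iff.1 hab with ⟨rfl, rfl⟩ | ⟨rfl, rfl⟩ <;> simp [hb]

theorem IsDualCoverEdge.mem_cover {u v : V} (h : IsDualCoverEdge G A C s(u, v)) :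
    u ∈ C ∨ v ∈ C := by
  obtain ⟨a, b, hab, -, hb, -⟩ := h
  rcases Sym2.eq_iff.1 hab with ⟨rfl, rfl⟩ | ⟨rfl, rfl⟩ <;> simp [hb]

/-- The edge set `q` complements the state `g` to degree two, and a cut that it does not cross has
the sides prescribed by `g`, where the first side is fixed. -/
def FitsDual (z : ℕ → V) (k : ℕ) (q : Finset (Sym2 V)) (g : Fin k → Fin 6) : Prop :=
  (∀ i : Fin k, i.val = 0 → (g i).val / 3 = 0) ∧
  (∀ i : Fin k, edgeDeg q (z i) + (g i).val % 3 = 2) ∧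
  ∃ c, Consistent q c ∧ ∀ i : Fin k, c (z i) = (g i).val / 3

open Classical in
/-- The linear functional that pairs a state vector with the edge set `q`. -/
noncomputable def pairing (z : ℕ → V) (k : ℕ) (q : Finset (Sym2 V)) :
    ((Fin k → Fin 6) → ZMod 2) →ₗ[ZMod 2] ZMod 2 where
  toFun v := ∑ g with FitsDual z k q g, v g
  map_add' v w := by simp [Finset.sum_add_distrib]
  map_smul' r v := by simp [Finset.mul_sum]

theorem consistent_union_iff {p q : Finset (Sym2 V)} {c : V → ℕ} :
    Consistent (p ∪ q) c ↔ Consistent p c ∧ Consistent q c := by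
  simp only [Consistent, Finset.mem_union]
  exact ⟨fun h => ⟨fun u v h' => h u v (Or.inl h'), fun u v h' => h u v (Or.inr h')⟩,
    fun h u v h' => h'.elim (h.1 u v) (h.2 u v)⟩

/-- Any vertex shared by `p` and `q` lies in `C`, where both cuts have the sides prescribed by `g`.
So the cut of `p` on `A` and the cut of `q` off `A` can be glued to a cut of `p ∪ q`. -/
theorem fits_and_fitsDual_iff (hE : Enumerates z k C) {p q : Finset (Sym2 V)}
    (hp : ∀ u v, s(u, v) ∈ p → u ∈ A ∨ u ∈ C) (hq : ∀ u v, s(u, v) ∈ q → u ∉ A ∨ u ∈ C)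
    (g : Fin k → Fin 6) :
    FitsDual z k q g ∧ Fits z k p g ↔ (∀ i : Fin k, i.val = 0 → (g i).val / 3 = 0) ∧
      (∀ i : Fin k, edgeDeg p (z i) = (g i).val % 3) ∧
      (∀ i : Fin k, edgeDeg q (z i) + (g i).val % 3 = 2) ∧
      ∃ c, Consistent (p ∪ q) c ∧ ∀ i : Fin k, c (z i) = (g i).val / 3 := by
  constructor
  · rintro ⟨⟨h1, h2, cq, hcq, hcq'⟩, h3, cp, hcp, hcp'⟩
    refine ⟨h1, h3, h2, fun v => if v ∈ A then cp v else cq v, ?_, ?_⟩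
    · have hcov : ∀ v ∈ C, cp v = cq v := by
        intro v hv
        obtain ⟨i, hi, rfl⟩ := (hE.mem_iff v).1 hv
        rw [hcp' ⟨i, hi⟩, hcq' ⟨i, hi⟩]
      have h4 : ∀ u v, s(u, v) ∈ p → (if u ∈ A then cp u else cq u) = cp u := by
        intro u v huv
        split_ifs with h
        · rfl
        · exact (hcov u ((hp u v huv).resolve_left h)).symm
      have h5 : ∀ u v, s(u, v) ∈ q → (if u ∈ A then cp u else cq u) = cq u := by
        intro u v huv
        split_ifs with h
        · exact hcov u ((hq u v huv).resolve_left (not_not.2 h))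
        · rfl
      rw [consistent_union_iff]
      constructor
      · intro u v huv
        beta_reduce
        rw [h4 u v huv, h4 v u (by rwa [Sym2.eq_swap]), hcp u v huv]
      · intro u v huv
        beta_reduce
        rw [h5 u v huv, h5 v u (by rwa [Sym2.eq_swap]), hcq u v huv]
    · intro i
      simp only
      split_ifs
      · exact hcp' i
      · exact hcq' i
  · rintro ⟨h1, h2, h3, c, hc, hc'⟩
    rw [consistent_union_iff] at hc
    exact ⟨⟨h1, h3, c, hc.2, hc'⟩, h2, c, hc.1, hc'⟩

/-- The pairing is the parity of the number of states common to both sides, that is, of sides on `C`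
induced by cuts not crossed by the union, with `z 0` on side 0. If a component avoids `z 0`,
switching its side pairs these states off; if the union is a Hamiltonian cycle, there is exactly
one. A nonzero value also yields a common state, which forces degree two on `C`. -/
theorem pairing_stateVec_ne_zero_iff (hE : Enumerates z k C) (hk : 0 < k)
    {s b J J' : Finset (Sym2 V)} (hs : s ∈ cert G (A : Set V)) (hb : b ∈ cert G (A : Set V)ᶜ)
    (hJ : ∀ e ∈ J, IsCoverEdge G A C e) (hJ' : ∀ e ∈ J', IsDualCoverEdge G A C e)
    (hdisj : Disjoint (s ∪ J) (b ∪ J'))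
    (hdA : ∀ u ∈ A, u ∉ C → edgeDeg (s ∪ J) u = 2)
    (hdB : ∀ u, u ∉ A → u ∉ C → edgeDeg (b ∪ J') u = 2) :
    pairing z k (b ∪ J') (stateVec z k (s ∪ J)) ≠ 0 ↔ IsWitness G ((s ∪ J) ∪ (b ∪ J')) := by
  classical
  have hC : C.Nonempty := ⟨z 0, (hE.mem_iff _).2 ⟨0, hk, rfl⟩⟩
  have hp : ∀ u v, s(u, v) ∈ s ∪ J → u ∈ A ∨ u ∈ C := by
    intro u v huv
    rcases Finset.mem_union.1 huv with h | h
    · exact Or.inl (not_mem_left_of_mem_cert hs h).1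
    · obtain ⟨a, y, hab, ha, -, hy, -⟩ := hJ _ h
      rcases Sym2.eq_iff.1 hab with ⟨rfl, rfl⟩ | ⟨rfl, rfl⟩ <;> simp [*]
  have hq : ∀ u v, s(u, v) ∈ b ∪ J' → u ∉ A ∨ u ∈ C := by
    intro u v huv
    rcases Finset.mem_union.1 huv with h | h
    · exact Or.inl (by simpa using (not_mem_left_of_mem_cert hb h).1)
    · obtain ⟨x, w, hab, hx, hxC, hw, -⟩ := hJ' _ h
      rcases Sym2.eq_iff.1 hab with ⟨rfl, rfl⟩ | ⟨rfl, rfl⟩ <;> simp [*]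
  have hpz : ∀ u, u ∉ A → u ∉ C → edgeDeg (s ∪ J) u = 0 := fun u h1 h2 =>
    edgeDeg_eq_zero fun v h => (hp u v h).elim h1 h2
  have hqz : ∀ u ∈ A, u ∉ C → edgeDeg (b ∪ J') u = 0 := fun u h1 h2 =>
    edgeDeg_eq_zero fun v h => (hq u v h).elim (fun h => h h1) h2
  have hGood := fits_and_fitsDual_iff hE hp hq
  set p := s ∪ J with hpdef
  set q := b ∪ J' with hqdef
  have hsum : ∀ v, edgeDeg (p ∪ q) v = edgeDeg p v + edgeDeg q v := edgeDeg_union hdisj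
  have hsub : ∀ e ∈ p ∪ q, e ∈ G.edgeSet := by
    intro e he
    simp only [hpdef, hqdef, Finset.mem_union] at he
    rcases he with (h | h) | (h | h)
    · exact (hs.2 e h).1
    · obtain ⟨a, y, rfl, -, -, -, -, h⟩ := hJ e h; exact h
    · exact (hb.2 e h).1
    · obtain ⟨a, y, rfl, -, -, -, h⟩ := hJ' e h; exact h
  have hval : pairing z k q (stateVec z k p) =
      ∑ g with (FitsDual z k q g ∧ Fits z k p g), (1 : ZMod 2) := by
    simp only [pairing, stateVec, LinearMap.coe_mk, AddHom.coe_mk]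
    rw [← Finset.filter_filter, ← Finset.sum_filter]
  rw [hval]
  constructor
  · intro hne
    have hex : ∃ g, FitsDual z k q g ∧ Fits z k p g := by
      by_contra! hcon
      apply hne
      apply Finset.sum_eq_zero
      intro g hg
      simp only [Finset.mem_filter, Finset.mem_univ, true_and] at hg
      exact absurd hg.2 (hcon g hg.1)
    have hdeg : ∀ v, edgeDeg (p ∪ q) v = 2 := by
      intro v
      rw [hsum]
      by_cases hvC : v ∈ C
      · obtain ⟨g, hg⟩ := hex
        obtain ⟨-, h1, h2, -⟩ := (hGood g).1 hg
        obtain ⟨i, hi, rfl⟩ := (hE.mem_iff v).1 hvC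
        have h1 := h1 ⟨i, hi⟩
        have h2 := h2 ⟨i, hi⟩
        simp only at h1 h2
        omega
      · by_cases hvA : v ∈ A
        · rw [hdA v hvA hvC, hqz v hvA hvC]
        · rw [hpz v hvA hvC, hdB v hvA hvC]
    have : Nonempty V := ⟨z 0⟩
    apply isWitness_of_edgeConnected hsub hdeg
    by_contra hnc
    unfold EdgeConnected at hnc
    push Not at hnc
    -- Passing to the complement if necessary, the closed set avoids `z 0`, so switching its side
    -- respects the normalisation.
    obtain ⟨K, hKne, hKcl, hKuniv⟩ : ∃ K : Set V, K.Nonempty ∧ EdgeClosed (p ∪ q) K ∧ z 0 ∉ K := by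
      obtain ⟨K, h1, h2, h3⟩ := hnc
      by_cases h0 : z 0 ∈ K
      · refine ⟨Kᶜ, ?_, h2.compl, by simpa using h0⟩
        rwa [Set.nonempty_compl]
      · exact ⟨K, h1, h2, h0⟩
    -- The switch moves some state only if `K` meets the cover. This follows from the certificate
    -- `s` if `K` meets `A`, and from `b` otherwise.
    obtain ⟨i0, hi0, hi0K⟩ : ∃ i < k, z i ∈ K := by
      have : ∃ v ∈ K, v ∈ C := by
        by_cases hKA : (K ∩ (A : Set V)).Nonempty
        · refine exists_mem_cover_of_edgeClosed hC hs (fun u v h => (hJ _ h).mem_cover)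
            (fun u v h hu => hKcl u v (Finset.mem_union_left _ h) hu) hKA ?_
          intro v _ hvA hvC
          exact hdA v hvA hvC
        · refine exists_mem_cover_of_edgeClosed hC hb (fun u v h => (hJ' _ h).mem_cover)
            (fun u v h hu => hKcl u v (Finset.mem_union_right _ h) hu) ?_ ?_
          · obtain ⟨x, hx⟩ := hKne
            exact ⟨x, hx, fun hxA => hKA ⟨x, hx, hxA⟩⟩
          · intro v _ hvA hvC
            exact hdB v (by simpa using hvA) hvC
      obtain ⟨v, hvK, hvC⟩ := this
      obtain ⟨i, hi, rfl⟩ := (hE.mem_iff v).1 hvC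
      exact ⟨i, hi, hvK⟩
    apply hne
    -- Adding three in `Fin 6` switches the side and keeps the degree.
    have h6 : ∀ x : Fin 6, (x + 3).val % 3 = x.val % 3 ∧ (x + 3).val / 3 = 1 - x.val / 3 ∧
        x + 3 ≠ x ∧ x + 3 + 3 = x := by decide
    refine Finset.sum_involution
      (fun g _ i => if z i ∈ K then g i + 3 else g i) ?_ ?_ ?_ ?_
    · intro g _; decide
    · intro g _ _ h
      have := congrFun h ⟨i0, hi0⟩
      simp only [hi0K, if_true] at this
      exact (h6 _).2.2.1 this
    · intro g hg
      simp only [Finset.mem_filter, Finset.mem_univ, true_and] at hg ⊢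
      rw [hGood] at hg ⊢
      obtain ⟨h1, h2, h3, c, hc, hc'⟩ := hg
      have hmod : ∀ i : Fin k, (if z i ∈ K then g i + 3 else g i).val % 3 = (g i).val % 3 := by
        intro i
        split_ifs
        · exact (h6 _).1
        · rfl
      refine ⟨?_, ?_, ?_, fun v => if v ∈ K then 1 - c v else c v, ?_, ?_⟩
      · intro i hi
        have : z i ∉ K := by rw [hi]; exact hKuniv
        simp only [this, if_false]
        exact h1 i hi
      · intro i; rw [hmod]; exact h2 i
      · intro i; rw [hmod]; exact h3 i
      · intro u v huv
        have : u ∈ K ↔ v ∈ K := ⟨hKcl u v huv, hKcl v u (by rwa [Sym2.eq_swap])⟩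
        simp only [this, hc u v huv]
      · intro i
        simp only
        split_ifs
        · rw [hc' i, (h6 _).2.1]
        · exact hc' i
    · intro g _
      funext i
      simp only
      split_ifs
      · exact (h6 _).2.2.2
      · rfl
  · intro hw
    have hdeg := hw.edgeDeg_eq
    have hle : ∀ v, edgeDeg p v + edgeDeg q v = 2 := fun v => by rw [← hsum, hdeg]
    -- The only common state: connectedness makes every uncrossed cut constant, hence 0 everywhere,
    -- and the degrees are those of `p`.
    let g0 : Fin k → Fin 6 := fun i => ⟨edgeDeg p (z i), by have := hle (z i); omega⟩
    have hg0 : ∀ i : Fin k, (g0 i).val % 3 = edgeDeg p (z i) ∧ (g0 i).val / 3 = 0 := by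
      intro i
      have := hle (z i)
      simp only [g0]
      omega
    rw [Finset.sum_eq_single g0]
    · simp
    · intro g hg hne
      simp only [Finset.mem_filter, Finset.mem_univ, true_and] at hg
      rw [hGood] at hg
      obtain ⟨h1, h2, h3, c, hc, hc'⟩ := hg
      exfalso
      apply hne
      funext i
      have huniv := hw.edgeConnected {v | c v = c (z 0)} ⟨z 0, rfl⟩ (fun u v huv hu => by
        simp only [Set.mem_ofPred_eq] at hu ⊢; rw [← hc u v huv, hu])
      have h4 : c (z i) = c (z 0) := by
        have : z i ∈ {v | c v = c (z 0)} := by rw [huniv]; trivial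
        exact this
      have h5 : c (z 0) = 0 := by rw [hc' ⟨0, hk⟩, h1 ⟨0, hk⟩ rfl]
      have h6 := hc' i
      have h7 := h2 i
      have h8 := hg0 i
      apply Fin.ext
      omega
    · intro hn
      exfalso
      apply hn
      simp only [Finset.mem_filter, Finset.mem_univ, true_and]
      rw [hGood]
      refine ⟨fun i _ => (hg0 i).2, fun i => (hg0 i).1.symm, fun i => ?_, fun _ => 0,
        fun _ _ _ => rfl, fun i => (hg0 i).2.symm⟩
      rw [(hg0 i).1]
      have := hle (z i)
      omega

/-- Each deficient vertex is an end of an edge of `J` whose other end is in `C`, and a vertex of `C`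
has at most two such edges. -/
theorem card_deficient_le {s J : Finset (Sym2 V)}
    (hJ : ∀ e ∈ J, IsCoverEdge G A C e)
    (hdA : ∀ u ∈ A, u ∉ C → edgeDeg (s ∪ J) u = 2)
    (hle : ∀ y ∈ C, edgeDeg (s ∪ J) y ≤ 2) : (deficient A C s).card ≤ 2 * C.card := by
  have hsub : deficient A C s ⊆ C.biUnion fun y => Finset.univ.filter fun u => s(y, u) ∈ J := by
    intro u hu
    simp only [deficient, Finset.mem_filter] at hu
    obtain ⟨huA, huC, hdeg⟩ := hu
    have : ∃ y, s(u, y) ∈ J := by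
      by_contra! hcon
      apply hdeg
      rw [← hdA u huA huC]
      apply edgeDeg_congr
      intro y
      simp [hcon]
    obtain ⟨y, hy⟩ := this
    simp only [Finset.mem_biUnion, Finset.mem_filter, Finset.mem_univ, true_and]
    exact ⟨y, ((hJ _ hy).mem_cover).resolve_left huC, by rwa [Sym2.eq_swap]⟩
  calc (deficient A C s).card ≤ _ := Finset.card_le_card hsub
    _ ≤ ∑ y ∈ C, _ := Finset.card_biUnion_le
    _ ≤ ∑ y ∈ C, 2 := Finset.sum_le_sum fun y hy =>
        (edgeDeg_mono Finset.subset_union_right y).trans (hle y hy)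
    _ = 2 * C.card := by simp [mul_comm]

/-- A subfamily whose members span the state vectors of the whole family preserves it. -/
theorem preserves_of_coverSpan_le (hE : Enumerates z k C) (hk : 0 < k)
    (hcov : (G.between (A : Set V) (A : Set V)ᶜ).IsVertexCover (C : Set V))
    {S S' : Set (Finset (Sym2 V))} (hS : S ⊆ cert G (A : Set V)) (hsub : S' ⊆ S)
    (hspan : ∀ s ∈ S, (deficient A C s).card ≤ 2 * k →
      coverSpan G A C z k s ≤ ⨆ s' ∈ S', coverSpan G A C z k s') :
    Preserves G (A : Set V) S' S := by
  classical
  rintro b hb ⟨H, ⟨hH, s, hs, b', hb', E', hE', rfl⟩, hw⟩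
  rw [Set.mem_singleton_iff] at hb'
  subst hb'
  have hsc := hS hs
  -- The cover property enters only here. Edges from `A ∩ C` to `C \ A` are counted as dual, so the
  -- two kinds exclude each other.
  have hE2 : ∀ e ∈ E', IsCoverEdge G A C e ∨ IsDualCoverEdge G A C e := by
    intro e he
    have := hE' e he
    induction e using Sym2.ind with
    | _ u v =>
      rw [SimpleGraph.mem_edgeSet] at this
      have hc := hcov this
      rw [SimpleGraph.between_adj] at this
      simp only [Finset.mem_coe, Set.mem_compl_iff] at this hc
      obtain ⟨hadj, ⟨hu, hv⟩ | ⟨hu, hv⟩⟩ := this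
      · by_cases huC : u ∈ C
        · exact Or.inr ⟨u, v, rfl, hu, huC, hv, hadj⟩
        · exact Or.inl ⟨u, v, rfl, hu, huC, hc.resolve_left huC, hv, hadj⟩
      · by_cases hvC : v ∈ C
        · exact Or.inr ⟨v, u, Sym2.eq_swap, hv, hvC, hu, hadj.symm⟩
        · exact Or.inl ⟨v, u, Sym2.eq_swap, hv, hvC, hc.resolve_right hvC, hu, hadj.symm⟩
  have hexcl : ∀ e, IsCoverEdge G A C e → ¬ IsDualCoverEdge G A C e := by
    rintro e ⟨u, y, rfl, hu, huC, hy, hyA, -⟩ ⟨x, w, h, hx, hxC, hw, -⟩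
    rcases Sym2.eq_iff.1 h with ⟨rfl, rfl⟩ | ⟨rfl, rfl⟩ <;> contradiction
  set J := E'.filter fun e => IsCoverEdge G A C e with hJdef
  set J' := E'.filter fun e => IsDualCoverEdge G A C e with hJ'def
  have hJ : ∀ e ∈ J, IsCoverEdge G A C e := fun e he => (Finset.mem_filter.1 he).2
  have hJ' : ∀ e ∈ J', IsDualCoverEdge G A C e := fun e he => (Finset.mem_filter.1 he).2
  have hEJ : s ∪ b' ∪ E' = (s ∪ J) ∪ (b' ∪ J') := by
    have : E' = J ∪ J' := by
      ext e
      simp only [hJdef, hJ'def, Finset.mem_union, Finset.mem_filter]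
      constructor
      · intro he
        rcases hE2 e he with h | h <;> simp [he, h]
      · rintro (h | h) <;> exact h.1
    rw [this]
    ext e
    simp only [Finset.mem_union]
    tauto
  have hb0 : ∀ u v, s(u, v) ∈ b' → u ∉ A ∧ v ∉ A := fun u v h => by
    simpa using And.intro (not_mem_left_of_mem_cert hb h).1 (not_mem_left_of_mem_cert hb h).2.1
  have hdisj : ∀ {t I : Finset (Sym2 V)}, t ∈ cert G (A : Set V) →
      (∀ e ∈ I, IsCoverEdge G A C e) → Disjoint (t ∪ I) (b' ∪ J') := by
    intro t I ht hI
    rw [Finset.disjoint_left]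
    intro e he he'
    rw [Finset.mem_union] at he he'
    rcases he with he | he
    · induction e using Sym2.ind with
      | _ u v =>
        have h1 := not_mem_left_of_mem_cert ht he
        simp only [Finset.mem_coe] at h1
        rcases he' with he' | he'
        · exact (hb0 u v he').1 h1.1
        · obtain ⟨x, w, h, -, -, hw, -⟩ := hJ' _ he'
          rcases Sym2.eq_iff.1 h with ⟨rfl, rfl⟩ | ⟨rfl, rfl⟩
          · exact hw h1.2.1
          · exact hw h1.1
    · rcases he' with he' | he'
      · obtain ⟨u, y, rfl, hu, -⟩ := hI e he
        exact (hb0 u y he').1 hu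
      · exact hexcl e (hI e he) (hJ' e he')
  rw [hEJ] at hw
  have hdeg := hw.edgeDeg_eq
  have hqz : ∀ u ∈ A, u ∉ C → edgeDeg (b' ∪ J') u = 0 := by
    intro u hu huC
    apply edgeDeg_eq_zero
    intro v h
    rcases Finset.mem_union.1 h with h | h
    · exact (hb0 u v h).1 hu
    · obtain ⟨x, w, h, -, hx, hw, -⟩ := hJ' _ h
      rcases Sym2.eq_iff.1 h with ⟨rfl, rfl⟩ | ⟨rfl, rfl⟩
      · exact huC hx
      · exact hw hu
  have hpz : ∀ u, u ∉ A → u ∉ C → edgeDeg (s ∪ J) u = 0 := by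
    intro u hu huC
    apply edgeDeg_eq_zero
    intro v h
    rcases Finset.mem_union.1 h with h | h
    · exact hu (by simpa using (not_mem_left_of_mem_cert hsc h).1)
    · obtain ⟨x, w, h, hx, -, hw, -⟩ := hJ _ h
      rcases Sym2.eq_iff.1 h with ⟨rfl, rfl⟩ | ⟨rfl, rfl⟩
      · exact hu hx
      · exact huC hw
  have hsum : ∀ v, edgeDeg (s ∪ J) v + edgeDeg (b' ∪ J') v = 2 := fun v => by
    rw [← edgeDeg_union (hdisj hsc hJ), hdeg]
  have hdA : ∀ u ∈ A, u ∉ C → edgeDeg (s ∪ J) u = 2 := by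
    intro u hu huC
    have := hsum u
    rwa [hqz u hu huC] at this
  have hdB : ∀ u, u ∉ A → u ∉ C → edgeDeg (b' ∪ J') u = 2 := by
    intro u hu huC
    have := hsum u
    rwa [hpz u hu huC, zero_add] at this
  -- A completable `s` has few deficient vertices, so the span condition is not needed for the
  -- others.
  have hcard : (deficient A C s).card ≤ 2 * k := by
    rw [← hE.card_eq]
    exact card_deficient_le hJ hdA fun y _ => by have := hsum y; omega
  have hmem : stateVec z k (s ∪ J) ∈ ⨆ s' ∈ S', coverSpan G A C z k s' :=
    hspan s hs hcard (Submodule.subset_span ⟨J, hJ, hdA, rfl⟩)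
  have hne := (pairing_stateVec_ne_zero_iff hE hk hsc hb hJ hJ' (hdisj hsc hJ) hdA hdB).2 hw
  -- If the functional of `b' ∪ J'` vanished on all generators coming from `S'`, it would vanish on
  -- their span and hence on the state vector of `s ∪ J`. The set `J'` is kept, and only the cover
  -- edges may change with `s'`.
  obtain ⟨s', hs', J₂, hJ₂, hdA₂, hne₂⟩ : ∃ s' ∈ S', ∃ J₂ : Finset (Sym2 V),
      (∀ e ∈ J₂, IsCoverEdge G A C e) ∧ (∀ u ∈ A, u ∉ C → edgeDeg (s' ∪ J₂) u = 2) ∧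
      pairing z k (b' ∪ J') (stateVec z k (s' ∪ J₂)) ≠ 0 := by
    by_contra! hcon
    apply hne
    have : (⨆ s' ∈ S', coverSpan G A C z k s') ≤ LinearMap.ker (pairing z k (b' ∪ J')) := by
      refine iSup₂_le fun s' hs' => ?_
      rw [coverSpan, Submodule.span_le]
      rintro _ ⟨I, hI, hdI, rfl⟩
      exact hcon s' hs' I hI hdI
    exact this hmem
  have hsc' := hS (hsub hs')
  have hw' := (pairing_stateVec_ne_zero_iff hE hk hsc' hb hJ₂ hJ' (hdisj hsc' hJ₂) hdA₂ hdB).1 hne₂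
  refine ⟨(s' ∪ J₂) ∪ (b' ∪ J'), ⟨⟨Or.inr hw', fun e he => ⟨hw'.subset_edgeSet e he, ?_⟩⟩,
    s', hs', b', rfl, J₂ ∪ J', ?_, ?_⟩, hw'⟩
  · simp
  · intro e he
    rcases Finset.mem_union.1 he with h | h
    · obtain ⟨u, y, rfl, hu, -, -, hy, hadj⟩ := hJ₂ e h
      rw [SimpleGraph.mem_edgeSet, SimpleGraph.between_adj]
      exact ⟨hadj, Or.inl ⟨hu, hy⟩⟩
    · obtain ⟨u, y, rfl, hu, -, hy, hadj⟩ := hJ' e h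
      rw [SimpleGraph.mem_edgeSet, SimpleGraph.between_adj]
      exact ⟨hadj, Or.inl ⟨hu, hy⟩⟩
  · ext e
    simp only [Finset.mem_union]
    tauto

/-- The state vectors on the cover are obtained by projection from a boundary that contains all
deficient vertices. -/
theorem map_project_extSpan (hk : 0 < k) (hkm : k ≤ m) (hE : Enumerates z k C)
    {s : Finset (Sym2 V)} (hs : s ∈ cert G (A : Set V))
    (hD : ∀ u, u ∈ deficient A C s ↔ ∃ i, k ≤ i ∧ i < m ∧ z i = u) {E : Finset (Sym2 V)}
    (hEdge : ∀ e, e ∈ E ↔ ∃ u y, e = s(u, y) ∧ u ∈ deficient A C s ∧ y ∈ C ∧ y ∉ A ∧ G.Adj u y) :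
    (extSpan z m s E).map (project hkm) = coverSpan G A C z k s := by
  have hC : C.Nonempty := ⟨z 0, (hE.mem_iff _).2 ⟨0, hk, rfl⟩⟩
  have hEJ : ∀ e ∈ E, IsCoverEdge G A C e := by
    intro e he
    obtain ⟨u, y, rfl, hu, hy⟩ := (hEdge e).1 he
    simp only [deficient, Finset.mem_filter] at hu
    exact ⟨u, y, rfl, hu.1, hu.2.1, hy⟩
  have hproj : ∀ J : Finset (Sym2 V), (∀ e ∈ J, IsCoverEdge G A C e) →
      (∀ u ∈ A, u ∉ C → edgeDeg (s ∪ J) u = 2) →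
      project hkm (stateVec z m (s ∪ J)) = stateVec z k (s ∪ J) := by
    intro J hJ hdeg
    have hmemD : ∀ i, k ≤ i → i < m → z i ∈ A ∧ z i ∉ C := by
      intro i hki him
      have := (hD (z i)).2 ⟨i, hki, him, rfl⟩
      simp only [deficient, Finset.mem_filter] at this
      exact ⟨this.1, this.2.1⟩
    apply project_stateVec
    · intro i hki him
      exact hdeg _ (hmemD i hki him).1 (hmemD i hki him).2
    · intro i hki him K hK hi
      obtain ⟨v, hvK, hvC⟩ := exists_mem_cover_of_edgeClosed hC hs
        (fun u v h => (hJ _ h).mem_cover) hK ⟨z i, hi, (hmemD i hki him).1⟩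
        (fun v _ hvA hvC => hdeg v hvA hvC)
      obtain ⟨j, hj, rfl⟩ := (hE.mem_iff v).1 hvC
      exact ⟨j, hj, hvK⟩
  rw [extSpan, Submodule.map_span, coverSpan]
  apply le_antisymm
  · rw [Submodule.span_le]
    rintro _ ⟨_, ⟨J, hJ, rfl⟩, rfl⟩
    have hJc : ∀ e ∈ J, IsCoverEdge G A C e := fun e he => hEJ e (hJ he)
    -- Edges of `E` inside `A \ C` end only in deficient vertices, so the other vertices there keep
    -- the degree two they have in `s`. A subset `J` that fails at a deficient vertex is projected
    -- to zero.
    by_cases hdeg : ∀ u ∈ deficient A C s, edgeDeg (s ∪ J) u = 2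
    · have hdeg' : ∀ u ∈ A, u ∉ C → edgeDeg (s ∪ J) u = 2 := by
        intro u hu huC
        by_cases huD : u ∈ deficient A C s
        · exact hdeg u huD
        · have h2 : edgeDeg s u = 2 := by
            by_contra h
            exact huD (by simp only [deficient, Finset.mem_filter]; exact ⟨hu, huC, h⟩)
          rw [← h2]
          apply edgeDeg_congr
          intro v
          rw [Finset.mem_union]
          refine ⟨fun h => h.resolve_right fun h' => ?_, Or.inl⟩
          obtain ⟨a, y, hay, ha, hy, -⟩ := (hEdge _).1 (hJ h')
          rcases Sym2.eq_iff.1 hay with ⟨rfl, rfl⟩ | ⟨rfl, rfl⟩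
          · exact huD ha
          · exact huC hy
      rw [hproj J hJc hdeg']
      exact Submodule.subset_span ⟨J, hJc, hdeg', rfl⟩
    · push Not at hdeg
      obtain ⟨u, hu, hne⟩ := hdeg
      obtain ⟨i, hki, him, rfl⟩ := (hD u).1 hu
      rw [project_stateVec_eq_zero hkm hki him hne]
      exact Submodule.zero_mem _
  · rw [Submodule.span_le]
    rintro _ ⟨J, hJ, hdeg, rfl⟩
    refine Submodule.subset_span ⟨_, ⟨J, ?_, rfl⟩, hproj J hJ hdeg⟩
    intro e he
    obtain ⟨u, y, rfl, hu, huC, hy, hyA, hadj⟩ := hJ e he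
    refine (hEdge _).2 ⟨u, y, rfl, ?_, hy, hyA, hadj⟩
    simp only [deficient, Finset.mem_filter]
    refine ⟨hu, huC, fun h2 => ?_⟩
    have h3 := hdeg u hu huC
    -- The edge to `y ∉ A` is not in `s`, so `u` has smaller degree in `s` than its final degree
    -- two. Hence `u` is deficient and every admissible `J` uses boundary edges only.
    have hlt : edgeDeg s u < edgeDeg (s ∪ J) u := by
      apply Finset.card_lt_card
      rw [Finset.ssubset_iff_of_subset]
      · refine ⟨y, by simp [he], ?_⟩
        simp only [Finset.mem_filter, Finset.mem_univ, true_and]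
        intro h
        exact hyA (by simpa using (not_mem_left_of_mem_cert hs h).2.1)
      · intro v hv
        simp only [Finset.mem_filter, Finset.mem_univ, true_and] at hv ⊢
        exact Finset.mem_union_left _ hv
    omega

end Cover

/-! ### A language of bounded loops on top of random access machines -/

namespace RAM

/-- Terms. Multiplication and division are carried out by loops of length `reg 4`. -/
inductive Tm where
  | const (c : ℕ)
  | reg (x : ℕ)
  | get (a : ℕ) (t : Tm)
  | add (t u : Tm)
  | sub (t u : Tm)
  | mul (t u : Tm)
  | div (t u : Tm)
  | ite (c t u : Tm)

/-- One round of division by repeated subtraction. -/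
def divStep (b : ℕ) (p : ℕ × ℕ) : ℕ × ℕ := if b ≤ p.1 then (p.1 - b, p.2 + 1) else p

/-- The value of a term. Products and quotients are exact as long as the first operand is at most
`reg 4`. -/
def Tm.eval (σ : State) : Tm → ℕ
  | .const c => c
  | .reg x => σ.reg x
  | .get a t => σ.arr a (t.eval σ)
  | .add t u => t.eval σ + u.eval σ
  | .sub t u => t.eval σ - u.eval σ
  | .mul t u => min (t.eval σ) (σ.reg 4) * u.eval σ
  | .div t u => ((divStep (u.eval σ))^[σ.reg 4] (t.eval σ, 0)).2
  | .ite c t u => if c.eval σ ≠ 0 then t.eval σ else u.eval σ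

/-- A strict upper bound on the registers that a term reads. -/
def Tm.bound : Tm → ℕ
  | .const _ => 0
  | .reg x => x + 1
  | .get _ t => t.bound
  | .add t u => max t.bound u.bound
  | .sub t u => max t.bound u.bound
  | .mul t u => max t.bound u.bound
  | .div t u => max t.bound u.bound
  | .ite c t u => max c.bound (max t.bound u.bound)

/-- The number of nodes of a term. -/
def Tm.size : Tm → ℕ
  | .const _ => 1
  | .reg _ => 1
  | .get _ t => t.size + 1
  | .add t u => t.size + u.size + 1
  | .sub t u => t.size + u.size + 1
  | .mul t u => t.size + u.size + 1
  | .div t u => t.size + u.size + 1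
  | .ite c t u => c.size + t.size + u.size + 1

/-- The body of the multiplication loop, with registers from `k` on. -/
def mulBody (k : ℕ) : Program :=
  .seq (.assign (k + 3) (.sub (.reg (k + 3)) (.const 1)))
    (.ite (.reg k)
      (.seq (.assign k (.sub (.reg k) (.const 1)))
        (.assign (k + 2) (.add (.reg (k + 2)) (.reg (k + 1)))))
      .skip)

/-- The body of the division loop, with registers from `k` on. -/
def divBody (k : ℕ) : Program :=
  .seq (.assign (k + 3) (.sub (.reg (k + 3)) (.const 1)))
    (.ite (.sub (.add (.reg k) (.const 1)) (.reg (k + 1)))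
      (.seq (.assign k (.sub (.reg k) (.reg (k + 1))))
        (.assign (k + 2) (.add (.reg (k + 2)) (.const 1))))
      .skip)

/-- The program that puts the value of a term into register `k`, with scratch registers above. -/
def Tm.compile : Tm → ℕ → Program
  | .const c, k => .assign k (.const c)
  | .reg x, k => .assign k (.reg x)
  | .get a t, k => .seq (t.compile k) (.assign k (.get a (.reg k)))
  | .add t u, k => .seq (t.compile k) (.seq (u.compile (k + 1))
      (.assign k (.add (.reg k) (.reg (k + 1)))))
  | .sub t u, k => .seq (t.compile k) (.seq (u.compile (k + 1))
      (.assign k (.sub (.reg k) (.reg (k + 1)))))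
  | .mul t u, k => .seq (t.compile k) (.seq (u.compile (k + 1))
      (.seq (.assign (k + 2) (.const 0)) (.seq (.assign (k + 3) (.reg 4))
        (.seq (.loop (.reg (k + 3)) (mulBody k)) (.assign k (.reg (k + 2)))))))
  | .div t u, k => .seq (t.compile k) (.seq (u.compile (k + 1))
      (.seq (.assign (k + 2) (.const 0)) (.seq (.assign (k + 3) (.reg 4))
        (.seq (.loop (.reg (k + 3)) (divBody k)) (.assign k (.reg (k + 2)))))))
  | .ite c t u, k => .seq (c.compile k) (.ite (.reg k) (t.compile k) (u.compile k))

/-- Agreement on all arrays and on the registers below `k`. -/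
def Agree (k : ℕ) (σ τ : State) : Prop := (∀ x < k, σ.reg x = τ.reg x) ∧ σ.arr = τ.arr

theorem Agree.refl (k : ℕ) (σ : State) : Agree k σ σ := ⟨fun _ _ => rfl, rfl⟩

theorem Agree.trans {k : ℕ} {σ τ υ : State} (h : Agree k σ τ) (h' : Agree k τ υ) : Agree k σ υ :=
  ⟨fun x hx => (h.1 x hx).trans (h'.1 x hx), h.2.trans h'.2⟩

theorem Agree.mono {k l : ℕ} (hkl : k ≤ l) {σ τ : State} (h : Agree l σ τ) : Agree k σ τ :=
  ⟨fun x hx => h.1 x (by omega), h.2⟩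

theorem Agree.setReg {k x : ℕ} (hx : k ≤ x) (σ : State) (v : ℕ) : Agree k σ (σ.setReg x v) :=
  ⟨fun y hy => (Function.update_of_ne (by omega) _ _).symm, rfl⟩

theorem Agree.setReg_setReg {k : ℕ} {σ τ : State} (h : Agree k σ τ) (x v : ℕ) :
    Agree k (σ.setReg x v) (τ.setReg x v) := by
  refine ⟨fun y hy => ?_, h.2⟩
  by_cases hxy : y = x
  · subst hxy; simp [State.setReg]
  · simp [State.setReg, hxy, h.1 y hy]

/-- The condition `4 < k` is needed because products and quotients read register 4. -/
theorem Tm.eval_congr {k : ℕ} (hk : 4 < k) {σ τ : State} (h : Agree k σ τ) (t : Tm)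
    (ht : t.bound ≤ k) : t.eval σ = t.eval τ := by
  induction t <;> simp_all [Tm.eval, Tm.bound, h.2, h.1 4 hk]
  exact h.1 _ (by omega)

@[simp] theorem State.setReg_reg_self (σ : State) (x v : ℕ) : (σ.setReg x v).reg x = v := by
  simp [State.setReg]

theorem State.setReg_reg (σ : State) (x v y : ℕ) :
    (σ.setReg x v).reg y = if y = x then v else σ.reg y := by
  simp [State.setReg, Function.update_apply]

@[simp] theorem State.setReg_arr (σ : State) (x v : ℕ) : (σ.setReg x v).arr = σ.arr := rfl

@[simp] theorem State.setArr_reg (σ : State) (a i v : ℕ) : (σ.setArr a i v).reg = σ.reg := rfl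

theorem State.setArr_arr (σ : State) (a i v b : ℕ) :
    (σ.setArr a i v).arr b = if b = a then Function.update (σ.arr a) i v else σ.arr b := by
  by_cases h : b = a
  · subst h; simp [State.setArr]
  · simp [State.setArr, h]

/-- A loop whose guard register counts down. -/
theorem exec_loop_down {c : ℕ} {P : Program} {I : ℕ → State → Prop} {T : ℕ}
    (hI : ∀ j σ, I j σ → σ.reg c = j)
    (hP : ∀ j σ, I (j + 1) σ → ∃ τ t, Exec P σ τ t ∧ t ≤ T ∧ I j τ) :
    ∀ j σ, I j σ → ∃ τ t, Exec (.loop (.reg c) P) σ τ t ∧ t ≤ j * (T + 2) + 2 ∧ I 0 τ := by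
  intro j
  induction j with
  | zero =>
    intro σ h
    exact ⟨σ, _, Exec.loopDone (hI 0 σ h), by simp [Expr.cost], h⟩
  | succ j ih =>
    intro σ h
    obtain ⟨τ, t, h1, h2, h3⟩ := hP j σ h
    obtain ⟨υ, t', h4, h5, h6⟩ := ih τ h3
    refine ⟨υ, _, Exec.loopStep ?_ h1 h4, ?_, h6⟩
    · simp [Expr.eval, hI _ _ h]
    · simp only [Expr.cost]
      nlinarith

theorem mulBody_exec (k : ℕ) (σ : State) : ∃ τ t, Exec (mulBody k) σ τ t ∧ t ≤ 20 ∧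
    Agree k σ τ ∧ τ.reg (k + 3) = σ.reg (k + 3) - 1 ∧ τ.reg (k + 1) = σ.reg (k + 1) ∧
    τ.reg k = σ.reg k - 1 ∧
    τ.reg (k + 2) = if σ.reg k = 0 then σ.reg (k + 2) else σ.reg (k + 2) + σ.reg (k + 1) := by
  by_cases h : σ.reg k = 0
  · refine ⟨_, _, Exec.seq (Exec.assign _ _ _) (Exec.iteFalse ?_ (Exec.skip _)), ?_, ?_⟩
    · simp [Expr.eval, State.setReg_reg, h]
    · simp [Expr.cost]
    · refine ⟨Agree.setReg (by omega) _ _, ?_⟩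
      simp [Expr.eval, State.setReg_reg, h]
  · refine ⟨_, _, Exec.seq (Exec.assign _ _ _)
      (Exec.iteTrue ?_ (Exec.seq (Exec.assign _ _ _) (Exec.assign _ _ _))), ?_, ?_⟩
    · simp [Expr.eval, State.setReg_reg, h]
    · simp [Expr.cost]
    · refine ⟨((Agree.setReg (by omega) _ _).trans (Agree.setReg (by omega) _ _)).trans
        (Agree.setReg (by omega) _ _), ?_⟩
      simp [Expr.eval, State.setReg_reg, h]

theorem divBody_exec (k : ℕ) (σ : State) : ∃ τ t, Exec (divBody k) σ τ t ∧ t ≤ 20 ∧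
    Agree k σ τ ∧ τ.reg (k + 3) = σ.reg (k + 3) - 1 ∧ τ.reg (k + 1) = σ.reg (k + 1) ∧
    (τ.reg k, τ.reg (k + 2)) = divStep (σ.reg (k + 1)) (σ.reg k, σ.reg (k + 2)) := by
  by_cases h : σ.reg (k + 1) ≤ σ.reg k
  · refine ⟨_, _, Exec.seq (Exec.assign _ _ _)
      (Exec.iteTrue ?_ (Exec.seq (Exec.assign _ _ _) (Exec.assign _ _ _))), ?_, ?_⟩
    · simp [Expr.eval, State.setReg_reg]; omega
    · simp [Expr.cost]
    · refine ⟨((Agree.setReg (by omega) _ _).trans (Agree.setReg (by omega) _ _)).trans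
        (Agree.setReg (by omega) _ _), ?_⟩
      simp [Expr.eval, State.setReg_reg, divStep, h]
  · refine ⟨_, _, Exec.seq (Exec.assign _ _ _) (Exec.iteFalse ?_ (Exec.skip _)), ?_, ?_⟩
    · simp [Expr.eval, State.setReg_reg]; omega
    · simp [Expr.cost]
    · refine ⟨Agree.setReg (by omega) _ _, ?_⟩
      simp [Expr.eval, State.setReg_reg, divStep, h]

theorem mulLoop_exec (k : ℕ) (σ : State) (F : ℕ) (hF : σ.reg (k + 3) = F) :
    ∃ τ t, Exec (.loop (.reg (k + 3)) (mulBody k)) σ τ t ∧ t ≤ F * 22 + 2 ∧ Agree k σ τ ∧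
      τ.reg (k + 2) = σ.reg (k + 2) + min (σ.reg k) F * σ.reg (k + 1) := by
  -- The accumulator plus what the remaining `j` rounds will contribute is constant; the minimum
  -- appears since a round does nothing once the first operand is used up.
  let I : ℕ → State → Prop := fun j τ => τ.reg (k + 3) = j ∧ Agree k σ τ ∧
      τ.reg (k + 1) = σ.reg (k + 1) ∧
      τ.reg (k + 2) + min (τ.reg k) j * σ.reg (k + 1) =
        σ.reg (k + 2) + min (σ.reg k) F * σ.reg (k + 1)
  have hstep : ∀ j τ, I (j + 1) τ → ∃ υ t, Exec (mulBody k) τ υ t ∧ t ≤ 20 ∧ I j υ := by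
    rintro j τ ⟨h1, h2, h3, h4⟩
    obtain ⟨υ, t, e1, e2, e3, e4, e5, e6, e7⟩ := mulBody_exec k τ
    refine ⟨υ, t, e1, e2, by omega, h2.trans e3, by rw [e5, h3], ?_⟩
    rw [← h4, e7, e6, h3]
    split_ifs with h0
    · simp [h0]
    · have : min (τ.reg k) (j + 1) = min (τ.reg k - 1) j + 1 := by omega
      rw [this]
      ring
  obtain ⟨τ, t, h1, h2, h3⟩ := exec_loop_down (fun j τ h => h.1) hstep F σ
    ⟨hF, Agree.refl _ _, rfl, rfl⟩
  exact ⟨τ, t, h1, h2, h3.2.1, by simpa using h3.2.2.2⟩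

theorem divLoop_exec (k : ℕ) (σ : State) (F : ℕ) (hF : σ.reg (k + 3) = F) :
    ∃ τ t, Exec (.loop (.reg (k + 3)) (divBody k)) σ τ t ∧ t ≤ F * 22 + 2 ∧ Agree k σ τ ∧
      τ.reg (k + 2) = ((divStep (σ.reg (k + 1)))^[F] (σ.reg k, σ.reg (k + 2))).2 := by
  let I : ℕ → State → Prop := fun j τ => τ.reg (k + 3) = j ∧ Agree k σ τ ∧
      τ.reg (k + 1) = σ.reg (k + 1) ∧
      (divStep (σ.reg (k + 1)))^[j] (τ.reg k, τ.reg (k + 2)) =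
        (divStep (σ.reg (k + 1)))^[F] (σ.reg k, σ.reg (k + 2))
  have hstep : ∀ j τ, I (j + 1) τ → ∃ υ t, Exec (divBody k) τ υ t ∧ t ≤ 20 ∧ I j υ := by
    rintro j τ ⟨h1, h2, h3, h4⟩
    obtain ⟨υ, t, e1, e2, e3, e4, e5, e6⟩ := divBody_exec k τ
    refine ⟨υ, t, e1, e2, by omega, h2.trans e3, by rw [e5, h3], ?_⟩
    rw [← h4, e6, h3, Function.iterate_succ_apply]
  obtain ⟨τ, t, h1, h2, h3⟩ := exec_loop_down (fun j τ h => h.1) hstep F σ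
    ⟨hF, Agree.refl _ _, rfl, rfl⟩
  exact ⟨τ, t, h1, h2, h3.2.1, by rw [← h3.2.2.2]; rfl⟩

/-- The second operand is evaluated with scratch space from `k + 1` on, so the first survives in
register `k`. Each node costs at most `30 * reg 4 + 30`, which pays for one multiplication or
division loop with at most 22 steps a round. -/
theorem Tm.compile_exec (t : Tm) : ∀ (k : ℕ) (σ : State), 4 < k → t.bound ≤ k →
    ∃ τ s, Exec (t.compile k) σ τ s ∧ s ≤ t.size * (30 * σ.reg 4 + 30) ∧ Agree k σ τ ∧
      τ.reg k = t.eval σ := by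
  induction t with
  | const c =>
    intro k σ hk ht
    refine ⟨_, _, Exec.assign _ _ _, ?_, Agree.setReg le_rfl _ _, ?_⟩
    · simp [Expr.cost, Tm.size]
    · simp [Tm.eval, Expr.eval]
  | reg x =>
    intro k σ hk ht
    refine ⟨_, _, Exec.assign _ _ _, ?_, Agree.setReg le_rfl _ _, ?_⟩
    · simp [Expr.cost, Tm.size]
    · simp [Tm.eval, Expr.eval]
  | get a t ih =>
    intro k σ hk ht
    obtain ⟨τ, s, h1, h2, h3, h4⟩ := ih k σ hk ht
    refine ⟨_, _, Exec.seq h1 (Exec.assign _ _ _), ?_, h3.trans (Agree.setReg le_rfl _ _), ?_⟩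
    · simp only [Expr.cost, Tm.size, add_mul]; omega
    · simp [Tm.eval, Expr.eval, h4, h3.2]
  | add t u iht ihu =>
    intro k σ hk ht
    simp only [Tm.bound, max_le_iff] at ht
    obtain ⟨τ, s, h1, h2, h3, h4⟩ := iht k σ hk ht.1
    obtain ⟨υ, s', e1, e2, e3, e4⟩ := ihu (k + 1) τ (by omega) (by omega)
    refine ⟨_, _, Exec.seq h1 (Exec.seq e1 (Exec.assign _ _ _)), ?_,
      (h3.trans (e3.mono (by omega))).trans (Agree.setReg le_rfl _ _), ?_⟩
    · rw [← h3.1 4 hk] at e2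
      simp only [Expr.cost, Tm.size, add_mul]; omega
    · simp [Tm.eval, Expr.eval, e4, ← e3.1 k (by omega), h4, Tm.eval_congr hk h3 u ht.2]
  | sub t u iht ihu =>
    intro k σ hk ht
    simp only [Tm.bound, max_le_iff] at ht
    obtain ⟨τ, s, h1, h2, h3, h4⟩ := iht k σ hk ht.1
    obtain ⟨υ, s', e1, e2, e3, e4⟩ := ihu (k + 1) τ (by omega) (by omega)
    refine ⟨_, _, Exec.seq h1 (Exec.seq e1 (Exec.assign _ _ _)), ?_,
      (h3.trans (e3.mono (by omega))).trans (Agree.setReg le_rfl _ _), ?_⟩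
    · rw [← h3.1 4 hk] at e2
      simp only [Expr.cost, Tm.size, add_mul]; omega
    · simp [Tm.eval, Expr.eval, e4, ← e3.1 k (by omega), h4, Tm.eval_congr hk h3 u ht.2]
  | mul t u iht ihu =>
    intro k σ hk ht
    simp only [Tm.bound, max_le_iff] at ht
    obtain ⟨τ, s, h1, h2, h3, h4⟩ := iht k σ hk ht.1
    obtain ⟨υ, s', e1, e2, e3, e4⟩ := ihu (k + 1) τ (by omega) (by omega)
    set υ' := (υ.setReg (k + 2) 0).setReg (k + 3) (υ.reg 4) with hυ'
    have h43 : υ.reg 4 = σ.reg 4 := by rw [← e3.1 4 (by omega), ← h3.1 4 hk]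
    obtain ⟨ω, s'', f1, f2, f3, f4⟩ := mulLoop_exec k υ' (σ.reg 4) (by simp [hυ', h43])
    refine ⟨_, _, Exec.seq h1 (Exec.seq e1 (Exec.seq (Exec.assign _ _ _)
      (Exec.seq (Exec.assign _ _ _) (Exec.seq (τ := ω) (s := s'') ?_ (Exec.assign _ _ _))))), ?_, ?_, ?_⟩
    · convert f1 using 1
      simp [hυ', Expr.eval, State.setReg_reg, show (4 : ℕ) ≠ k + 2 by omega]
    · rw [← h3.1 4 hk] at e2
      simp only [Expr.cost, Tm.size, add_mul]; omega
    · refine (h3.trans (e3.mono (by omega))).trans ?_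
      refine Agree.trans ?_ (f3.trans (Agree.setReg le_rfl _ _))
      exact (Agree.setReg (by omega) _ _).trans (Agree.setReg (by omega) _ _)
    · simp [Expr.eval, f4, hυ', State.setReg_reg, Tm.eval, e4, ← e3.1 k (by omega), h4,
        Tm.eval_congr hk h3 u ht.2]
  | div t u iht ihu =>
    intro k σ hk ht
    simp only [Tm.bound, max_le_iff] at ht
    obtain ⟨τ, s, h1, h2, h3, h4⟩ := iht k σ hk ht.1
    obtain ⟨υ, s', e1, e2, e3, e4⟩ := ihu (k + 1) τ (by omega) (by omega)
    set υ' := (υ.setReg (k + 2) 0).setReg (k + 3) (υ.reg 4) with hυ'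
    have h43 : υ.reg 4 = σ.reg 4 := by rw [← e3.1 4 (by omega), ← h3.1 4 hk]
    obtain ⟨ω, s'', f1, f2, f3, f4⟩ := divLoop_exec k υ' (σ.reg 4) (by simp [hυ', h43])
    refine ⟨_, _, Exec.seq h1 (Exec.seq e1 (Exec.seq (Exec.assign _ _ _)
      (Exec.seq (Exec.assign _ _ _) (Exec.seq (τ := ω) (s := s'') ?_ (Exec.assign _ _ _))))), ?_, ?_, ?_⟩
    · convert f1 using 1
      simp [hυ', Expr.eval, State.setReg_reg, show (4 : ℕ) ≠ k + 2 by omega]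
    · rw [← h3.1 4 hk] at e2
      simp only [Expr.cost, Tm.size, add_mul]; omega
    · refine (h3.trans (e3.mono (by omega))).trans ?_
      refine Agree.trans ?_ (f3.trans (Agree.setReg le_rfl _ _))
      exact (Agree.setReg (by omega) _ _).trans (Agree.setReg (by omega) _ _)
    · simp [Expr.eval, f4, hυ', State.setReg_reg, Tm.eval, e4, ← e3.1 k (by omega), h4,
        Tm.eval_congr hk h3 u ht.2]
  | ite c t u ihc iht ihu =>
    intro k σ hk ht
    simp only [Tm.bound, max_le_iff] at ht
    obtain ⟨τ, s, h1, h2, h3, h4⟩ := ihc k σ hk ht.1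
    by_cases h0 : c.eval σ = 0
    · obtain ⟨υ, s', e1, e2, e3, e4⟩ := ihu k τ hk ht.2.2
      refine ⟨_, _, Exec.seq h1 (Exec.iteFalse ?_ e1), ?_, h3.trans e3, ?_⟩
      · simp [Expr.eval, h4, h0]
      · rw [← h3.1 4 hk] at e2
        simp only [Expr.cost, Tm.size, add_mul]; omega
      · simp [Tm.eval, h0, e4, Tm.eval_congr hk h3 u ht.2.2]
    · obtain ⟨υ, s', e1, e2, e3, e4⟩ := iht k τ hk ht.2.1
      refine ⟨_, _, Exec.seq h1 (Exec.iteTrue ?_ e1), ?_, h3.trans e3, ?_⟩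
      · simp [Expr.eval, h4, h0]
      · rw [← h3.1 4 hk] at e2
        simp only [Expr.cost, Tm.size, add_mul]; omega
      · simp [Tm.eval, h0, e4, Tm.eval_congr hk h3 t ht.2.1]

/-! ### Bounded-loop programs: translation, invariants and running time -/

/-- Programs with bounded loops only: in `bdd x r P`, register `x` runs from `0` to the value of
register `r`. -/
inductive Code where
  | skip
  | assign (x : ℕ) (t : Tm)
  | store (a : ℕ) (t u : Tm)
  | seq (P Q : Code)
  | ite (c : Tm) (P Q : Code)
  | bdd (x r : ℕ) (P : Code)

/-- The iteration of a state transformation, with the counter in register `x`. -/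
def iter (x : ℕ) (f : State → State) (σ : State) : ℕ → State
  | 0 => σ.setReg x 0
  | i + 1 => (f (iter x f σ i)).setReg x (i + 1)

/-- The final state of a bounded program. -/
def Code.run : Code → State → State
  | .skip, σ => σ
  | .assign x t, σ => σ.setReg x (t.eval σ)
  | .store a t u, σ => σ.setArr a (t.eval σ) (u.eval σ)
  | .seq P Q, σ => Q.run (P.run σ)
  | .ite c P Q, σ => if c.eval σ ≠ 0 then P.run σ else Q.run σ
  | .bdd x r P, σ => iter x P.run σ (σ.reg r)

/-- The translation of bounded programs; registers from 100 on are scratch space. -/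
def Code.compile : Code → Program
  | .skip => .skip
  | .assign x t => .seq (t.compile 100) (.assign x (.reg 100))
  | .store a t u => .seq (t.compile 100) (.seq (u.compile 101) (.store a (.reg 100) (.reg 101)))
  | .seq P Q => .seq P.compile Q.compile
  | .ite c P Q => .seq (c.compile 100) (.ite (.reg 100) P.compile Q.compile)
  | .bdd x r P => .seq (.assign x (.const 0))
      (.loop (.sub (.reg r) (.reg x)) (.seq P.compile (.assign x (.add (.reg x) (.const 1)))))

/-- The registers that a bounded program may change. -/
def Code.regs : Code → List ℕ
  | .skip => []
  | .assign x _ => [x]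
  | .store _ _ _ => []
  | .seq P Q => P.regs ++ Q.regs
  | .ite _ P Q => P.regs ++ Q.regs
  | .bdd x _ P => x :: P.regs

/-- The arrays that a bounded program may change. -/
def Code.arrs : Code → List ℕ
  | .skip => []
  | .assign _ _ => []
  | .store a _ _ => [a]
  | .seq P Q => P.arrs ++ Q.arrs
  | .ite _ P Q => P.arrs ++ Q.arrs
  | .bdd _ _ P => P.arrs

/-- The registers that bound the loops of a program. -/
def Code.limits : Code → List ℕ
  | .skip => []
  | .assign _ _ => []
  | .store _ _ _ => []
  | .seq P Q => P.limits ++ Q.limits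
  | .ite _ P Q => P.limits ++ Q.limits
  | .bdd _ r P => r :: P.limits

/-- Only registers below 100 are used, and loops do not change their own counters. -/
def Code.ok : Code → Bool
  | .skip => true
  | .assign x t => x < 100 && t.bound ≤ 100
  | .store _ t u => t.bound ≤ 100 && u.bound ≤ 100
  | .seq P Q => P.ok && Q.ok
  | .ite c P Q => c.bound ≤ 100 && P.ok && Q.ok
  | .bdd x r P => x < 100 && r < 100 && x != r && !P.regs.contains x && P.ok

/-- A bound on the running time in terms of bounds on the registers. -/
def Code.time (ρ : ℕ → ℕ) : Code → ℕ
  | .skip => 1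
  | .assign _ t => t.size * (30 * ρ 4 + 30) + 2
  | .store _ t u => (t.size + u.size) * (30 * ρ 4 + 30) + 3
  | .seq P Q => P.time ρ + Q.time ρ
  | .ite c P Q => c.size * (30 * ρ 4 + 30) + 2 + P.time ρ + Q.time ρ
  | .bdd _ r P => ρ r * (P.time ρ + 8) + 6

theorem iter_reg (x : ℕ) (f : State → State) (σ : State) (i : ℕ) : (iter x f σ i).reg x = i := by
  cases i <;> simp [iter]

theorem iter_reg_of_ne {x y : ℕ} (hxy : y ≠ x) {f : State → State}
    (hf : ∀ σ, (f σ).reg y = σ.reg y) (σ : State) (i : ℕ) : (iter x f σ i).reg y = σ.reg y := by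
  induction i with
  | zero => simp [iter, State.setReg_reg, hxy]
  | succ i ih => simp [iter, State.setReg_reg, hxy, hf, ih]

theorem iter_arr (x : ℕ) {a : ℕ} {f : State → State}
    (hf : ∀ σ, (f σ).arr a = σ.arr a) (σ : State) (i : ℕ) : (iter x f σ i).arr a = σ.arr a := by
  induction i with
  | zero => simp [iter]
  | succ i ih => simp [iter, hf, ih]

theorem Code.run_reg {c : Code} {y : ℕ} (hy : y ∉ c.regs) : ∀ σ, (c.run σ).reg y = σ.reg y := by
  induction c with
  | skip => intro σ; rfl
  | assign x t => intro σ; simp_all [Code.run, Code.regs, State.setReg_reg]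
  | store a t u => intro σ; simp [Code.run]
  | seq P Q ihP ihQ => intro σ; simp_all [Code.run, Code.regs]
  | ite c P Q ihP ihQ =>
    intro σ
    simp only [Code.regs, List.mem_append, not_or] at hy
    simp only [Code.run]
    split_ifs
    · exact ihP hy.1 σ
    · exact ihQ hy.2 σ
  | bdd x r P ih =>
    intro σ
    simp only [Code.regs, List.mem_cons, not_or] at hy
    exact iter_reg_of_ne hy.1 (ih hy.2) σ _

theorem Code.run_arr {c : Code} {a : ℕ} (ha : a ∉ c.arrs) : ∀ σ, (c.run σ).arr a = σ.arr a := by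
  induction c with
  | skip => intro σ; rfl
  | assign x t => intro σ; simp [Code.run]
  | store b t u => intro σ; simp_all [Code.run, Code.arrs, State.setArr_arr]
  | seq P Q ihP ihQ => intro σ; simp_all [Code.run, Code.arrs]
  | ite c P Q ihP ihQ =>
    intro σ
    simp only [Code.arrs, List.mem_append, not_or] at ha
    simp only [Code.run]
    split_ifs
    · exact ihP ha.1 σ
    · exact ihQ ha.2 σ
  | bdd x r P ih => intro σ; exact iter_arr x (ih ha) σ _

/-- The machine follows the abstract run up to the scratch registers. Register 4 and the loop limits
are never written, so their initial bounds hold throughout and control the time. -/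
theorem Code.compile_exec (ρ : ℕ → ℕ) (c : Code) : ∀ σ σ' : State, Agree 100 σ σ' →
    c.ok = true → (∀ r ∈ 4 :: c.limits, r ∉ c.regs ∧ σ.reg r ≤ ρ r) →
    ∃ τ t, Exec c.compile σ' τ t ∧ t ≤ c.time ρ ∧ Agree 100 (c.run σ) τ := by
  induction c with
  | skip =>
    intro σ σ' h _ _
    exact ⟨_, _, Exec.skip _, le_rfl, h⟩
  | assign x t =>
    intro σ σ' h hok hl
    simp only [Code.ok, Bool.and_eq_true, decide_eq_true_eq] at hok
    have h4 := (hl 4 (by simp)).2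
    rw [h.1 4 (by norm_num)] at h4
    obtain ⟨τ, s, h1, h2, h3, h5⟩ := t.compile_exec 100 σ' (by norm_num) hok.2
    refine ⟨_, _, Exec.seq h1 (Exec.assign _ _ _), ?_, ?_⟩
    · simp only [Expr.cost, Code.time]
      have : t.size * (30 * σ'.reg 4 + 30) ≤ t.size * (30 * ρ 4 + 30) := by gcongr
      omega
    · simp only [Code.run, Expr.eval, h5, Tm.eval_congr (by norm_num) h t hok.2]
      exact (h.trans h3).setReg_setReg _ _
  | store a t u =>
    intro σ σ' h hok hl
    simp only [Code.ok, Bool.and_eq_true, decide_eq_true_eq] at hok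
    have h4 := (hl 4 (by simp)).2
    rw [h.1 4 (by norm_num)] at h4
    obtain ⟨τ, s, h1, h2, h3, h5⟩ := t.compile_exec 100 σ' (by norm_num) hok.1
    obtain ⟨υ, s', e1, e2, e3, e5⟩ := u.compile_exec 101 τ (by norm_num) (by omega)
    refine ⟨_, _, Exec.seq h1 (Exec.seq e1 (Exec.store _ _ _ _)), ?_, ?_⟩
    · simp only [Expr.cost, Code.time, add_mul]
      rw [← h3.1 4 (by norm_num)] at e2
      have : t.size * (30 * σ'.reg 4 + 30) ≤ t.size * (30 * ρ 4 + 30) := by gcongr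
      have : u.size * (30 * σ'.reg 4 + 30) ≤ u.size * (30 * ρ 4 + 30) := by gcongr
      omega
    · have hag := (h.trans h3).trans (e3.mono (by norm_num))
      simp only [Code.run, Expr.eval, ← e3.1 100 (by norm_num), h5, e5,
        ← Tm.eval_congr (by norm_num) h3 u hok.2,
        Tm.eval_congr (by norm_num) h t hok.1, Tm.eval_congr (by norm_num) h u hok.2]
      refine ⟨hag.1, ?_⟩
      simp only [State.setArr, hag.2]
  | seq P Q ihP ihQ =>
    intro σ σ' h hok hl
    simp only [Code.ok, Bool.and_eq_true] at hok
    simp only [Code.limits, Code.regs, List.mem_cons, List.mem_append] at hl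
    obtain ⟨τ, s, h1, h2, h3⟩ := ihP σ σ' h hok.1 (fun r hr => by
      have := hl r (by simp at hr; tauto)
      exact ⟨fun h => this.1 (Or.inl h), this.2⟩)
    obtain ⟨υ, s', e1, e2, e3⟩ := ihQ _ τ h3 hok.2 (fun r hr => by
      have := hl r (by simp at hr; tauto)
      exact ⟨fun h => this.1 (Or.inr h), by
        rw [Code.run_reg (fun h => this.1 (Or.inl h))]; exact this.2⟩)
    exact ⟨υ, _, Exec.seq h1 e1, Nat.add_le_add h2 e2, e3⟩
  | ite c P Q ihP ihQ =>
    intro σ σ' h hok hl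
    simp only [Code.ok, Bool.and_eq_true, decide_eq_true_eq] at hok
    have h4 := (hl 4 (by simp)).2
    rw [h.1 4 (by norm_num)] at h4
    simp only [Code.limits, Code.regs, List.mem_cons, List.mem_append] at hl
    obtain ⟨τ, s, h1, h2, h3, h5⟩ := c.compile_exec 100 σ' (by norm_num) hok.1.1
    rw [← Tm.eval_congr (by norm_num) h c hok.1.1] at h5
    have : c.size * (30 * σ'.reg 4 + 30) ≤ c.size * (30 * ρ 4 + 30) := by gcongr
    by_cases h0 : c.eval σ = 0
    · obtain ⟨υ, s', e1, e2, e3⟩ := ihQ σ τ (h.trans h3) hok.2 (fun r hr => by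
        have := hl r (by simp at hr; tauto)
        exact ⟨fun h => this.1 (Or.inr h), this.2⟩)
      refine ⟨υ, _, Exec.seq h1 (Exec.iteFalse ?_ e1), ?_, ?_⟩
      · simp [Expr.eval, h5, h0]
      · simp only [Expr.cost, Code.time]; omega
      · simpa [Code.run, h0] using e3
    · obtain ⟨υ, s', e1, e2, e3⟩ := ihP σ τ (h.trans h3) hok.1.2 (fun r hr => by
        have := hl r (by simp at hr; tauto)
        exact ⟨fun h => this.1 (Or.inl h), this.2⟩)
      refine ⟨υ, _, Exec.seq h1 (Exec.iteTrue ?_ e1), ?_, ?_⟩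
      · simp [Expr.eval, h5, h0]
      · simp only [Expr.cost, Code.time]; omega
      · simpa [Code.run, h0] using e3
  | bdd x r P ih =>
    intro σ σ' h hok hl
    simp only [Code.ok, Bool.and_eq_true, decide_eq_true_eq, Bool.not_eq_true',
      List.contains_eq_mem, decide_eq_false_iff_not, bne_iff_ne] at hok
    obtain ⟨⟨⟨⟨hx, hr⟩, hxr⟩, hxP⟩, hP⟩ := hok
    simp only [Code.limits, Code.regs, List.mem_cons, not_or] at hl
    have hrP := hl r (by simp)
    -- Induction on the number `j` of rounds left, starting from an arbitrary machine state that
    -- agrees with round `i`.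
    have key : ∀ j i, i + j = σ.reg r → ∀ τ, Agree 100 (iter x P.run σ i) τ →
        ∃ υ t, Exec (.loop (.sub (.reg r) (.reg x))
          (.seq P.compile (.assign x (.add (.reg x) (.const 1))))) τ υ t ∧
          t ≤ j * (P.time ρ + 8) + 4 ∧ Agree 100 (iter x P.run σ (σ.reg r)) υ := by
      intro j
      induction j with
      | zero =>
        intro i hi τ hτ
        refine ⟨τ, _, Exec.loopDone ?_, by simp [Expr.cost], ?_⟩
        · simp only [Expr.eval]
          rw [← hτ.1 r hr, ← hτ.1 x hx, iter_reg,
            iter_reg_of_ne (Ne.symm hxr) (Code.run_reg hrP.1.2)]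
          omega
        · rw [← hi]; exact hτ
      | succ j ihj =>
        intro i hi τ hτ
        obtain ⟨υ, s, h1, h2, h3⟩ := ih _ τ hτ hP (fun q hq => by
          have := hl q (by simp at hq; tauto)
          exact ⟨this.1.2, by
            rw [iter_reg_of_ne this.1.1 (Code.run_reg this.1.2)]; exact this.2⟩)
        have hux : υ.reg x = i := by
          rw [← h3.1 x hx, Code.run_reg hxP, iter_reg]
        obtain ⟨ω, s', e1, e2, e3⟩ := ihj (i + 1) (by omega) (υ.setReg x (i + 1)) (by
          simp only [iter]
          exact h3.setReg_setReg _ _)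
        refine ⟨ω, _, Exec.loopStep (t := s') ?_ (Exec.seq h1 (Exec.assign _ _ _)) ?_, ?_, e3⟩
        · simp only [Expr.eval]
          rw [← hτ.1 r hr, ← hτ.1 x hx, iter_reg,
            iter_reg_of_ne (Ne.symm hxr) (Code.run_reg hrP.1.2)]
          omega
        · simpa [Expr.eval, hux] using e1
        · simp only [Expr.cost, add_mul]; omega
    obtain ⟨υ, t, e1, e2, e3⟩ := key (σ.reg r) 0 (by omega) (σ'.setReg x 0)
      (h.setReg_setReg _ _)
    refine ⟨υ, _, Exec.seq (Exec.assign _ _ _) e1, ?_, e3⟩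
    simp only [Expr.cost, Code.time]
    have : σ.reg r * (P.time ρ + 8) ≤ ρ r * (P.time ρ + 8) := by
      gcongr; exact hrP.2
    omega

/-- A size measure of bounded programs. -/
def Code.size : Code → ℕ
  | .skip => 1
  | .assign _ t => t.size + 1
  | .store _ t u => t.size + u.size + 1
  | .seq P Q => P.size + Q.size
  | .ite c P Q => c.size + P.size + Q.size + 1
  | .bdd _ _ P => P.size + 8

/-- The nesting depth of loops, plus one. -/
def Code.depth : Code → ℕ
  | .skip => 1
  | .assign _ _ => 1
  | .store _ _ _ => 1
  | .seq P Q => max P.depth Q.depth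
  | .ite _ P Q => max P.depth Q.depth
  | .bdd _ _ P => P.depth + 1

theorem Code.one_le_depth (c : Code) : 1 ≤ c.depth := by
  induction c <;> simp_all [Code.depth]

/-- Each level of loops multiplies the time by at most `30 * B + 30`; the summand 8 in the size of a
loop pays for its control. -/
theorem Code.time_le {ρ : ℕ → ℕ} {B : ℕ} (c : Code) (hB : ∀ r ∈ 4 :: c.limits, ρ r ≤ B) :
    c.time ρ ≤ c.size * (30 * B + 30) ^ c.depth := by
  have h4 : ρ 4 ≤ B := hB 4 (by simp)
  have hX : 30 ≤ 30 * B + 30 := by omega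
  have hle : 30 * ρ 4 + 30 ≤ 30 * B + 30 := by omega
  set X := 30 * B + 30 with hXdef
  induction c with
  | skip => simp [Code.time, Code.size, Code.depth]; omega
  | assign x t =>
    simp only [Code.time, Code.size, Code.depth, pow_one]
    nlinarith [Nat.mul_le_mul_left t.size hle]
  | store a t u =>
    simp only [Code.time, Code.size, Code.depth, pow_one]
    nlinarith [Nat.mul_le_mul_left (t.size + u.size) hle]
  | seq P Q ihP ihQ =>
    simp only [Code.time, Code.size, Code.depth, add_mul]
    have h1 := ihP (fun r hr => hB r (by simp [Code.limits] at hr ⊢; tauto))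
    have h2 := ihQ (fun r hr => hB r (by simp [Code.limits] at hr ⊢; tauto))
    refine Nat.add_le_add (h1.trans ?_) (h2.trans ?_)
    · exact Nat.mul_le_mul_left _ (Nat.pow_le_pow_right (by omega) (le_max_left _ _))
    · exact Nat.mul_le_mul_left _ (Nat.pow_le_pow_right (by omega) (le_max_right _ _))
  | ite c P Q ihP ihQ =>
    simp only [Code.time, Code.size, Code.depth, add_mul, one_mul]
    have h1 := ihP (fun r hr => hB r (by simp [Code.limits] at hr ⊢; tauto))
    have h2 := ihQ (fun r hr => hB r (by simp [Code.limits] at hr ⊢; tauto))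
    have hX1 : X ≤ X ^ max P.depth Q.depth := by
      calc X = X ^ 1 := (pow_one X).symm
        _ ≤ _ := Nat.pow_le_pow_right (by omega) ((P.one_le_depth).trans (le_max_left _ _))
    have h3 : P.size * X ^ P.depth ≤ P.size * X ^ max P.depth Q.depth :=
      Nat.mul_le_mul_left _ (Nat.pow_le_pow_right (by omega) (le_max_left _ _))
    have h4 : Q.size * X ^ Q.depth ≤ Q.size * X ^ max P.depth Q.depth :=
      Nat.mul_le_mul_left _ (Nat.pow_le_pow_right (by omega) (le_max_right _ _))
    have h5 : c.size * (30 * ρ 4 + 30) ≤ c.size * X ^ max P.depth Q.depth :=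
      Nat.mul_le_mul_left _ (hle.trans hX1)
    omega
  | bdd x r P ih =>
    simp only [Code.time, Code.size, Code.depth, pow_succ]
    have h1 := ih (fun r hr => hB r (by simp [Code.limits] at hr ⊢; tauto))
    have hr := hB r (by simp [Code.limits])
    have hpos : 1 ≤ X ^ P.depth := Nat.one_le_pow _ _ (by omega)
    calc ρ r * (P.time ρ + 8) + 6 ≤ (B + 1) * (P.time ρ + 8) := by
          nlinarith [Nat.mul_le_mul_right (P.time ρ + 8) hr]
      _ ≤ X * ((P.size + 8) * X ^ P.depth) := by
          apply Nat.mul_le_mul (by omega)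
          nlinarith
      _ = _ := by ring

/-- The invariant rule behind the correctness proofs of loops. The step also receives that
everything outside `P.regs` and `P.arrs` is unchanged since the start, so an invariant need only
mention what the body writes. -/
theorem Code.run_bdd_induct {x r : ℕ} {P : Code} {σ : State} (I : ℕ → State → Prop)
    (h0 : I 0 (σ.setReg x 0))
    (hstep : ∀ i < σ.reg r, ∀ s : State, s.reg x = i →
      (∀ y, y ∉ x :: P.regs → s.reg y = σ.reg y) → (∀ a, a ∉ P.arrs → s.arr a = σ.arr a) →
      I i s → I (i + 1) ((P.run s).setReg x (i + 1))) :
    I (σ.reg r) ((Code.bdd x r P).run σ) := by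
  have key : ∀ i ≤ σ.reg r, I i (iter x P.run σ i) := by
    intro i
    induction i with
    | zero => intro _; exact h0
    | succ i ih =>
      intro hi
      refine hstep i hi _ (iter_reg _ _ _ _) ?_ ?_ (ih (by omega))
      · intro y hy
        simp only [List.mem_cons, not_or] at hy
        exact iter_reg_of_ne hy.1 (Code.run_reg hy.2) _ _
      · intro a ha
        exact iter_arr x (Code.run_arr ha) _ _
  exact key _ le_rfl

/-- Each effective round subtracts at least one, so `a ≤ F` rounds reach the remainder, after which
rounds change nothing. -/
theorem iterate_divStep_of_pos {b : ℕ} (hb : 0 < b) :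
    ∀ (F a q : ℕ), a ≤ F → ((divStep b)^[F] (a, q)).2 = q + a / b := by
  intro F
  induction F with
  | zero => intro a q ha; simp [Nat.le_zero.1 ha]
  | succ F ih =>
    intro a q ha
    rw [Function.iterate_succ_apply]
    by_cases h : b ≤ a
    · rw [divStep, if_pos h, ih _ _ (by simp; omega), Nat.div_eq_sub_div hb h]
      simp only
      omega
    · have hz : ∀ n, (divStep b)^[n] (a, q) = (a, q) := by
        intro n
        induction n with
        | zero => rfl
        | succ n ihn => rw [Function.iterate_succ_apply, divStep, if_neg h, ihn]
      rw [divStep, if_neg h, hz, Nat.div_eq_of_lt (by omega)]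
      simp

theorem Tm.eval_div {σ : State} {t u : Tm} (hu : 0 < u.eval σ) (ht : t.eval σ ≤ σ.reg 4) :
    (Tm.div t u).eval σ = t.eval σ / u.eval σ := by
  rw [Tm.eval, iterate_divStep_of_pos hu _ _ _ ht, zero_add]

theorem Tm.eval_mul {σ : State} {t u : Tm} (ht : t.eval σ ≤ σ.reg 4) :
    (Tm.mul t u).eval σ = t.eval σ * u.eval σ := by
  rw [Tm.eval, min_eq_left ht]

/-! ### Derived terms and array operations -/

/-- Truth value of an equation. -/
def Tm.eq (t u : Tm) : Tm := .ite (.sub t u) (.const 0) (.ite (.sub u t) (.const 0) (.const 1))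

/-- A term that is nonzero if and only if `t < u`. -/
def Tm.lt (t u : Tm) : Tm := .sub u t

/-- Conjunction of truth values. -/
def Tm.and (t u : Tm) : Tm := .ite t u (.const 0)

/-- Negation of a truth value. -/
def Tm.not (t : Tm) : Tm := .ite t (.const 0) (.const 1)

/-- Exclusive disjunction of truth values. -/
def Tm.xor (t u : Tm) : Tm :=
  .ite t (.ite u (.const 0) (.const 1)) (.ite u (.const 1) (.const 0))

/-- Remainders. -/
def Tm.mod (t u : Tm) : Tm := .sub t (.mul (.div t u) u)

/-- Six times a term. -/
def Tm.six (t : Tm) : Tm := .add t (.add t (.add t (.add t (.add t t))))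

theorem Tm.eval_const (σ : State) (c : ℕ) : (Tm.const c).eval σ = c := rfl
theorem Tm.eval_reg (σ : State) (x : ℕ) : (Tm.reg x).eval σ = σ.reg x := rfl
theorem Tm.eval_get (σ : State) (a : ℕ) (t : Tm) : (Tm.get a t).eval σ = σ.arr a (t.eval σ) := rfl
theorem Tm.eval_add (σ : State) (t u : Tm) : (Tm.add t u).eval σ = t.eval σ + u.eval σ := rfl
theorem Tm.eval_sub (σ : State) (t u : Tm) : (Tm.sub t u).eval σ = t.eval σ - u.eval σ := rfl
theorem Tm.eval_ite (σ : State) (c t u : Tm) :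
    (Tm.ite c t u).eval σ = if c.eval σ ≠ 0 then t.eval σ else u.eval σ := rfl

theorem Tm.eval_eq_ne_zero {σ : State} {t u : Tm} :
    (Tm.eq t u).eval σ ≠ 0 ↔ t.eval σ = u.eval σ := by
  simp only [Tm.eq, Tm.eval]
  by_cases h1 : t.eval σ - u.eval σ = 0
  · by_cases h2 : u.eval σ - t.eval σ = 0
    · simp [h1, h2]; omega
    · simp [h1, h2]; omega
  · simp [h1]; omega

theorem Tm.eval_lt_ne_zero {σ : State} {t u : Tm} :
    (Tm.lt t u).eval σ ≠ 0 ↔ t.eval σ < u.eval σ := by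
  simp only [Tm.lt, Tm.eval]; omega

theorem Tm.eval_and_ne_zero {σ : State} {t u : Tm} :
    (Tm.and t u).eval σ ≠ 0 ↔ t.eval σ ≠ 0 ∧ u.eval σ ≠ 0 := by
  simp only [Tm.and, Tm.eval]
  split_ifs <;> simp_all

theorem Tm.eval_not_ne_zero {σ : State} {t : Tm} :
    (Tm.not t).eval σ ≠ 0 ↔ ¬ t.eval σ ≠ 0 := by
  simp only [Tm.not, Tm.eval]
  split_ifs <;> simp_all

theorem Tm.eval_six {σ : State} {t : Tm} : (Tm.six t).eval σ = 6 * t.eval σ := by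
  simp only [Tm.six, Tm.eval]; ring

theorem Tm.eval_mod {σ : State} {t u : Tm} (hu : 0 < u.eval σ) (ht : t.eval σ ≤ σ.reg 4) :
    (Tm.mod t u).eval σ = t.eval σ % u.eval σ := by
  rw [Tm.mod, Tm.eval_sub, Tm.eval_mul, Tm.eval_div hu ht]
  · have := Nat.div_add_mod (t.eval σ) (u.eval σ)
    rw [mul_comm] at this
    omega
  · rw [Tm.eval_div hu ht]
    exact (Nat.div_le_self _ _).trans ht

/-- The parity of a truth value. -/
def bit (x : ℕ) : ZMod 2 := if x = 0 then 0 else 1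

theorem bit_zero : bit 0 = 0 := rfl

theorem bit_eq_zero_iff {x : ℕ} : bit x = 0 ↔ x = 0 := by
  unfold bit; split_ifs <;> simp_all

theorem bit_xor {σ : State} {t u : Tm} :
    bit ((Tm.xor t u).eval σ) = bit (t.eval σ) + bit (u.eval σ) := by
  simp only [Tm.xor, Tm.eval, bit]
  by_cases h1 : t.eval σ = 0 <;> by_cases h2 : u.eval σ = 0 <;> simp [h1, h2]
  decide

/-- Tabulation of the values of register `z` after `P`. -/
def Code.tab (x r a : ℕ) (ti : Tm) (P : Code) (z : ℕ) : Code :=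
  .bdd x r (.seq P (.store a ti (.reg z)))

/-- The last hypothesis available in round `j` says that the entries from `off + j` on are still the
original ones. It allows a table to be overwritten in place, with entry `j` computed from its old
value. -/
theorem Code.run_tab {x r a z off : ℕ} {ti : Tm} {P : Code} (f : ℕ → ℕ) (σ : State)
    (ha : a ∉ P.arrs)
    (h : ∀ j < σ.reg r, ∀ s : State, s.reg x = j →
      (∀ y, y ∉ x :: P.regs → s.reg y = σ.reg y) →
      (∀ b, b ∉ a :: P.arrs → s.arr b = σ.arr b) →
      (∀ i, off + j ≤ i → s.arr a i = σ.arr a i) →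
      ti.eval (P.run s) = off + j ∧ (P.run s).reg z = f j) :
    ((Code.tab x r a ti P z).run σ).arr a =
      fun i => if off ≤ i ∧ i < off + σ.reg r then f (i - off) else σ.arr a i := by
  refine Code.run_bdd_induct (I := fun j s => s.arr a =
    fun i => if off ≤ i ∧ i < off + j then f (i - off) else σ.arr a i) ?_ ?_
  · funext i
    have : ¬ (off ≤ i ∧ i < off + 0) := by omega
    simp only [this, if_false, State.setReg_arr]
  · intro j hj s hsx hsr hsa hI
    have hregs : (Code.seq P (.store a ti (.reg z))).regs = P.regs := by simp [Code.regs]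
    have harrs : (Code.seq P (.store a ti (.reg z))).arrs = P.arrs ++ [a] := by simp [Code.arrs]
    rw [hregs] at hsr
    rw [harrs] at hsa
    obtain ⟨h1, h2⟩ := h j hj s hsx hsr (fun b hb => hsa b (by simpa [or_comm] using hb))
      (fun i hi => by
        rw [hI]
        have : ¬ (off ≤ i ∧ i < off + j) := by omega
        simp only [this, if_false])
    have hPa : (P.run s).arr a = s.arr a := Code.run_arr ha s
    simp only [Code.run, State.setReg_arr, State.setArr_arr, if_true, h1, Tm.eval_reg, h2, hPa, hI]
    funext i
    by_cases hi : i = off + j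
    · subst hi
      simp
    · rw [Function.update_of_ne hi]
      have : (off ≤ i ∧ i < off + j) ↔ (off ≤ i ∧ i < off + (j + 1)) := by omega
      simp only [this]

/-- Two-dimensional tabulation. -/
theorem Code.run_tab_tab {x y r a z off n : ℕ} {ti t : Tm} (f : ℕ → ℕ) (σ : State) (hr : σ.reg r = n)
    (hxy : x ≠ y) (hxz : x ≠ z) (hrx : r ≠ x) (hry : r ≠ y) (hrz : r ≠ z)
    (h : ∀ i < n, ∀ j < n, ∀ s : State, s.reg x = i → s.reg y = j →
      (∀ w, w ≠ x → w ≠ y → w ≠ z → s.reg w = σ.reg w) →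
      (∀ b, b ≠ a → s.arr b = σ.arr b) →
      ti.eval (s.setReg z (t.eval s)) = off + (i * n + j) ∧ t.eval s = f (i * n + j)) :
    ((Code.bdd x r (Code.tab y r a ti (.assign z t) z)).run σ).arr a =
      fun i => if off ≤ i ∧ i < off + n * n then f (i - off) else σ.arr a i := by
  have hgoal := Code.run_bdd_induct (x := x) (r := r)
    (P := Code.tab y r a ti (.assign z t) z) (σ := σ) (I := fun j s => s.arr a =
    fun i => if off ≤ i ∧ i < off + j * n then f (i - off) else σ.arr a i) ?_ ?_
  · rw [hgoal, hr]
  · funext i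
    have : ¬ (off ≤ i ∧ i < off + 0 * n) := by omega
    simp only [this, if_false, State.setReg_arr]
  · intro i hi s hsx hsr hsa hI
    rw [hr] at hi
    have hregs : (Code.tab y r a ti (.assign z t) z).regs = [y, z] := by simp [Code.regs, Code.tab]
    have harrs : (Code.tab y r a ti (.assign z t) z).arrs = [a] := by simp [Code.arrs, Code.tab]
    rw [hregs] at hsr
    rw [harrs] at hsa
    have hsn : s.reg r = n := by rw [hsr r (by simp [hrx, hry, hrz]), hr]
    have hin := Code.run_tab (x := y) (r := r) (a := a) (z := z) (off := off + i * n) (ti := ti)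
      (P := .assign z t) (fun j => f (i * n + j)) s (by simp [Code.arrs]) ?_
    · rw [State.setReg_arr, hin, hsn, hI]
      funext l
      by_cases h1 : off + i * n ≤ l ∧ l < off + i * n + n
      · have h2 : off ≤ l ∧ l < off + (i + 1) * n := by
          rw [add_mul, one_mul]; omega
        simp only [h1, h2, and_self, if_true]
        congr 1
        omega
      · have h2 : (off ≤ l ∧ l < off + (i + 1) * n) ↔ (off ≤ l ∧ l < off + i * n) := by
          rw [add_mul, one_mul]; omega
        rw [if_neg h1]
        simp only [h2]
    · intro j hj s' hsy hsr' hsa' _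
      rw [hsn] at hj
      simp only [Code.regs, List.mem_cons, List.not_mem_nil, or_false, not_or] at hsr' hsr
      simp only [Code.arrs, List.mem_cons, List.not_mem_nil, or_false] at hsa' hsa
      obtain ⟨h1, h2⟩ := h i hi j hj s' (by rw [hsr' x ⟨hxy, hxz⟩, hsx]) hsy
        (fun w h1 h2 h3 => by rw [hsr' w ⟨h2, h3⟩, hsr w ⟨h1, h2, h3⟩])
        (fun b hb => by rw [hsa' b hb, hsa b hb])
      refine ⟨?_, ?_⟩
      · simp only [Code.run]
        rw [h1]
        omega
      · simp [Code.run, h2]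

/-! ### Gaussian elimination over the field with two elements -/

/-- The vector stored in the `R` entries from position `off` on. -/
def vecAt (a : ℕ → ℕ) (off R : ℕ) : ℕ → ZMod 2 := fun j => if j < R then bit (a (off + j)) else 0

/-- The span of the rows of length `R` (at distance `F`) whose flag is set. -/
def rowSpan (F R : ℕ) (fl rw : ℕ → ℕ) : Submodule (ZMod 2) (ℕ → ZMod 2) :=
  Submodule.span (ZMod 2) {v | ∃ p < R, fl p ≠ 0 ∧ v = vecAt rw (p * F) R}

/-- The rows are in echelon form: the first nonzero entry of row `p` is in position `p`. -/
def Echelon (F R : ℕ) (fl rw : ℕ → ℕ) : Prop :=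
  ∀ p < R, fl p ≠ 0 → rw (p * F + p) ≠ 0 ∧ ∀ j < p, rw (p * F + j) = 0

/-- Insertion of the vector in array 10 into the rows in echelon form, with flags in array `fl`,
rows in array `rw` and length `reg r`. Register 22 is set to 1 if the span grows. -/
def insertCode (r fl rw : ℕ) : Code :=
  .bdd 30 r (.ite (.get 10 (.reg 30))
    (.ite (.get fl (.reg 30))
      (.tab 31 r 10 (.reg 31) (.assign 32 (.xor (.get 10 (.reg 31))
        (.get rw (.add (.mul (.reg 30) (.reg 4)) (.reg 31))))) 32)
      (.seq (.tab 31 r rw (.add (.mul (.reg 30) (.reg 4)) (.reg 31))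
          (.assign 32 (.get 10 (.reg 31))) 32)
        (.seq (.tab 31 r 10 (.reg 31) (.assign 32 (.const 0)) 32)
          (.seq (.store fl (.reg 30) (.const 1)) (.assign 22 (.const 1))))))
    .skip)

/-- The effect of an insertion on flags, rows and register 22. -/
structure Inserted (F R : ℕ) (fl rw fl' rw' : ℕ → ℕ) (q q' : ℕ) : Prop where
  flag_mono : ∀ p, fl p ≠ 0 → fl' p ≠ 0
  row_eq : ∀ p < R, fl p ≠ 0 → ∀ j < R, rw' (p * F + j) = rw (p * F + j)
  change : (q' = q ∧ fl' = fl) ∨ (q' = 1 ∧ ∃ p < R, fl p = 0 ∧ fl' p ≠ 0)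

theorem Inserted.refl (F R : ℕ) (fl rw : ℕ → ℕ) (q : ℕ) : Inserted F R fl rw fl rw q q :=
  ⟨fun _ h => h, fun _ _ _ _ _ => rfl, Or.inl ⟨rfl, rfl⟩⟩

theorem Inserted.trans {F R : ℕ} {fl rw fl' rw' fl'' rw'' : ℕ → ℕ} {q q' q'' : ℕ}
    (h : Inserted F R fl rw fl' rw' q q') (h' : Inserted F R fl' rw' fl'' rw'' q' q'') :
    Inserted F R fl rw fl'' rw'' q q'' := by
  refine ⟨fun p hp => h'.flag_mono p (h.flag_mono p hp), fun p hp hf j hj => ?_, ?_⟩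
  · rw [h'.row_eq p hp (h.flag_mono p hf) j hj, h.row_eq p hp hf j hj]
  · rcases h'.change with ⟨h1, h2⟩ | ⟨h1, p, h2, h3, h4⟩
    · rw [h1, h2]; exact h.change
    · refine Or.inr ⟨h1, p, h2, ?_, h4⟩
      by_contra h5
      exact h.flag_mono p h5 h3

theorem rowSpan_congr {F R : ℕ} {fl rw rw' : ℕ → ℕ}
    (h : ∀ p < R, fl p ≠ 0 → ∀ j < R, rw' (p * F + j) = rw (p * F + j)) :
    rowSpan F R fl rw' = rowSpan F R fl rw := by
  have : ∀ p < R, fl p ≠ 0 → vecAt rw' (p * F) R = vecAt rw (p * F) R := by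
    intro p hp hf
    funext j
    unfold vecAt
    split_ifs with hj
    · rw [h p hp hf j hj]
    · rfl
  unfold rowSpan
  congr 1
  ext v
  constructor
  · rintro ⟨p, hp, hf, rfl⟩; exact ⟨p, hp, hf, this p hp hf⟩
  · rintro ⟨p, hp, hf, rfl⟩; exact ⟨p, hp, hf, (this p hp hf).symm⟩

theorem rowSpan_insert {F R p : ℕ} (hp : p < R) {fl rw : ℕ → ℕ} :
    rowSpan F R (Function.update fl p 1) rw =
      rowSpan F R (Function.update fl p 0) rw ⊔ Submodule.span (ZMod 2) {vecAt rw (p * F) R} := by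
  unfold rowSpan
  rw [← Submodule.span_union]
  congr 1
  ext v
  constructor
  · rintro ⟨q, hq, hf, rfl⟩
    by_cases hqp : q = p
    · subst hqp; right; rfl
    · left
      exact ⟨q, hq, by simpa [hqp] using hf, rfl⟩
  · rintro (⟨q, hq, hf, rfl⟩ | rfl)
    · by_cases hqp : q = p
      · subst hqp; simp at hf
      · exact ⟨q, hq, by simpa [hqp] using hf, rfl⟩
    · exact ⟨p, hp, by simp, rfl⟩

theorem insertCode_regs (r fl rw : ℕ) :
    ∀ y ∈ (insertCode r fl rw).regs, y = 22 ∨ y = 30 ∨ y = 31 ∨ y = 32 := by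
  simp [insertCode, Code.regs, Code.tab]

theorem insertCode_arrs (r fl rw : ℕ) :
    ∀ a ∈ (insertCode r fl rw).arrs, a = 10 ∨ a = fl ∨ a = rw := by
  simp [insertCode, Code.arrs, Code.tab]

/-- Round `p` clears coordinate `p` of the vector in array 10. If row `p` exists it is added to the
vector, otherwise the vector itself becomes row `p` and is replaced by zero. The span of the rows
together with the vector is the same after each round, and at the end the vector is zero. -/
theorem insertCode_spec {r fl rw F R : ℕ} (hr : r < 22) (h1 : fl ≠ 10) (h2 : rw ≠ 10) (h3 : fl ≠ rw)
    {σ : State} (hF : σ.reg 4 = F) (hR : σ.reg r = R) (hRF : R ≤ F)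
    (hech : Echelon F R (σ.arr fl) (σ.arr rw)) {τ : State} (hτ : τ = (insertCode r fl rw).run σ) :
    Echelon F R (τ.arr fl) (τ.arr rw) ∧
    Inserted F R (σ.arr fl) (σ.arr rw) (τ.arr fl) (τ.arr rw) (σ.reg 22) (τ.reg 22) ∧
    rowSpan F R (τ.arr fl) (τ.arr rw) =
      rowSpan F R (σ.arr fl) (σ.arr rw) ⊔ Submodule.span (ZMod 2) {vecAt (σ.arr 10) 0 R} := by
  -- Rows of length `R` start at multiples of `F ≥ R`, so they do not overlap.
  have hidx : ∀ {p q i j : ℕ}, i < R → j < R → p * F + i = q * F + j → p = q := by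
    intro p q i j hi hj h
    have e1 : (p * F + i) / F = p := by
      rw [mul_comm, Nat.mul_add_div (by omega), Nat.div_eq_of_lt (by omega), add_zero]
    have e2 : (q * F + j) / F = q := by
      rw [mul_comm, Nat.mul_add_div (by omega), Nat.div_eq_of_lt (by omega), add_zero]
    rw [← e1, h, e2]
  have key := Code.run_bdd_induct (x := 30) (r := r) (σ := σ)
    (P := .ite (.get 10 (.reg 30))
    (.ite (.get fl (.reg 30))
      (.tab 31 r 10 (.reg 31) (.assign 32 (.xor (.get 10 (.reg 31))
        (.get rw (.add (.mul (.reg 30) (.reg 4)) (.reg 31))))) 32)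
      (.seq (.tab 31 r rw (.add (.mul (.reg 30) (.reg 4)) (.reg 31))
          (.assign 32 (.get 10 (.reg 31))) 32)
        (.seq (.tab 31 r 10 (.reg 31) (.assign 32 (.const 0)) 32)
          (.seq (.store fl (.reg 30) (.const 1)) (.assign 22 (.const 1))))))
    .skip)
    (I := fun p s => Echelon F R (s.arr fl) (s.arr rw) ∧
      Inserted F R (σ.arr fl) (σ.arr rw) (s.arr fl) (s.arr rw) (σ.reg 22) (s.reg 22) ∧
      (∀ j < p, j < R → s.arr 10 j = 0) ∧
      rowSpan F R (s.arr fl) (s.arr rw) ⊔ Submodule.span (ZMod 2) {vecAt (s.arr 10) 0 R} =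
      rowSpan F R (σ.arr fl) (σ.arr rw) ⊔ Submodule.span (ZMod 2) {vecAt (σ.arr 10) 0 R})
    ⟨hech, by simpa [State.setReg_reg] using Inserted.refl _ _ _ _ _, by simp, rfl⟩ ?_
  · change τ = _ at hτ
    rw [insertCode] at hτ
    rw [← hτ, hR] at key
    obtain ⟨k1, k2, k3, k4⟩ := key
    refine ⟨k1, k2, ?_⟩
    have hz : vecAt (τ.arr 10) 0 R = 0 := by
      funext j
      unfold vecAt
      split_ifs with hj
      · rw [zero_add, k3 j hj hj]; rfl
      · rfl
    rwa [hz, Submodule.span_zero_singleton, sup_bot_eq] at k4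
  · intro p hp s hs30 hsr hsa ⟨i1, i2, i3, i4⟩
    rw [hR] at hp
    have hs4 : s.reg 4 = F := by rw [hsr 4 (by simp [Code.regs, Code.tab]), hF]
    have hsR : s.reg r = R := by
      rw [hsr r (by simp [Code.regs, Code.tab]; omega), hR]
    simp only [Code.run, State.setReg_arr, State.setReg_reg, Tm.eval_get, Tm.eval_reg, hs30]
    norm_num only [if_neg, ite_false]
    by_cases hv : s.arr 10 p = 0
    · simp only [hv]
      simp only [ne_eq, not_true_eq_false, if_false]
      refine ⟨i1, i2, fun j hj hjR => ?_, i4⟩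
      by_cases hjp : j = p
      · rw [hjp, hv]
      · exact i3 j (by omega) hjR
    · rw [if_pos hv]
      by_cases hf : s.arr fl p = 0
      · rw [if_neg (by simpa using hf)]
        set s1 := Code.run (.tab 31 r rw (.add (.mul (.reg 30) (.reg 4)) (.reg 31))
          (.assign 32 (.get 10 (.reg 31))) 32) s with hs1
        set s2 := Code.run (.tab 31 r 10 (.reg 31) (.assign 32 (.const 0)) 32) s1 with hs2
        have hs1rw : s1.arr rw = fun i => if p * F ≤ i ∧ i < p * F + R then s.arr 10 (i - p * F)
            else s.arr rw i := by
          rw [hs1, Code.run_tab (off := p * F) (s.arr 10) s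
            (by simp [Code.arrs]), hsR]
          intro j hj s' h1' h2' h3' h4'
          simp only [Code.regs, Code.arrs, List.mem_cons, List.not_mem_nil, or_false, not_or]
            at h2' h3'
          have e30 : s'.reg 30 = p := by rw [h2' 30 (by norm_num), hs30]
          have e4 : s'.reg 4 = F := by rw [h2' 4 (by norm_num), hs4]
          refine ⟨?_, ?_⟩
          · simp only [Code.run]
            rw [Tm.eval_add, Tm.eval_mul] <;>
            simp [Tm.eval, State.setReg_reg, e30, e4, h1']
            omega
          · simp [Code.run, Tm.eval, h1', h3' 10 (Ne.symm h2)]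
        have hs110 : s1.arr 10 = s.arr 10 :=
          Code.run_arr (by simpa [Code.arrs, Code.tab] using Ne.symm h2) s
        have hs1fl : s1.arr fl = s.arr fl :=
          Code.run_arr (by simpa [Code.arrs, Code.tab] using h3) s
        have hs1r : ∀ y, y ≠ 31 → y ≠ 32 → s1.reg y = s.reg y := fun y e1 e2 =>
          Code.run_reg (by simp [Code.regs, Code.tab, e1, e2]) s
        have hs2r : ∀ y, y ≠ 31 → y ≠ 32 → s2.reg y = s.reg y := fun y e1 e2 => by
          rw [hs2, Code.run_reg (by simp [Code.regs, Code.tab, e1, e2]), hs1r y e1 e2]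
        have hs2a : ∀ a, a ≠ 10 → s2.arr a = s1.arr a := fun a e =>
          Code.run_arr (by simpa [Code.arrs, Code.tab] using e) s1
        have hs210 : s2.arr 10 = fun i => if i < R then 0 else s.arr 10 i := by
          rw [hs2, Code.run_tab (off := 0) (fun _ => 0) s1
            (by simp [Code.arrs]), hs1r r (by omega) (by omega), hsR, hs110]
          · simp
          · intro j hj s' h1' _ _ _
            simp [Code.run, Tm.eval, State.setReg_reg, h1']
        have e30 : s2.reg 30 = p := by rw [hs2r 30 (by norm_num) (by norm_num), hs30]
        have efl : s2.arr fl = s.arr fl := by rw [hs2a fl h1, hs1fl]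
        have erw : s2.arr rw = s1.arr rw := hs2a rw h2
        simp only [State.setArr_arr, State.setReg_arr, State.setReg_reg, State.setArr_reg, e30, Tm.eval_const, if_neg (Ne.symm h1),
          if_neg (Ne.symm h3), if_true, efl, erw, hs210]
        -- Storing row `p` leaves the other rows intact.
        have hother : ∀ q < R, q ≠ p → ∀ j < R, s1.arr rw (q * F + j) = s.arr rw (q * F + j) := by
          intro q hq hqp j hj
          rw [hs1rw]
          simp only
          rw [if_neg]
          rintro ⟨e1, e2⟩
          exact hqp (hidx (i := j) (j := q * F + j - p * F) hj (by omega) (by omega))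
        have hown : ∀ j < R, s1.arr rw (p * F + j) = s.arr 10 j := by
          intro j hj
          rw [hs1rw]
          simp only
          rw [if_pos (by omega), Nat.add_sub_cancel_left]
        have hvec : vecAt (s1.arr rw) (p * F) R = vecAt (s.arr 10) 0 R := by
          funext j
          unfold vecAt
          split_ifs with hj
          · rw [hown j hj, zero_add]
          · rfl
        have hspan0 : rowSpan F R (Function.update (s.arr fl) p 0) (s1.arr rw) =
            rowSpan F R (s.arr fl) (s.arr rw) := by
          have : Function.update (s.arr fl) p 0 = s.arr fl := by
            rw [← hf]; exact Function.update_eq_self _ _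
          rw [this]
          exact rowSpan_congr fun q hq hfq j hj =>
            hother q hq (fun h => hfq (h ▸ hf)) j hj
        refine ⟨?_, ?_, ?_, ?_⟩
        · intro q hq hfq
          by_cases hqp : q = p
          · subst hqp
            refine ⟨by rw [hown q hq]; exact hv, fun j hj => ?_⟩
            rw [hown j (by omega)]
            exact i3 j hj (by omega)
          · rw [Function.update_of_ne hqp] at hfq
            have := i1 q hq hfq
            refine ⟨by rw [hother q hq hqp q hq]; exact this.1, fun j hj => ?_⟩
            rw [hother q hq hqp j (by omega)]
            exact this.2 j hj
        · refine i2.trans ⟨fun q hfq => ?_, fun q hq hfq j hj => ?_, Or.inr ⟨?_, p, hp, hf, by simp⟩⟩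
          · by_cases hqp : q = p
            · subst hqp; simp
            · rwa [Function.update_of_ne hqp]
          · exact hother q hq (fun h => hfq (h ▸ hf)) j hj
          · simp
        · intro j hj hjR
          simp [hjR]
        · rw [rowSpan_insert hp, hspan0, hvec, ← i4]
          have hz : vecAt (fun i => if i < R then 0 else s.arr 10 i) 0 R = 0 := by
            funext j
            unfold vecAt
            split_ifs with hj
            · simp [hj, bit_zero]
            · rfl
          rw [hz, Submodule.span_zero_singleton, sup_bot_eq]
      · rw [if_pos hf]
        set s1 := Code.run (.tab 31 r 10 (.reg 31) (.assign 32 (.xor (.get 10 (.reg 31))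
          (.get rw (.add (.mul (.reg 30) (.reg 4)) (.reg 31))))) 32) s with hs1
        have hfl : s1.arr fl = s.arr fl :=
          Code.run_arr (by simpa [Code.arrs, Code.tab] using h1) s
        have hrw : s1.arr rw = s.arr rw :=
          Code.run_arr (by simpa [Code.arrs, Code.tab] using h2) s
        have h22 : s1.reg 22 = s.reg 22 :=
          Code.run_reg (by simp [Code.regs, Code.tab]) s
        have h10 : ∀ j < R, bit (s1.arr 10 j) = bit (s.arr 10 j) + bit (s.arr rw (p * F + j)) := by
          let f : ℕ → ℕ := fun j => if s.arr 10 j ≠ 0 then (if s.arr rw (p * F + j) ≠ 0 then 0 else 1)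
            else (if s.arr rw (p * F + j) ≠ 0 then 1 else 0)
          have hbf : ∀ j, bit (f j) = bit (s.arr 10 j) + bit (s.arr rw (p * F + j)) := by
            intro j
            simp only [f, bit]
            by_cases e1 : s.arr 10 j = 0 <;> by_cases e2 : s.arr rw (p * F + j) = 0 <;>
              simp [e1, e2]
            decide
          have : s1.arr 10 = fun i => if i < R then f i else s.arr 10 i := by
            rw [hs1, Code.run_tab (off := 0) f s (by simp [Code.arrs]), hsR]
            · simp
            · intro j hj s' h1' h2' h3' h4'
              simp only [Code.regs, Code.arrs, List.mem_cons, List.not_mem_nil, or_false, not_or]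
                at h2' h3'
              have e30 : s'.reg 30 = p := by rw [h2' 30 (by norm_num), hs30]
              have e4 : s'.reg 4 = F := by rw [h2' 4 (by norm_num), hs4]
              have e10 : s'.arr 10 j = s.arr 10 j := h4' j (by omega)
              have emul : (Tm.mul (.reg 30) (.reg 4)).eval s' = p * F := by
                rw [Tm.eval_mul] <;> simp [Tm.eval, e30, e4]
                omega
              refine ⟨by simp [Code.run, Tm.eval, State.setReg_reg, h1'], ?_⟩
              simp only [Code.run, Tm.xor, Tm.eval_ite, Tm.eval_get, Tm.eval_add, Tm.eval_reg,
                emul, h1', e10, h3' rw h2, Tm.eval_const, State.setReg_reg_self, f]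
          intro j hj
          rw [this]
          simp only [hj, if_true]
          exact hbf j
        have hvec : vecAt (s1.arr 10) 0 R = vecAt (s.arr 10) 0 R + vecAt (s.arr rw) (p * F) R := by
          funext j
          simp only [vecAt, Pi.add_apply]
          split_ifs with hj
          · simp [h10 j hj]
          · simp
        rw [hfl, hrw, h22]
        refine ⟨i1, i2, ?_, ?_⟩
        · intro j hj hjR
          -- At the pivot `1 + 1 = 0`; before the pivot both the vector and row `p` are zero
          -- already.
          rw [← bit_eq_zero_iff, h10 j hjR]
          by_cases hjp : j = p
          · subst hjp
            have e1 : bit (s.arr 10 j) = 1 := by simp [bit, hv]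
            have e2 : bit (s.arr rw (j * F + j)) = 1 := by simp [bit, (i1 j hp hf).1]
            rw [e1, e2]; decide
          · rw [i3 j (by omega) hjR, (i1 p hp hf).2 j (by omega)]
            simp [bit_zero]
        · rw [← i4, hvec]
          have hmem : vecAt (s.arr rw) (p * F) R ∈ rowSpan F R (s.arr fl) (s.arr rw) :=
            Submodule.subset_span ⟨p, hp, hf, rfl⟩
          apply le_antisymm
          · refine sup_le le_sup_left ?_
            rw [Submodule.span_singleton_le_iff_mem]
            exact Submodule.add_mem _ (Submodule.mem_sup_right (Submodule.mem_span_singleton_self _))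
              (Submodule.mem_sup_left hmem)
          · refine sup_le le_sup_left ?_
            rw [Submodule.span_singleton_le_iff_mem]
            -- Conversely, the old vector is the new one minus row `p`.
            have := Submodule.sub_mem _ (Submodule.mem_sup_right
              (S := rowSpan F R (s.arr fl) (s.arr rw)) (Submodule.mem_span_singleton_self
              (vecAt (s.arr 10) 0 R + vecAt (s.arr rw) (p * F) R))) (Submodule.mem_sup_left hmem)
            simpa using this

end RAM

/-! ### Reading the input -/

theorem bitArray_ne_zero_iff {T : Set ℕ} {j : ℕ} : bitArray T j ≠ 0 ↔ j ∈ T := by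
  unfold bitArray; split_ifs with h <;> simp [h]

theorem bitArray_eq_ite {T : Set ℕ} {j : ℕ} {p : Prop} [Decidable p] (h : j ∈ T ↔ p) :
    bitArray T j = if p then 1 else 0 := by
  unfold bitArray
  by_cases hp : p
  · rw [if_pos (h.2 hp), if_pos hp]
  · rw [if_neg (fun h' => hp (h.1 h')), if_neg hp]

theorem vertexSetArray_ne_zero_iff {n : ℕ} {X : Finset (Fin n)} {v : Fin n} :
    vertexSetArray X v ≠ 0 ↔ v ∈ X := by
  rw [vertexSetArray, bitArray_ne_zero_iff]
  constructor
  · rintro ⟨w, hw, h⟩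
    rwa [Fin.ext h]
  · intro h; exact ⟨v, h, rfl⟩

theorem pair_index_inj {n a b c d : ℕ} (hb : b < n) (hd : d < n) (h : a * n + b = c * n + d) :
    a = c ∧ b = d := by
  have e1 : (a * n + b) / n = a := by
    rw [mul_comm, Nat.mul_add_div (by omega), Nat.div_eq_of_lt hb, add_zero]
  have e2 : (c * n + d) / n = c := by
    rw [mul_comm, Nat.mul_add_div (by omega), Nat.div_eq_of_lt hd, add_zero]
  have : a = c := by rw [← e1, h, e2]
  subst this
  omega

theorem graphArray_ne_zero_iff {n : ℕ} {G : SimpleGraph (Fin n)} {u v : Fin n} :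
    graphArray G (u * n + v) ≠ 0 ↔ G.Adj u v := by
  rw [graphArray, bitArray_ne_zero_iff]
  constructor
  · rintro ⟨a, b, hab, h⟩
    obtain ⟨h1, h2⟩ := pair_index_inj v.2 b.2 h
    rwa [Fin.ext h1, Fin.ext h2]
  · intro h; exact ⟨u, v, h, rfl⟩

open Classical in
theorem familyArray_eq_ite {n : ℕ} {L : List (Finset (Sym2 (Fin n)))} {i : ℕ}
    (hi : i < L.length) (u v : Fin n) :
    familyArray L (i * (n * n) + (u * n + v)) = if s(u, v) ∈ L[i] then 1 else 0 := by
  rw [familyArray]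
  apply bitArray_eq_ite
  constructor
  · rintro ⟨j, a, b, hab, h⟩
    have h' : (i * n + u) * n + v = (j * n + a) * n + b := by rw [← h]; ring
    obtain ⟨h1, h2⟩ := pair_index_inj v.2 b.2 h'
    obtain ⟨h3, h4⟩ := pair_index_inj u.2 a.2 h1
    rw [Fin.ext h2, Fin.ext h4]
    subst h3
    exact hab
  · intro h
    exact ⟨⟨i, hi⟩, u, v, h, by ring⟩

/-! ### Memory layout; degrees and components of the current certificate -/

namespace RAM

/-- The index of an entry in a matrix with `reg 0` columns. -/
def Tm.pair (t u : Tm) : Tm := .add (.mul t (.reg 0)) u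

theorem Tm.eval_pair {σ : State} {t u : Tm} (ht : t.eval σ ≤ σ.reg 4) :
    (Tm.pair t u).eval σ = t.eval σ * σ.reg 0 + u.eval σ := by
  rw [Tm.pair, Tm.eval_add, Tm.eval_mul ht, Tm.eval_reg]

/-- The memory during the main loop: the input, the cover as a list in array 5, and powers of six
in array 6. -/
structure Base {n : ℕ} (G : SimpleGraph (Fin n)) (A C : Finset (Fin n))
    (L : List (Finset (Sym2 (Fin n)))) (z : ℕ → Fin n) (k : ℕ) (σ : State) : Prop where
  reg0 : σ.reg 0 = n
  reg3 : σ.reg 3 = k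
  reg4 : σ.reg 4 = 216 ^ k + n
  reg5 : σ.reg 5 = 6 ^ k
  reg6 : σ.reg 6 = 3 * k
  arr0 : σ.arr 0 = graphArray G
  arr1 : σ.arr 1 = vertexSetArray A
  arr2 : σ.arr 2 = vertexSetArray C
  arr3 : σ.arr 3 = familyArray L
  arr6 : ∀ i ≤ 3 * k, σ.arr 6 i = 6 ^ i
  arr5 : ∀ i < k, σ.arr 5 i = z i

section Base

variable {n : ℕ} {G : SimpleGraph (Fin n)} {A C : Finset (Fin n)}
  {L : List (Finset (Sym2 (Fin n)))} {z : ℕ → Fin n} {k : ℕ} {σ τ : State}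

theorem Base.of_frame (h : Base G A C L z k σ)
    (hr : ∀ y, y = 0 ∨ y = 3 ∨ y = 4 ∨ y = 5 ∨ y = 6 → τ.reg y = σ.reg y)
    (ha : ∀ a, a = 0 ∨ a = 1 ∨ a = 2 ∨ a = 3 ∨ a = 6 → τ.arr a = σ.arr a)
    (h5 : ∀ i < k, τ.arr 5 i = σ.arr 5 i) : Base G A C L z k τ where
  reg0 := by rw [hr 0 (by simp), h.reg0]
  reg3 := by rw [hr 3 (by simp), h.reg3]
  reg4 := by rw [hr 4 (by simp), h.reg4]
  reg5 := by rw [hr 5 (by simp), h.reg5]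
  reg6 := by rw [hr 6 (by simp), h.reg6]
  arr0 := by rw [ha 0 (by simp), h.arr0]
  arr1 := by rw [ha 1 (by simp), h.arr1]
  arr2 := by rw [ha 2 (by simp), h.arr2]
  arr3 := by rw [ha 3 (by simp), h.arr3]
  arr6 := by rw [ha 6 (by simp)]; exact h.arr6
  arr5 := fun i hi => by rw [h5 i hi, h.arr5 i hi]

/-- The registers and arrays that carry the fixed data are not changed. -/
def Code.keepsBase (c : Code) : Bool :=
  !c.regs.contains 0 && !c.regs.contains 3 && !c.regs.contains 4 && !c.regs.contains 5 &&
  !c.regs.contains 6 && !c.arrs.contains 0 && !c.arrs.contains 1 && !c.arrs.contains 2 &&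
  !c.arrs.contains 3 && !c.arrs.contains 6

theorem Base.of_code (h : Base G A C L z k σ) {c : Code} (hc : c.keepsBase = true)
    (hr : ∀ y, y ∉ c.regs → τ.reg y = σ.reg y) (ha : ∀ a, a ∉ c.arrs → τ.arr a = σ.arr a)
    (h5 : ∀ i < k, τ.arr 5 i = σ.arr 5 i) : Base G A C L z k τ := by
  simp only [Code.keepsBase, Bool.and_eq_true, Bool.not_eq_true', List.contains_eq_mem,
    decide_eq_false_iff_not] at hc
  obtain ⟨⟨⟨⟨⟨⟨⟨⟨⟨h1, h2⟩, h3⟩, h4⟩, h5'⟩, h6⟩, h7⟩, h8⟩, h9⟩, h10⟩ := hc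
  refine h.of_frame ?_ ?_ h5
  · rintro y (rfl | rfl | rfl | rfl | rfl) <;> exact hr _ ‹_›
  · rintro a (rfl | rfl | rfl | rfl | rfl) <;> exact ha _ ‹_›

theorem Base.run (h : Base G A C L z k σ) {c : Code} (hc : c.keepsBase = true)
    (h5 : c.arrs.contains 5 = false) : Base G A C L z k (c.run σ) :=
  h.of_code hc (fun _ hy => Code.run_reg hy σ) (fun _ hy => Code.run_arr hy σ)
    (fun i _ => by rw [Code.run_arr (by simpa using h5)])

theorem Base.le_reg4 (h : Base G A C L z k σ) : n ≤ σ.reg 4 := by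
  rw [h.reg4]; exact Nat.le_add_left _ _

/-- Degrees of the current edge set, to array 7. -/
def degCode : Code :=
  .tab 13 0 7 (.reg 13) (.seq (.assign 14 (.const 0)) (.bdd 15 0 (.assign 14
    (.add (.reg 14) (.get 3 (.add (.reg 12) (.pair (.reg 13) (.reg 15)))))))) 14

theorem degCode_spec (h : Base G A C L z k σ) {i : ℕ} (hi : i < L.length)
    (h12 : σ.reg 12 = i * (n * n)) (v : Fin n) :
    (degCode.run σ).arr 7 v = edgeDeg L[i] v := by
  classical
  rw [degCode, Code.run_tab (off := 0) (fun j => if hj : j < n then edgeDeg L[i] ⟨j, hj⟩ else 0)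
    σ (by simp [Code.arrs]), h.reg0]
  · simp
  · intro j hj s hs13 hsr hsa _
    rw [h.reg0] at hj
    simp only [Code.regs, List.mem_cons, List.cons_append, List.nil_append, List.not_mem_nil,
      or_false, not_or] at hsr
    simp only [Code.arrs, List.mem_cons, List.append_nil, List.not_mem_nil, or_false] at hsa
    refine ⟨by rw [Tm.eval_reg, Code.run_reg (by simp [Code.regs]), hs13, zero_add], ?_⟩
    simp only [hj, dif_pos]
    rw [Code.run]
    have key := Code.run_bdd_induct (x := 15) (r := 0)
      (P := .assign 14 (.add (.reg 14) (.get 3 (.add (.reg 12) (.pair (.reg 13) (.reg 15))))))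
      (σ := Code.run (.assign 14 (.const 0)) s)
      (I := fun x t => t.reg 14 =
        ∑ y ∈ Finset.range x, familyArray L (i * (n * n) + (j * n + y))) ?_ ?_
    · rw [key]
      simp only [Code.run, State.setReg_reg]
      rw [if_neg (by norm_num), hsr 0 (by norm_num), h.reg0, edgeDeg, Finset.card_filter,
        ← Fin.sum_univ_eq_sum_range (fun y => familyArray L (i * (n * n) + (j * n + y))) n]
      apply Finset.sum_congr rfl
      intro u _
      exact familyArray_eq_ite hi ⟨j, hj⟩ u
    · simp [Code.run, State.setReg_reg, Tm.eval]
    · intro x hx t ht15 htr hta hI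
      simp only [Code.regs, List.mem_cons, List.not_mem_nil, or_false, not_or, Code.run,
        State.setReg_reg] at htr
      simp only [Code.arrs, Code.run, State.setReg_arr] at hta
      have e0 : t.reg 0 = n := by
        rw [htr 0 (by norm_num), if_neg (by norm_num), hsr 0 (by norm_num), h.reg0]
      have e4 : n ≤ t.reg 4 := by
        rw [htr 4 (by norm_num), if_neg (by norm_num), hsr 4 (by norm_num)]; exact h.le_reg4
      have e12 : t.reg 12 = i * (n * n) := by
        rw [htr 12 (by norm_num), if_neg (by norm_num), hsr 12 (by norm_num), h12]
      have e13 : t.reg 13 = j := by rw [htr 13 (by norm_num), if_neg (by norm_num), hs13]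
      have e3 : t.arr 3 = familyArray L := by
        rw [hta 3 (by simp), hsa 3 (by norm_num), h.arr3]
      simp only [Code.run, State.setReg_reg, Tm.eval_add, Tm.eval_reg, Tm.eval_get]
      rw [if_pos trivial, hI, Finset.sum_range_succ,
        Tm.eval_pair (by rw [Tm.eval_reg, e13]; omega)]
      simp only [Tm.eval_reg, e12, e13, e0, e3, ht15]
      rw [if_neg (by norm_num)]

/-- A loop that makes an array grow. -/
theorem Code.run_bdd_grow {x r a : ℕ} {P : Code} {R : (ℕ → ℕ) → (ℕ → ℕ) → Prop}
    (hrefl : ∀ b, R b b) (htrans : ∀ b c d, R b c → R c d → R b d)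
    {Q : ℕ → (ℕ → ℕ) → Prop} (hQ : ∀ i b c, Q i b → R b c → Q i c) (σ : State)
    (hstep : ∀ i < σ.reg r, ∀ s : State, s.reg x = i →
      (∀ y, y ∉ x :: P.regs → s.reg y = σ.reg y) → (∀ a, a ∉ P.arrs → s.arr a = σ.arr a) →
      R (σ.arr a) (s.arr a) → R (s.arr a) ((P.run s).arr a) ∧ Q i ((P.run s).arr a)) :
    R (σ.arr a) (((Code.bdd x r P).run σ).arr a) ∧
      ∀ i < σ.reg r, Q i (((Code.bdd x r P).run σ).arr a) := by
  refine Code.run_bdd_induct (I := fun j s => R (σ.arr a) (s.arr a) ∧ ∀ i < j, Q i (s.arr a))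
    ⟨hrefl _, by simp⟩ ?_
  intro i hi s hsx hsr hsa ⟨h1, h2⟩
  obtain ⟨h3, h4⟩ := hstep i hi s hsx hsr hsa h1
  refine ⟨htrans _ _ _ h1 h3, fun j hj => ?_⟩
  by_cases hji : j = i
  · rw [hji]; exact h4
  · exact hQ j _ _ (h2 j (by omega)) h3

/-- One round of the computation of connected components. -/
def linkRound : Code :=
  .bdd 13 0 (.bdd 15 0 (.bdd 17 0 (.ite
    (.and (.get 8 (.pair (.reg 13) (.reg 15)))
      (.get 3 (.add (.reg 12) (.pair (.reg 15) (.reg 17)))))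
    (.store 8 (.pair (.reg 13) (.reg 17)) (.const 1)) .skip)))

/-- Connectivity in the current edge set, to array 8. -/
def linkCode : Code :=
  .seq (.bdd 13 0 (.tab 15 0 8 (.pair (.reg 13) (.reg 15)) (.assign 14 (.eq (.reg 13) (.reg 15))) 14))
    (.bdd 16 0 linkRound)

/-- The matrix is updated in place, so a round may also use pairs found in the same round. Therefore
only two bounds are claimed: entries never leave a relation `R` closed under the edges, and all
pairs one edge further than the old entries are reached. -/
theorem linkRound_spec (h : Base G A C L z k σ) {i : ℕ} (hi : i < L.length)
    (h12 : σ.reg 12 = i * (n * n)) {R : Fin n → Fin n → Prop}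
    (hR : ∀ u v w, R u v → s(v, w) ∈ L[i] → R u w)
    (hsound : ∀ u w : Fin n, σ.arr 8 (u * n + w) ≠ 0 → R u w) :
    (∀ u w : Fin n, (linkRound.run σ).arr 8 (u * n + w) ≠ 0 → R u w) ∧
    (∀ j, σ.arr 8 j ≠ 0 → (linkRound.run σ).arr 8 j ≠ 0) ∧
    (∀ u v w : Fin n, σ.arr 8 (u * n + v) ≠ 0 → s(v, w) ∈ L[i] →
      (linkRound.run σ).arr 8 (u * n + w) ≠ 0) := by
  classical
  let S : (ℕ → ℕ) → Prop := fun b => ∀ u w : Fin n, b (u * n + w) ≠ 0 → R u w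
  -- Soundness is inherited and no entry is erased. This relation is reflexive and transitive, as
  -- the three nested loops require.
  let T : (ℕ → ℕ) → (ℕ → ℕ) → Prop := fun b c => (S b → S c) ∧ ∀ j, b j ≠ 0 → c j ≠ 0
  have hTr : ∀ b, T b b := fun b => ⟨id, fun _ => id⟩
  have hTt : ∀ b c d, T b c → T c d → T b d := fun b c d h1 h2 =>
    ⟨fun h => h2.1 (h1.1 h), fun j h => h2.2 j (h1.2 j h)⟩
  have main : T (σ.arr 8) ((linkRound.run σ).arr 8) ∧ ∀ u < σ.reg 0, ∀ v w, ∀ (hu : u < n)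
      (hv : v < n) (hw : w < n), σ.arr 8 (u * n + v) ≠ 0 → s(⟨v, hv⟩, ⟨w, hw⟩) ∈ L[i] →
      (linkRound.run σ).arr 8 (u * n + w) ≠ 0 := by
    refine Code.run_bdd_grow (x := 13) (r := 0) (a := 8) hTr hTt (Q := fun u b => ∀ v w,
      ∀ (_ : u < n) (hv : v < n) (hw : w < n), σ.arr 8 (u * n + v) ≠ 0 →
      s(⟨v, hv⟩, ⟨w, hw⟩) ∈ L[i] → b (u * n + w) ≠ 0)
      (fun u b c h1 h2 v w hu hv hw h3 h4 => h2.2 _ (h1 v w hu hv hw h3 h4)) σ ?_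
    intro u hu s hs13 hsr hsa hsT
    rw [h.reg0] at hu
    simp only [Code.regs, List.mem_cons, List.append_nil, List.not_mem_nil, or_false,
      not_or] at hsr
    have es0 : s.reg 0 = n := by rw [hsr 0 (by norm_num), h.reg0]
    have main2 := Code.run_bdd_grow (x := 15) (r := 0) (a := 8) (P := .bdd 17 0 (.ite
      (.and (.get 8 (.pair (.reg 13) (.reg 15)))
      (.get 3 (.add (.reg 12) (.pair (.reg 15) (.reg 17)))))
      (.store 8 (.pair (.reg 13) (.reg 17)) (.const 1)) .skip)) hTr hTt (Q := fun v b => ∀ w,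
      ∀ (_ : u < n) (hv : v < n) (hw : w < n), σ.arr 8 (u * n + v) ≠ 0 →
      s(⟨v, hv⟩, ⟨w, hw⟩) ∈ L[i] → b (u * n + w) ≠ 0)
      (fun v b c h1 h2 w hu hv hw h3 h4 => h2.2 _ (h1 w hu hv hw h3 h4)) s ?_
    · refine ⟨main2.1, fun v w hu hv hw => main2.2 v (by rw [es0]; exact hv) w hu hv hw⟩
    intro v hv t ht15 htr hta htT
    rw [es0] at hv
    simp only [Code.regs, List.mem_cons, List.append_nil, List.not_mem_nil, or_false,
      not_or] at htr
    have et0 : t.reg 0 = n := by rw [htr 0 (by norm_num), es0]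
    have main3 := Code.run_bdd_grow (x := 17) (r := 0) (a := 8) (P := .ite
      (.and (.get 8 (.pair (.reg 13) (.reg 15)))
      (.get 3 (.add (.reg 12) (.pair (.reg 15) (.reg 17)))))
      (.store 8 (.pair (.reg 13) (.reg 17)) (.const 1)) .skip) hTr hTt (Q := fun w b =>
      ∀ (_ : u < n) (hv : v < n) (hw : w < n), σ.arr 8 (u * n + v) ≠ 0 →
      s(⟨v, hv⟩, ⟨w, hw⟩) ∈ L[i] → b (u * n + w) ≠ 0)
      (fun w b c h1 h2 hu hv hw h3 h4 => h2.2 _ (h1 hu hv hw h3 h4)) t ?_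
    · refine ⟨main3.1, fun w hu hv hw => main3.2 w (by rw [et0]; exact hw) hu hv hw⟩
    intro w hw q hq17 hqr hqa hqT
    rw [et0] at hw
    simp only [Code.regs, List.mem_cons, List.append_nil, List.not_mem_nil, or_false] at hqr
    simp only [Code.arrs, List.append_nil, List.mem_cons, List.not_mem_nil,
      or_false] at hqa hta hsa
    have e0 : q.reg 0 = n := by rw [hqr 0 (by norm_num), et0]
    have e4 : n ≤ q.reg 4 := by
      rw [hqr 4 (by norm_num), htr 4 (by norm_num), hsr 4 (by norm_num)]; exact h.le_reg4
    have e12 : q.reg 12 = i * (n * n) := by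
      rw [hqr 12 (by norm_num), htr 12 (by norm_num), hsr 12 (by norm_num), h12]
    have e13 : q.reg 13 = u := by rw [hqr 13 (by norm_num), htr 13 (by norm_num), hs13]
    have e15 : q.reg 15 = v := by rw [hqr 15 (by norm_num), ht15]
    have e3 : q.arr 3 = familyArray L := by
      rw [hqa 3 (by norm_num), hta 3 (by norm_num), hsa 3 (by norm_num), h.arr3]
    have hcond : (Tm.and (.get 8 (.pair (.reg 13) (.reg 15)))
        (.get 3 (.add (.reg 12) (.pair (.reg 15) (.reg 17))))).eval q ≠ 0 ↔
        q.arr 8 (u * n + v) ≠ 0 ∧ s(⟨v, hv⟩, ⟨w, hw⟩) ∈ L[i] := by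
      rw [Tm.eval_and_ne_zero, Tm.eval_get, Tm.eval_get, Tm.eval_add,
        Tm.eval_pair (by rw [Tm.eval_reg, e13]; omega),
        Tm.eval_pair (by rw [Tm.eval_reg, e15]; omega)]
      simp only [Tm.eval_reg, e0, e12, e13, e15, e3, hq17]
      rw [familyArray_eq_ite hi ⟨v, hv⟩ ⟨w, hw⟩]
      simp
    have hidx : (Tm.pair (.reg 13) (.reg 17)).eval q = u * n + w := by
      rw [Tm.eval_pair (by rw [Tm.eval_reg, e13]; omega)]
      simp only [Tm.eval_reg, e0, e13, hq17]
    by_cases hc : q.arr 8 (u * n + v) ≠ 0 ∧ s(⟨v, hv⟩, ⟨w, hw⟩) ∈ L[i]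
    · have hrun : (Code.run (.ite (.and (.get 8 (.pair (.reg 13) (.reg 15)))
          (.get 3 (.add (.reg 12) (.pair (.reg 15) (.reg 17)))))
          (.store 8 (.pair (.reg 13) (.reg 17)) (.const 1)) .skip) q).arr 8 =
          Function.update (q.arr 8) (u * n + w) 1 := by
        rw [Code.run, if_pos (hcond.2 hc), Code.run, hidx]
        simp [State.setArr_arr, Tm.eval]
      rw [hrun]
      refine ⟨⟨fun hS a b hab => ?_, fun j hj => ?_⟩, fun _ _ _ _ _ => by simp⟩
      · by_cases he : (a : ℕ) * n + b = u * n + w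
        · obtain ⟨ha, hb⟩ := pair_index_inj b.2 hw he
          have ha' : a = ⟨u, hu⟩ := Fin.ext ha
          have hb' : b = ⟨w, hw⟩ := Fin.ext hb
          subst ha' hb'
          exact hR _ _ _ (hS ⟨u, hu⟩ ⟨v, hv⟩ hc.1) hc.2
        · rw [Function.update_of_ne he] at hab
          exact hS a b hab
      · by_cases he : j = u * n + w
        · rw [he]; simp
        · rwa [Function.update_of_ne he]
    · have hrun : Code.run (.ite (.and (.get 8 (.pair (.reg 13) (.reg 15)))
          (.get 3 (.add (.reg 12) (.pair (.reg 15) (.reg 17)))))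
          (.store 8 (.pair (.reg 13) (.reg 17)) (.const 1)) .skip) q = q := by
        rw [Code.run, if_neg (fun h' => hc (hcond.1 h')), Code.run]
      rw [hrun]
      refine ⟨hTr _, fun _ _ _ h1 h2 => ?_⟩
      exact absurd ⟨hqT.2 _ (htT.2 _ (hsT.2 _ h1)), h2⟩ hc
  refine ⟨main.1.1 hsound, main.1.2, fun u v w h1 h2 => ?_⟩
  exact main.2 u (by rw [h.reg0]; exact u.2) v w u.2 v.2 w.2 h1 h2

/-- Starting from the identity matrix, `t` rounds mark all pairs joined by a walk of length at most
`t`. Paths have fewer than `n` edges, so `n` rounds suffice. -/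
theorem linkCode_spec (h : Base G A C L z k σ) {i : ℕ} (hi : i < L.length)
    (h12 : σ.reg 12 = i * (n * n)) (u w : Fin n) :
    (linkCode.run σ).arr 8 (u * n + w) ≠ 0 ↔
      (SimpleGraph.fromEdgeSet ((L[i] : Finset (Sym2 (Fin n))) : Set (Sym2 (Fin n)))).Reachable
        u w := by
  classical
  set K := SimpleGraph.fromEdgeSet ((L[i] : Finset (Sym2 (Fin n))) : Set (Sym2 (Fin n))) with hK
  rw [linkCode, Code.run]
  set s0 := Code.run (.bdd 13 0 (.tab 15 0 8 (.pair (.reg 13) (.reg 15))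
    (.assign 14 (.eq (.reg 13) (.reg 15))) 14)) σ with hs0
  have hB0 : Base G A C L z k s0 := h.run rfl rfl
  have h120 : s0.reg 12 = i * (n * n) := by
    rw [hs0, Code.run_reg (by simp [Code.regs, Code.tab]), h12]
  have h80 : ∀ a b : Fin n, s0.arr 8 (a * n + b) ≠ 0 ↔ a = b := by
    intro a b
    have hlt : (a : ℕ) * n + b < n * n := by
      have := a.2; have := b.2
      calc (a : ℕ) * n + b < a * n + n := by omega
        _ = (a + 1) * n := by ring
        _ ≤ n * n := Nat.mul_le_mul_right _ (by omega)
    rw [hs0, Code.run_tab_tab (off := 0) (n := n) (fun j => if j / n = j % n then 1 else 0) σ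
      h.reg0 (by norm_num) (by norm_num) (by norm_num) (by norm_num) (by norm_num)]
    · simp only [Nat.zero_le, true_and, zero_add, hlt, if_true, Nat.sub_zero]
      have e1 : ((a : ℕ) * n + b) / n = a := by
        rw [mul_comm, Nat.mul_add_div (by omega), Nat.div_eq_of_lt b.2, add_zero]
      have e2 : ((a : ℕ) * n + b) % n = b := by
        rw [mul_comm, Nat.mul_add_mod, Nat.mod_eq_of_lt b.2]
      simp only [e1, e2, Fin.ext_iff]
      simp
    · intro a ha b hb s h1 h2 h3 _
      have e1 : (a * n + b) / n = a := by
        rw [mul_comm, Nat.mul_add_div (by omega), Nat.div_eq_of_lt hb, add_zero]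
      have e2 : (a * n + b) % n = b := by
        rw [mul_comm, Nat.mul_add_mod, Nat.mod_eq_of_lt hb]
      have e4 : n ≤ s.reg 4 := by
        rw [h3 4 (by norm_num) (by norm_num) (by norm_num)]; exact h.le_reg4
      have e0 : s.reg 0 = n := by
        rw [h3 0 (by norm_num) (by norm_num) (by norm_num), h.reg0]
      refine ⟨?_, ?_⟩
      · rw [Tm.eval_pair]
        · simp [Tm.eval_reg, State.setReg_reg, h1, h2, e0]
        · simp [Tm.eval_reg, State.setReg_reg, h1]; omega
      · rw [e1, e2]
        simp only [Tm.eq, Tm.eval, h1, h2]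
        split_ifs <;> omega
  have key := Code.run_bdd_induct (x := 16) (r := 0) (P := linkRound) (σ := s0)
    (I := fun t s => (∀ a b : Fin n, s.arr 8 (a * n + b) ≠ 0 → K.Reachable a b) ∧
      ∀ (a b : Fin n) (p : K.Walk a b), p.length ≤ t → s.arr 8 (a * n + b) ≠ 0) ?_ ?_
  · rw [hB0.reg0] at key
    refine ⟨key.1 u w, fun hr => ?_⟩
    obtain ⟨p, hp⟩ := hr.exists_isPath
    have := hp.length_lt
    rw [Fintype.card_fin] at this
    exact key.2 u w p this.le
  · refine ⟨fun a b hab => ?_, fun a b p hp => ?_⟩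
    · rw [State.setReg_arr, h80] at hab
      rw [hab]
    · rw [State.setReg_arr, h80]
      exact SimpleGraph.Walk.eq_of_length_eq_zero (Nat.le_zero.1 hp)
  · intro t ht s hs16 hsr hsa ⟨h1, h2⟩
    have hBs : Base G A C L z k s := by
      refine hB0.of_code (c := .bdd 16 0 linkRound) rfl hsr hsa ?_
      intro j _
      rw [hsa 5 (by simp [linkRound, Code.arrs])]
    have hs12 : s.reg 12 = i * (n * n) := by
      rw [hsr 12 (by simp [linkRound, Code.regs]), h120]
    obtain ⟨h3, h4, h5⟩ := linkRound_spec hBs hi hs12 (R := K.Reachable) (fun a b c hab hbc => by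
      by_cases hbc' : b = c
      · rwa [← hbc']
      · exact hab.trans (SimpleGraph.Adj.reachable
          ((SimpleGraph.fromEdgeSet_adj _).2 ⟨hbc, hbc'⟩))) h1
    refine ⟨by simpa using h3, fun a b p hp => ?_⟩
    rw [State.setReg_arr]
    by_cases hnil : p.Nil
    · apply h4
      apply h2 a b p
      rw [SimpleGraph.Walk.length_eq_zero_iff.2 hnil]
      exact Nat.zero_le _
    · have hadj := p.adj_penultimate hnil
      refine h5 a p.penultimate b (h2 _ _ p.dropLast ?_) ((SimpleGraph.fromEdgeSet_adj _).1 hadj).1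
      have := SimpleGraph.Walk.length_dropLast_add_one hnil
      omega

end Base

end RAM

/-! ### Coordinates of state vectors -/

/-- The digits of a number in base six. -/
def digitAt (i j : ℕ) : ℕ := j / 6 ^ i % 6

theorem digitAt_finFunctionFinEquiv {m : ℕ} (g : Fin m → Fin 6) (i : Fin m) :
    digitAt i (finFunctionFinEquiv g : ℕ) = g i := by
  conv_rhs => rw [← finFunctionFinEquiv.symm_apply_apply g]
  -- The inverse of `finFunctionFinEquiv` extracts digits by definition.
  rfl

/-- Both digits are positive, so lowering them needs no borrow and subtracts `6 ^ a + 6 ^ b` from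
the code. -/
theorem finFunctionFinEquiv_lowerAt {m : ℕ} {a b : Fin m} (hab : a ≠ b) {g : Fin m → Fin 6}
    (h : CanLower a b g) : (finFunctionFinEquiv (lowerAt a b g) : ℕ) + (6 ^ (a : ℕ) + 6 ^ (b : ℕ)) =
      (finFunctionFinEquiv g : ℕ) := by
  rw [finFunctionFinEquiv_apply, finFunctionFinEquiv_apply]
  have key : ∀ x : Fin 6, 1 ≤ x.val % 3 → (x - 1).val + 1 = x.val := by decide
  have hsum : ∑ i : Fin m, (if i = a ∨ i = b then 6 ^ (i : ℕ) else 0) =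
      6 ^ (a : ℕ) + 6 ^ (b : ℕ) := by
    rw [← Finset.sum_filter]
    have : (Finset.univ.filter fun i => i = a ∨ i = b) = {a, b} := by ext i; simp
    rw [this, Finset.sum_pair hab]
  rw [← hsum, ← Finset.sum_add_distrib]
  apply Finset.sum_congr rfl
  intro i _
  unfold lowerAt
  split_ifs with hi
  · have := key (g i) (by rcases hi with rfl | rfl; exacts [h.2.1, h.2.2])
    rw [← this]
    ring
  · rfl

/-- The state vector with the coordinates in a sequence. -/
noncomputable def coords (m : ℕ) : (ℕ → ZMod 2) →ₗ[ZMod 2] ((Fin m → Fin 6) → ZMod 2) :=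
  LinearMap.funLeft (ZMod 2) (ZMod 2) fun g => (finFunctionFinEquiv g : ℕ)

theorem coords_apply {m : ℕ} (f : ℕ → ZMod 2) (g : Fin m → Fin 6) :
    coords m f g = f (finFunctionFinEquiv g : ℕ) := rfl

/-- The condition of `CanLower` in terms of digits. -/
def LowerDigits (a b j : ℕ) : Prop :=
  digitAt a j / 3 = digitAt b j / 3 ∧ digitAt a j % 3 ≠ 0 ∧ digitAt b j % 3 ≠ 0

open Classical in
/-- The map `attach` on coordinates. -/
noncomputable def shift (F a b : ℕ) : (ℕ → ZMod 2) →ₗ[ZMod 2] (ℕ → ZMod 2) where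
  toFun f j := if j < F ∧ LowerDigits a b j then f (j - (6 ^ a + 6 ^ b)) else 0
  map_add' v w := by ext j; by_cases h : j < F ∧ LowerDigits a b j <;> simp [h]
  map_smul' r v := by ext j; by_cases h : j < F ∧ LowerDigits a b j <;> simp [h]

/-- Sequences may be longer than `6 ^ m`: one length `F` serves all boundaries, and `coords m`
ignores the excess. -/
theorem coords_shift {F m : ℕ} (hF : 6 ^ m ≤ F) {a b : Fin m} (hab : a ≠ b) (f : ℕ → ZMod 2) :
    coords m (shift F a b f) = attach a b (coords m f) := by
  ext g
  have hlt : (finFunctionFinEquiv g : ℕ) < F := (finFunctionFinEquiv g).2.trans_le hF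
  have hiff : LowerDigits a b (finFunctionFinEquiv g : ℕ) ↔ CanLower a b g := by
    simp only [LowerDigits, CanLower, digitAt_finFunctionFinEquiv]
    omega
  simp only [coords_apply, shift, attach, LinearMap.coe_mk, AddHom.coe_mk, hlt, true_and, hiff]
  by_cases h : CanLower a b g
  · rw [if_pos ⟨hlt, hiff.2 h⟩, if_pos h, ← finFunctionFinEquiv_lowerAt hab h, Nat.add_sub_cancel_right]
  · rw [if_neg fun h' => h (hiff.1 h'.2), if_neg h]

/-- The condition of `Extends` in terms of digits. -/
def ExtendsDigits (k m j q : ℕ) : Prop :=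
  (∀ i < k, digitAt i q = digitAt i j) ∧ ∀ i, k ≤ i → i < m → digitAt i q % 3 = 2

open Classical in
/-- The map `project` on coordinates. -/
noncomputable def foldMap (k m : ℕ) : (ℕ → ZMod 2) →ₗ[ZMod 2] (ℕ → ZMod 2) where
  toFun f j := if j < 6 ^ k then ∑ q ∈ Finset.range (6 ^ m) with ExtendsDigits k m j q, f q else 0
  map_add' v w := by ext j; by_cases h : j < 6 ^ k <;> simp [h, Finset.sum_add_distrib]
  map_smul' r v := by ext j; by_cases h : j < 6 ^ k <;> simp [h, Finset.mul_sum]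

theorem coords_foldMap {k m : ℕ} (hkm : k ≤ m) (f : ℕ → ZMod 2) :
    coords k (foldMap k m f) = project hkm (coords m f) := by
  classical
  ext h
  have hlt : (finFunctionFinEquiv h : ℕ) < 6 ^ k := (finFunctionFinEquiv h).2
  simp only [coords_apply, foldMap, project, LinearMap.coe_mk, AddHom.coe_mk, hlt, if_true]
  rw [Finset.sum_filter, Finset.sum_filter, ← Fin.sum_univ_eq_sum_range (fun q =>
    if ExtendsDigits k m (finFunctionFinEquiv h : ℕ) q then f q else 0),
    ← finFunctionFinEquiv.sum_comp]
  apply Finset.sum_congr rfl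
  intro g _
  have hiff : ExtendsDigits k m (finFunctionFinEquiv h : ℕ) (finFunctionFinEquiv g : ℕ) ↔
      Extends hkm h g := by
    constructor
    · rintro ⟨h1, h2⟩
      refine ⟨fun i => ?_, fun i hi => ?_⟩
      · have := h1 i i.2
        have e1 := digitAt_finFunctionFinEquiv g (Fin.castLE hkm i)
        have e2 := digitAt_finFunctionFinEquiv h i
        rw [Fin.val_castLE] at e1
        rw [Fin.ext_iff, ← e1, ← e2, this]
      · have := h2 i hi i.2
        rwa [digitAt_finFunctionFinEquiv] at this
    · rintro ⟨h1, h2⟩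
      refine ⟨fun i hi => ?_, fun i hi him => ?_⟩
      · have e1 := digitAt_finFunctionFinEquiv g (Fin.castLE hkm ⟨i, hi⟩)
        have e2 := digitAt_finFunctionFinEquiv h ⟨i, hi⟩
        rw [Fin.val_castLE, h1] at e1
        exact e1.trans e2.symm
      · have := h2 ⟨i, him⟩ hi
        rwa [← digitAt_finFunctionFinEquiv g] at this
  simp only [hiff]

/-- The condition of `Fits` in terms of digits. -/
def FitsDigits {n : ℕ} (z : ℕ → Fin n) (m : ℕ) (s : Finset (Sym2 (Fin n))) (j : ℕ) : Prop :=
  ∀ i < m, ∀ i' < m, edgeDeg s (z i) = digitAt i j % 3 ∧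
    ((SimpleGraph.fromEdgeSet (s : Set (Sym2 (Fin n)))).Reachable (z i) (z i') →
      digitAt i j / 3 = digitAt i' j / 3)

/-- An uncrossed cut with prescribed sides exists exactly when boundary vertices in the same
component have the same side. This replaces the quantifier over cuts by a test on the reachability
matrix. -/
theorem fitsDigits_iff {n m : ℕ} {z : ℕ → Fin n} {s : Finset (Sym2 (Fin n))}
    (g : Fin m → Fin 6) : FitsDigits z m s (finFunctionFinEquiv g : ℕ) ↔ Fits z m s g := by
  classical
  have hdig : ∀ i (hi : i < m), digitAt i (finFunctionFinEquiv g : ℕ) = g ⟨i, hi⟩ := fun i hi =>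
    digitAt_finFunctionFinEquiv g ⟨i, hi⟩
  constructor
  · intro h
    -- A vertex takes the side of a chosen boundary vertex of its component, and 0 if there is none.
    -- Adjacent vertices reach the same boundary vertices, so the choice is the same for both.
    refine ⟨fun i => ?_, fun v => if hv : ∃ i : Fin m, (SimpleGraph.fromEdgeSet
      (s : Set (Sym2 (Fin n)))).Reachable (z i) v then (g hv.choose).val / 3 else 0, ?_, ?_⟩
    · have := (h i i.2 i i.2).1
      rwa [hdig i i.2] at this
    · intro u v huv
      have hr : (SimpleGraph.fromEdgeSet (s : Set (Sym2 (Fin n)))).Reachable u v := by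
        by_cases hne : u = v
        · rw [hne]
        · exact SimpleGraph.Adj.reachable ((SimpleGraph.fromEdgeSet_adj _).2 ⟨huv, hne⟩)
      have : (fun i : Fin m => (SimpleGraph.fromEdgeSet (s : Set (Sym2 (Fin n)))).Reachable
          (z i) u) = fun i : Fin m => (SimpleGraph.fromEdgeSet
          (s : Set (Sym2 (Fin n)))).Reachable (z i) v := by
        funext i
        exact propext ⟨fun h => h.trans hr, fun h => h.trans hr.symm⟩
      simp only [this]
    · intro i
      have hv : ∃ i' : Fin m, (SimpleGraph.fromEdgeSet (s : Set (Sym2 (Fin n)))).Reachable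
        (z i') (z i) := ⟨i, SimpleGraph.Reachable.refl _⟩
      simp only [hv, dif_pos]
      have := (h hv.choose hv.choose.2 i i.2).2 hv.choose_spec
      rwa [hdig _ hv.choose.2, hdig i i.2] at this
  · rintro ⟨h1, c, hc, h2⟩ i hi i' hi'
    rw [hdig i hi, hdig i' hi']
    refine ⟨h1 ⟨i, hi⟩, fun hr => ?_⟩
    rw [← h2 ⟨i, hi⟩, ← h2 ⟨i', hi'⟩]
    obtain ⟨p⟩ := hr
    generalize z i = u, z i' = v at p
    induction p with
    | nil => rfl
    | cons hadj _ ih => exact (hc _ _ ((SimpleGraph.fromEdgeSet_adj _).1 hadj).1).trans ih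

open Classical in
theorem coords_fitsDigits {n m F : ℕ} (hF : 6 ^ m ≤ F) {z : ℕ → Fin n}
    {s : Finset (Sym2 (Fin n))} :
    coords m (fun j => if j < F ∧ FitsDigits z m s j then 1 else 0) = stateVec z m s := by
  ext g
  have hlt : (finFunctionFinEquiv g : ℕ) < F := (finFunctionFinEquiv g).2.trans_le hF
  simp only [coords_apply, stateVec, hlt, true_and, fitsDigits_iff]

namespace RAM

/-! ### Auxiliary programs -/

/-- Implication between truth values. -/
def Tm.imp (c t : Tm) : Tm := .ite c t (.const 1)

theorem Tm.eval_imp_ne_zero {σ : State} {c t : Tm} :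
    (Tm.imp c t).eval σ ≠ 0 ↔ (c.eval σ ≠ 0 → t.eval σ ≠ 0) := by
  simp only [Tm.imp, Tm.eval]
  split_ifs with h <;> simp [h]

/-- Universal quantification over the values of a register. -/
def Code.all (x r acc : ℕ) (t : Tm) : Code :=
  .seq (.assign acc (.const 1)) (.bdd x r (.ite t .skip (.assign acc (.const 0))))

/-- Universal quantification over the values of two registers. -/
def Code.allPairs (x y r acc : ℕ) (t : Tm) : Code :=
  .seq (.assign acc (.const 1)) (.bdd x r (.bdd y r (.ite t .skip (.assign acc (.const 0)))))

theorem Code.run_bdd_all {x r acc : ℕ} {t : Tm} (hx : x ≠ acc) (P : ℕ → Prop) (σ : State)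
    (h : ∀ i < σ.reg r, ∀ s : State, s.reg x = i →
      (∀ y, y ≠ x → y ≠ acc → s.reg y = σ.reg y) → s.arr = σ.arr → (t.eval s ≠ 0 ↔ P i)) :
    ((Code.bdd x r (.ite t .skip (.assign acc (.const 0)))).run σ).reg acc ≠ 0 ↔
      σ.reg acc ≠ 0 ∧ ∀ i < σ.reg r, P i := by
  refine Code.run_bdd_induct (I := fun j s => s.reg acc ≠ 0 ↔ σ.reg acc ≠ 0 ∧ ∀ i < j, P i) ?_ ?_
  · simp [State.setReg_reg, Ne.symm hx]
  · intro i hi s hsx hsr hsa hI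
    have ht := h i hi s hsx (fun y h1 h2 => hsr y (by simp [Code.regs, h1, h2]))
      (by funext a; exact hsa a (by simp [Code.arrs]))
    rw [State.setReg_reg, if_neg (Ne.symm hx)]
    have hsucc : (∀ j < i + 1, P j) ↔ (∀ j < i, P j) ∧ P i := by
      constructor
      · intro h'; exact ⟨fun j hj => h' j (by omega), h' i (by omega)⟩
      · rintro ⟨h1, h2⟩ j hj
        by_cases hji : j = i
        · rw [hji]; exact h2
        · exact h1 j (by omega)
    rw [hsucc, ← and_assoc, ← hI, ← ht]
    by_cases hc : t.eval s = 0
    · simp [Code.run, hc, Tm.eval]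
    · simp [Code.run, hc]

theorem Code.run_all {x r acc : ℕ} {t : Tm} (hx : x ≠ acc) (hr : r ≠ acc) (P : ℕ → Prop)
    (σ : State) (h : ∀ i < σ.reg r, ∀ s : State, s.reg x = i →
      (∀ y, y ≠ x → y ≠ acc → s.reg y = σ.reg y) → s.arr = σ.arr → (t.eval s ≠ 0 ↔ P i)) :
    ((Code.all x r acc t).run σ).reg acc ≠ 0 ↔ ∀ i < σ.reg r, P i := by
  rw [Code.all, Code.run, Code.run_bdd_all hx P]
  · simp [Code.run, State.setReg_reg, Tm.eval, hr]
  · intro i hi s h1 h2 h3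
    simp only [Code.run, State.setReg_reg, if_neg hr] at hi
    refine h i hi s h1 (fun y h4 h5 => ?_) h3
    rw [h2 y h4 h5]
    simp [Code.run, State.setReg_reg, h5]

theorem Code.run_allPairs {x y r acc : ℕ} {t : Tm} (hx : x ≠ acc) (hy : y ≠ acc) (hr : r ≠ acc)
    (hxy : x ≠ y) (hrx : r ≠ x) (hry : r ≠ y) (P : ℕ → ℕ → Prop)
    (σ : State) (h : ∀ i < σ.reg r, ∀ j < σ.reg r, ∀ s : State, s.reg x = i → s.reg y = j →
      (∀ w, w ≠ x → w ≠ y → w ≠ acc → s.reg w = σ.reg w) → s.arr = σ.arr →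
      (t.eval s ≠ 0 ↔ P i j)) :
    ((Code.allPairs x y r acc t).run σ).reg acc ≠ 0 ↔
      ∀ i < σ.reg r, ∀ j < σ.reg r, P i j := by
  rw [Code.allPairs, Code.run]
  set σ' := Code.run (.assign acc (.const 1)) σ with hσ'
  have h1' : σ'.reg acc ≠ 0 := by simp [hσ', Code.run, Tm.eval]
  have hr' : σ'.reg r = σ.reg r := by simp [hσ', Code.run, State.setReg_reg, hr]
  have key := Code.run_bdd_induct (x := x) (r := r) (σ := σ')
    (P := .bdd y r (.ite t .skip (.assign acc (.const 0))))
    (I := fun i s => s.reg acc ≠ 0 ↔ ∀ i' < i, ∀ j < σ.reg r, P i' j) ?_ ?_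
  · rw [key, hr']
  · simp [State.setReg_reg, Ne.symm hx, h1']
  · intro i hi s hsx hsr hsa hI
    rw [hr'] at hi
    have hsr' : ∀ w, w ≠ x → w ≠ y → w ≠ acc → s.reg w = σ.reg w := by
      intro w e1 e2 e3
      rw [hsr w (by simp [Code.regs, e1, e2, e3])]
      simp [hσ', Code.run, State.setReg_reg, e3]
    have hsar : s.arr = σ.arr := by
      funext a
      rw [hsa a (by simp [Code.arrs])]
      simp [hσ', Code.run]
    rw [State.setReg_reg, if_neg (Ne.symm hx), Code.run_bdd_all hy (P i) s, hI, hsr' r hrx hry hr]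
    · constructor
      · rintro ⟨h1, h2⟩ i' hi'
        by_cases hii : i' = i
        · rw [hii]; exact h2
        · exact h1 i' (by omega)
      · intro h1
        exact ⟨fun i' hi' => h1 i' (by omega), h1 i (by omega)⟩
    · intro j hj s' h1 h2 h3
      rw [hsr' r hrx hry hr] at hj
      refine h i hi j hj s' (by rw [h2 x hxy hx, hsx]) h1 (fun w e1 e2 e3 => ?_) (by rw [h3, hsar])
      rw [h2 w e2 e3, hsr' w e1 e2 e3]

/-- The vertices that satisfy a condition are appended to the list in array 5, whose length is
in register `r`. -/
def Code.collect (x r : ℕ) (c : Tm) : Code :=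
  .bdd x 0 (.ite c (.seq (.store 5 (.reg r) (.reg x)) (.assign r (.add (.reg r) (.const 1)))) .skip)

theorem Code.run_collect {x r : ℕ} {c : Tm} (hxr : x ≠ r) (P : ℕ → Prop) (σ : State)
    (h : ∀ i < σ.reg 0, ∀ s : State, s.reg x = i → (∀ y, y ≠ x → y ≠ r → s.reg y = σ.reg y) →
      (∀ a, a ≠ 5 → s.arr a = σ.arr a) → (c.eval s ≠ 0 ↔ P i)) :
    ∃ l : List ℕ, l.Nodup ∧ (∀ v, v ∈ l ↔ v < σ.reg 0 ∧ P v) ∧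
      ((Code.collect x r c).run σ).reg r = σ.reg r + l.length ∧
      (∀ i (hi : i < l.length), ((Code.collect x r c).run σ).arr 5 (σ.reg r + i) = l[i]) ∧
      ∀ i < σ.reg r, ((Code.collect x r c).run σ).arr 5 i = σ.arr 5 i := by
  refine Code.run_bdd_induct (I := fun j s => ∃ l : List ℕ, l.Nodup ∧ (∀ v, v ∈ l ↔ v < j ∧ P v) ∧
      s.reg r = σ.reg r + l.length ∧
      (∀ i (hi : i < l.length), s.arr 5 (σ.reg r + i) = l[i]) ∧
      ∀ i < σ.reg r, s.arr 5 i = σ.arr 5 i) ?_ ?_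
  · exact ⟨[], by simp [State.setReg_reg, Ne.symm hxr]⟩
  · rintro j hj s hsx hsr hsa ⟨l, h1, h2, h3, h4, h5⟩
    have hc := h j hj s hsx (fun y e1 e2 => hsr y (by simp [Code.regs, e1, e2]))
      (fun a e => hsa a (by simp [Code.arrs, e]))
    by_cases hP : P j
    · refine ⟨l ++ [j], ?_, ?_, ?_, ?_, ?_⟩
      · rw [List.nodup_append]
        refine ⟨h1, by simp, ?_⟩
        intro a ha b hb
        have := ((h2 a).1 ha).1
        simp at hb
        omega
      · intro v
        rw [List.mem_append, h2, List.mem_singleton]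
        constructor
        · rintro (⟨e1, e2⟩ | rfl)
          · exact ⟨by omega, e2⟩
          · exact ⟨by omega, hP⟩
        · rintro ⟨e1, e2⟩
          by_cases hv : v = j
          · exact Or.inr hv
          · exact Or.inl ⟨by omega, e2⟩
      · rw [State.setReg_reg, if_neg (Ne.symm hxr), Code.run, if_pos (hc.2 hP)]
        simp only [Code.run, Tm.eval, State.setReg_reg_self, State.setArr_reg, h3,
          List.length_append, List.length_singleton]
        omega
      · intro i hi
        rw [State.setReg_arr, Code.run, if_pos (hc.2 hP)]
        simp only [Code.run, Tm.eval, State.setReg_arr, State.setArr_arr, if_true, h3, hsx]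
        rw [List.length_append, List.length_singleton] at hi
        by_cases hil : i = l.length
        · subst hil; simp
        · rw [Function.update_of_ne (by omega), h4 i (by omega), List.getElem_append_left]
      · intro i hi
        rw [State.setReg_arr, Code.run, if_pos (hc.2 hP)]
        simp only [Code.run, Tm.eval, State.setReg_arr, State.setArr_arr, if_true, h3]
        rw [Function.update_of_ne (by omega), h5 i hi]
    · have hc0 : ¬ c.eval s ≠ 0 := fun h' => hP (hc.1 h')
      refine ⟨l, h1, fun v => ?_, ?_, ?_, ?_⟩
      · rw [h2]
        constructor
        · rintro ⟨e1, e2⟩; exact ⟨by omega, e2⟩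
        · rintro ⟨e1, e2⟩
          refine ⟨?_, e2⟩
          by_contra hv
          exact hP ((show v = j by omega) ▸ e2)
      · rw [State.setReg_reg, if_neg (Ne.symm hxr), Code.run, if_neg hc0, Code.run, h3]
      · rw [State.setReg_arr, Code.run, if_neg hc0, Code.run]; exact h4
      · rw [State.setReg_arr, Code.run, if_neg hc0, Code.run]; exact h5

/-! ### Spaces of state vectors -/

/-- For all rows in array 11 with a flag in array `fs`, the vector computed by `V` (for the row with
number in register 21) is inserted into a second family of rows. -/
def spreadCode (fs r fl rw : ℕ) (V : Code) : Code :=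
  .bdd 21 4 (.ite (.get fs (.reg 21)) (.seq V (insertCode r fl rw)) .skip)

/-- The target rows may be the source rows themselves, as in the step `W ↦ W + T W`. Then `fs` must
hold flags fixed beforehand, so that new rows are not processed, and insertion must not alter the
rows still to be read; `hper` covers both cases. -/
theorem spreadCode_spec {fs r fl rw F R : ℕ} {V : Code}
    (T : (ℕ → ZMod 2) →ₗ[ZMod 2] (ℕ → ZMod 2)) {σ τ : State} (hr : r < 21)
    (h1 : fl ≠ 10) (h2 : rw ≠ 10) (h3 : fl ≠ rw) (h4 : fs ≠ 10) (h5 : fs ≠ fl) (h6 : fs ≠ rw)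
    (hfl : fl ≠ 11)
    (hVr : ∀ y ∈ V.regs, y ≠ 4 ∧ y ≠ r ∧ y ≠ 21 ∧ y ≠ 22) (hVa : ∀ a ∈ V.arrs, a = 10)
    (hF : σ.reg 4 = F) (hR : σ.reg r = R) (hRF : R ≤ F)
    (hech : Echelon F R (σ.arr fl) (σ.arr rw))
    (hper : rw ≠ 11 ∨ rw = 11 ∧ R = F ∧ ∀ p < F, σ.arr fs p ≠ 0 → σ.arr fl p ≠ 0)
    (h : ∀ p < F, ∀ s : State, s.reg 21 = p →
      (∀ y, y ∉ (spreadCode fs r fl rw V).regs → s.reg y = σ.reg y) →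
      (∀ a, a ≠ 10 → a ≠ fl → a ≠ rw → s.arr a = σ.arr a) →
      (∀ j < F, s.arr 11 (p * F + j) = σ.arr 11 (p * F + j)) →
      vecAt ((V.run s).arr 10) 0 R = T (vecAt (σ.arr 11) (p * F) F))
    (hτ : τ = (spreadCode fs r fl rw V).run σ) :
    Echelon F R (τ.arr fl) (τ.arr rw) ∧
    Inserted F R (σ.arr fl) (σ.arr rw) (τ.arr fl) (τ.arr rw) (σ.reg 22) (τ.reg 22) ∧
    rowSpan F R (τ.arr fl) (τ.arr rw) =
      rowSpan F R (σ.arr fl) (σ.arr rw) ⊔ (rowSpan F F (σ.arr fs) (σ.arr 11)).map T := by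
  have key := Code.run_bdd_induct (x := 21) (r := 4) (σ := σ)
    (P := .ite (.get fs (.reg 21)) (.seq V (insertCode r fl rw)) .skip)
    (I := fun p s => Echelon F R (s.arr fl) (s.arr rw) ∧
      Inserted F R (σ.arr fl) (σ.arr rw) (s.arr fl) (s.arr rw) (σ.reg 22) (s.reg 22) ∧
      rowSpan F R (s.arr fl) (s.arr rw) = rowSpan F R (σ.arr fl) (σ.arr rw) ⊔
        Submodule.span (ZMod 2) {v | ∃ q < p, σ.arr fs q ≠ 0 ∧
          v = T (vecAt (σ.arr 11) (q * F) F)}) ?_ ?_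
  · change _ ∧ _ at key
    rw [hF] at key
    rw [spreadCode] at hτ
    rw [← hτ] at key
    refine ⟨key.1, key.2.1, ?_⟩
    rw [key.2.2, rowSpan, rowSpan, Submodule.map_span]
    congr 2
    ext v
    constructor
    · rintro ⟨q, e1, e2, rfl⟩; exact ⟨_, ⟨q, e1, e2, rfl⟩, rfl⟩
    · rintro ⟨_, ⟨q, e1, e2, rfl⟩, rfl⟩; exact ⟨q, e1, e2, rfl⟩
  · refine ⟨hech, ?_, ?_⟩
    · rw [State.setReg_reg, if_neg (by norm_num)]
      exact Inserted.refl _ _ _ _ _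
    · simp
  · intro p hp s hs21 hsr hsa ⟨i1, i2, i3⟩
    rw [hF] at hp
    have hsr' : ∀ y, y ∉ (spreadCode fs r fl rw V).regs → s.reg y = σ.reg y := hsr
    have hV : ∀ y, y = 4 ∨ y = 21 ∨ y = 22 ∨ y = r → y ∉ V.regs := by
      rintro y hy hmem
      have := hVr y hmem
      omega
    have hs4 : s.reg 4 = F := by
      rw [hsr 4, hF]
      have := hV 4 (by simp)
      simp [Code.regs, this]
      intro hm; have := insertCode_regs _ _ _ _ hm; omega
    have hsR : s.reg r = R := by
      rw [hsr r, hR]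
      have := hV r (by simp)
      simp [Code.regs, this]
      refine ⟨by omega, ?_⟩
      intro hm; have := insertCode_regs _ _ _ _ hm; omega
    have hsa' : ∀ a, a ≠ 10 → a ≠ fl → a ≠ rw → s.arr a = σ.arr a := by
      intro a e1 e2 e3
      apply hsa
      have hVa' : a ∉ V.arrs := fun hm => e1 (hVa a hm)
      simp only [Code.arrs, List.append_nil, List.mem_append, not_or]
      exact ⟨hVa', fun hm => by have := insertCode_arrs _ _ _ _ hm; omega⟩
    have hfs : s.arr fs = σ.arr fs := hsa' fs h4 h5 h6
    have hset : {v | ∃ q < p + 1, σ.arr fs q ≠ 0 ∧ v = T (vecAt (σ.arr 11) (q * F) F)} =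
        {v | ∃ q < p, σ.arr fs q ≠ 0 ∧ v = T (vecAt (σ.arr 11) (q * F) F)} ∪
        {v | σ.arr fs p ≠ 0 ∧ v = T (vecAt (σ.arr 11) (p * F) F)} := by
      ext v
      constructor
      · rintro ⟨q, e1, e2, e3⟩
        by_cases hq : q = p
        · subst hq; exact Or.inr ⟨e2, e3⟩
        · exact Or.inl ⟨q, by omega, e2, e3⟩
      · rintro (⟨q, e1, e2, e3⟩ | ⟨e2, e3⟩)
        · exact ⟨q, by omega, e2, e3⟩
        · exact ⟨p, by omega, e2, e3⟩
    rw [State.setReg_reg, if_neg (by norm_num), State.setReg_arr, hset]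
    by_cases hf : σ.arr fs p = 0
    · have hrun : Code.run (.ite (.get fs (.reg 21)) (.seq V (insertCode r fl rw)) .skip) s = s := by
        rw [Code.run, if_neg (by simp [Tm.eval, hs21, hfs, hf]), Code.run]
      rw [hrun]
      refine ⟨i1, i2, ?_⟩
      rw [i3]
      simp [hf]
    · have hrun : Code.run (.ite (.get fs (.reg 21)) (.seq V (insertCode r fl rw)) .skip) s =
          (insertCode r fl rw).run (V.run s) := by
        rw [Code.run, if_pos (by simp [Tm.eval, hs21, hfs, hf]), Code.run]
      rw [hrun]
      have harr : ∀ a, a ≠ 10 → (V.run s).arr a = s.arr a := fun a ha =>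
        Code.run_arr (fun hm => ha (hVa a hm)) s
      have hreg : ∀ y, y = 4 ∨ y = 21 ∨ y = 22 ∨ y = r → (V.run s).reg y = s.reg y := fun y hy =>
        Code.run_reg (hV y hy) s
      have h11 : ∀ j < F, s.arr 11 (p * F + j) = σ.arr 11 (p * F + j) := by
        intro j hj
        -- Insertion writes only rows whose flag was zero, so a source row flagged at the start is
        -- still the original one.
        rcases hper with hne | ⟨he, hRF', hall⟩
        · rw [hsa' 11 (by norm_num) (Ne.symm hfl) (Ne.symm hne)]
        · subst he
          subst hRF'
          exact i2.row_eq p hp (hall p hp hf) j hj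
      have hvec := h p hp s hs21 hsr' hsa' h11
      obtain ⟨j1, j2, j3⟩ := insertCode_spec (r := r) (fl := fl) (rw := rw) (F := F) (R := R)
        (by omega) h1 h2 h3 (σ := V.run s) (by rw [hreg 4 (by simp), hs4])
        (by rw [hreg r (by simp), hsR]) hRF (by rw [harr fl h1, harr rw h2]; exact i1) rfl
      rw [harr fl h1, harr rw h2] at j2 j3
      rw [hreg 22 (by simp)] at j2
      refine ⟨j1, i2.trans j2, ?_⟩
      rw [j3, i3, hvec, Submodule.span_union, sup_assoc]
      congr 3
      ext v
      simp [hf]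

/-- Digits in base six, with the powers of six in array 6. -/
def Tm.digit (t u : Tm) : Tm := .mod (.div u (.get 6 t)) (.const 6)

/-- The degree in a digit. -/
def Tm.degree (t u : Tm) : Tm := .mod (.digit t u) (.const 3)

/-- The side in a digit. -/
def Tm.side (t u : Tm) : Tm := .div (.digit t u) (.const 3)

theorem Tm.eval_digit {σ : State} {t u : Tm} (h6 : σ.arr 6 (t.eval σ) = 6 ^ t.eval σ)
    (hu : u.eval σ ≤ σ.reg 4) : (Tm.digit t u).eval σ = digitAt (t.eval σ) (u.eval σ) := by
  have hdiv : (Tm.div u (.get 6 t)).eval σ = u.eval σ / 6 ^ t.eval σ := by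
    rw [Tm.eval_div, Tm.eval_get, h6]
    · rw [Tm.eval_get, h6]; positivity
    · exact hu
  rw [Tm.digit, Tm.eval_mod, hdiv, Tm.eval_const, digitAt]
  · rw [Tm.eval_const]; norm_num
  · rw [hdiv]; exact (Nat.div_le_self _ _).trans hu

theorem Tm.eval_degree {σ : State} {t u : Tm} (h6 : σ.arr 6 (t.eval σ) = 6 ^ t.eval σ)
    (hu : u.eval σ ≤ σ.reg 4) (h4 : 6 ≤ σ.reg 4) :
    (Tm.degree t u).eval σ = digitAt (t.eval σ) (u.eval σ) % 3 := by
  rw [Tm.degree, Tm.eval_mod, Tm.eval_digit h6 hu, Tm.eval_const]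
  · rw [Tm.eval_const]; norm_num
  · rw [Tm.eval_digit h6 hu]
    exact (Nat.mod_lt _ (by norm_num)).le.trans h4

theorem Tm.eval_side {σ : State} {t u : Tm} (h6 : σ.arr 6 (t.eval σ) = 6 ^ t.eval σ)
    (hu : u.eval σ ≤ σ.reg 4) (h4 : 6 ≤ σ.reg 4) :
    (Tm.side t u).eval σ = digitAt (t.eval σ) (u.eval σ) / 3 := by
  rw [Tm.side, Tm.eval_div, Tm.eval_digit h6 hu, Tm.eval_const]
  · rw [Tm.eval_const]; norm_num
  · rw [Tm.eval_digit h6 hu]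
    exact (Nat.mod_lt _ (by norm_num)).le.trans h4

/-! ### The initial state vector of a certificate -/

/-- The memory during the treatment of the certificate `s` with boundary `z 0, …, z (m - 1)`. -/
structure Stage {n : ℕ} (G : SimpleGraph (Fin n)) (A C : Finset (Fin n))
    (L : List (Finset (Sym2 (Fin n)))) (z : ℕ → Fin n) (k m : ℕ) (s : Finset (Sym2 (Fin n)))
    (σ : State) : Prop extends Base G A C L z k σ where
  reg18 : σ.reg 18 = m
  list : ∀ i < m, σ.arr 5 i = z i
  deg : ∀ v : Fin n, σ.arr 7 v = edgeDeg s v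
  conn : ∀ u w : Fin n, σ.arr 8 (u * n + w) ≠ 0 ↔
    (SimpleGraph.fromEdgeSet (s : Set (Sym2 (Fin n)))).Reachable u w

/-- The boundary and the data of the current certificate are not changed either. -/
def Code.keepsStage (c : Code) : Bool :=
  c.keepsBase && !c.regs.contains 18 && !c.arrs.contains 5 && !c.arrs.contains 7 &&
    !c.arrs.contains 8

section Stage

variable {n : ℕ} {G : SimpleGraph (Fin n)} {A C : Finset (Fin n)}
  {L : List (Finset (Sym2 (Fin n)))} {z : ℕ → Fin n} {k m : ℕ} {s : Finset (Sym2 (Fin n))}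
  {σ τ : State}

theorem Stage.of_code (h : Stage G A C L z k m s σ) {c : Code} (hc : c.keepsStage = true)
    (hr : ∀ y, y ∉ c.regs → τ.reg y = σ.reg y) (ha : ∀ a, a ∉ c.arrs → τ.arr a = σ.arr a) :
    Stage G A C L z k m s τ := by
  simp only [Code.keepsStage, Bool.and_eq_true, Bool.not_eq_true', List.contains_eq_mem,
    decide_eq_false_iff_not] at hc
  obtain ⟨⟨⟨⟨hb, h18⟩, h5⟩, h7⟩, h8⟩ := hc
  refine ⟨h.toBase.of_code hb hr ha (fun i _ => by rw [ha 5 h5]), ?_, ?_, ?_, ?_⟩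
  · rw [hr 18 h18, h.reg18]
  · rw [ha 5 h5]; exact h.list
  · rw [ha 7 h7]; exact h.deg
  · rw [ha 8 h8]; exact h.conn

theorem Stage.run (h : Stage G A C L z k m s σ) {c : Code} (hc : c.keepsStage = true) :
    Stage G A C L z k m s (c.run σ) :=
  h.of_code hc (fun _ hy => Code.run_reg hy σ) (fun _ hy => Code.run_arr hy σ)

theorem Base.six_le (h : Base G A C L z k σ) (hk : 0 < k) : 6 ≤ σ.reg 4 := by
  rw [h.reg4]
  have : 216 ^ 1 ≤ 216 ^ k := Nat.pow_le_pow_right (by norm_num) hk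
  omega

theorem Base.pow_le (h : Base G A C L z k σ) {i : ℕ} (hi : i ≤ 3 * k) : 6 ^ i ≤ σ.reg 4 := by
  rw [h.reg4]
  have : 6 ^ i ≤ 6 ^ (3 * k) := Nat.pow_le_pow_right (by norm_num) hi
  rw [pow_mul] at this
  norm_num at this
  omega

/-- The term that compares a state with the current certificate. -/
def fitsTerm : Tm :=
  .imp (.lt (.reg 15) (.reg 18)) (.imp (.lt (.reg 16) (.reg 18)) (.and
    (.eq (.get 7 (.get 5 (.reg 15))) (.degree (.reg 15) (.reg 13)))
    (.imp (.get 8 (.pair (.get 5 (.reg 15)) (.get 5 (.reg 16))))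
      (.eq (.side (.reg 15) (.reg 13)) (.side (.reg 16) (.reg 13))))))

/-- The state vector of the current certificate is the first row. -/
def startCode : Code :=
  .seq (.tab 13 4 9 (.reg 13) (.assign 14 (.const 0)) 14)
    (.seq (.tab 13 4 10 (.reg 13) (.allPairs 15 16 6 14 fitsTerm) 14) (insertCode 4 9 11))

theorem eval_fitsTerm (h : Stage G A C L z k m s σ) (hk : 0 < k) {a b : ℕ} (ha : a < 3 * k)
    (hb : b < 3 * k) (h13 : σ.reg 13 < σ.reg 4) (h15 : σ.reg 15 = a) (h16 : σ.reg 16 = b) :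
    fitsTerm.eval σ ≠ 0 ↔ (a < m → b < m → edgeDeg s (z a) = digitAt a (σ.reg 13) % 3 ∧
      ((SimpleGraph.fromEdgeSet (s : Set (Sym2 (Fin n)))).Reachable (z a) (z b) →
        digitAt a (σ.reg 13) / 3 = digitAt b (σ.reg 13) / 3)) := by
  rw [fitsTerm, Tm.eval_imp_ne_zero, Tm.eval_imp_ne_zero, Tm.eval_lt_ne_zero, Tm.eval_lt_ne_zero,
    Tm.eval_and_ne_zero, Tm.eval_imp_ne_zero, Tm.eval_eq_ne_zero, Tm.eval_eq_ne_zero]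
  have e15 : (Tm.reg 15).eval σ = a := h15
  have e16 : (Tm.reg 16).eval σ = b := h16
  have e18 : (Tm.reg 18).eval σ = m := h.reg18
  have e13 : (Tm.reg 13).eval σ = σ.reg 13 := rfl
  have h6a : σ.arr 6 ((Tm.reg 15).eval σ) = 6 ^ (Tm.reg 15).eval σ := by
    rw [e15]; exact h.arr6 a (by omega)
  have h6b : σ.arr 6 ((Tm.reg 16).eval σ) = 6 ^ (Tm.reg 16).eval σ := by
    rw [e16]; exact h.arr6 b (by omega)
  rw [Tm.eval_degree h6a (by rw [e13]; exact h13.le) (h.six_le hk),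
    Tm.eval_side h6a (by rw [e13]; exact h13.le) (h.six_le hk),
    Tm.eval_side h6b (by rw [e13]; exact h13.le) (h.six_le hk), e15, e16, e18, e13]
  refine imp_congr_right fun ham => imp_congr_right fun hbm => ?_
  have e5a : (Tm.get 5 (.reg 15)).eval σ = z a := by rw [Tm.eval_get, e15, h.list a ham]
  have e5b : (Tm.get 5 (.reg 16)).eval σ = z b := by rw [Tm.eval_get, e16, h.list b hbm]
  rw [Tm.eval_get σ 7, Tm.eval_get σ 8, e5a,
    Tm.eval_pair (by rw [e5a]; have := (z a).2; have := h.le_reg4; omega), e5a, e5b, h.reg0, h.deg, h.conn]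

/-- Clearing the flags discards the rows left by the previous certificate. The quantifiers run up to
`3 * k` instead of `m`, with tests against `m`: loop limits must be registers that the program never
writes, and `m` changes with the certificate. -/
theorem startCode_spec (h : Stage G A C L z k m s σ) (hk : 0 < k) (hm : m ≤ 3 * k) {F : ℕ}
    (hF : σ.reg 4 = F) (hτ : τ = startCode.run σ) :
    Echelon F F (τ.arr 9) (τ.arr 11) ∧
      (rowSpan F F (τ.arr 9) (τ.arr 11)).map (coords m) = extSpan z m s ∅ := by
  classical
  rw [startCode, Code.run, Code.run] at hτ
  set s1 := Code.run (.tab 13 4 9 (.reg 13) (.assign 14 (.const 0)) 14) σ with hs1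
  set s2 := Code.run (.tab 13 4 10 (.reg 13) (.allPairs 15 16 6 14 fitsTerm) 14) s1 with hs2
  have hS1 : Stage G A C L z k m s s1 := h.run rfl
  have h41 : s1.reg 4 = F := by rw [hs1, Code.run_reg (by decide), hF]
  have h42 : s2.reg 4 = F := by rw [hs2, Code.run_reg (by decide), h41]
  have h9 : s1.arr 9 = fun i => if i < F then 0 else σ.arr 9 i := by
    rw [hs1, Code.run_tab (off := 0) (fun _ => 0) σ (by simp [Code.arrs]), hF]
    · simp
    · intro j hj s' h1' _ _ _
      simp [Code.run, Tm.eval, State.setReg_reg, h1']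
  have h92 : s2.arr 9 = s1.arr 9 := Code.run_arr (by decide) s1
  have hfl : ∀ p < F, s2.arr 9 p = 0 := by
    intro p hp; rw [h92, h9]; simp [hp]
  have hbot : rowSpan F F (s2.arr 9) (s2.arr 11) = ⊥ := by
    rw [rowSpan, Submodule.span_eq_bot]
    rintro _ ⟨p, hp, hf, -⟩
    exact absurd (hfl p hp) hf
  have hvec : vecAt (s2.arr 10) 0 F = fun j => if j < F ∧ FitsDigits z m s j then 1 else 0 := by
    have key := Code.run_bdd_induct (x := 13) (r := 4) (σ := s1)
      (P := .seq (.allPairs 15 16 6 14 fitsTerm) (.store 10 (.reg 13) (.reg 14)))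
      (I := fun j t => ∀ i < j, (t.arr 10 i ≠ 0 ↔ FitsDigits z m s i)) (by simp) ?_
    · rw [h41] at key
      change ∀ i < F, (s2.arr 10 i ≠ 0 ↔ _) at key
      funext j
      unfold vecAt
      by_cases hj : j < F
      · have := key j hj
        rw [zero_add, if_pos hj]
        by_cases hfit : FitsDigits z m s j
        · rw [if_pos ⟨hj, hfit⟩, bit, if_neg (this.2 hfit)]
        · rw [if_neg fun h' => hfit h'.2, bit, if_pos]
          by_contra h0
          exact hfit (this.1 h0)
      · rw [if_neg hj, if_neg fun h' => hj h'.1]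
    · intro j hj t ht13 htr hta hI i hi
      rw [h41] at hj
      have hSt : Stage G A C L z k m s t := hS1.of_code
        (c := .bdd 13 4 (.seq (.allPairs 15 16 6 14 fitsTerm) (.store 10 (.reg 13) (.reg 14))))
        rfl htr hta
      have ht4 : t.reg 4 = F := by rw [htr 4 (by decide), h41]
      have hall := Code.run_allPairs (x := 15) (y := 16) (r := 6) (acc := 14) (t := fitsTerm)
        (by norm_num) (by norm_num) (by norm_num) (by norm_num) (by norm_num) (by norm_num)
        (fun a b => a < m → b < m → edgeDeg s (z a) = digitAt a j % 3 ∧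
          ((SimpleGraph.fromEdgeSet (s : Set (Sym2 (Fin n)))).Reachable (z a) (z b) →
            digitAt a j / 3 = digitAt b j / 3)) t ?_
      · have hiff : (∀ a < t.reg 6, ∀ b < t.reg 6, a < m → b < m →
            edgeDeg s (z a) = digitAt a j % 3 ∧
            ((SimpleGraph.fromEdgeSet (s : Set (Sym2 (Fin n)))).Reachable (z a) (z b) →
            digitAt a j / 3 = digitAt b j / 3)) ↔ FitsDigits z m s j := by
          rw [hSt.reg6]
          constructor
          · intro h' a ha b hb; exact h' a (by omega) b (by omega) ha hb
          · intro h' a _ b _ ha hb; exact h' a ha b hb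
        rw [hiff] at hall
        rw [State.setReg_arr, Code.run, Code.run, State.setArr_arr, if_pos rfl, Tm.eval_reg,
          Tm.eval_reg, Code.run_reg (y := 13) (by decide), ht13,
          Code.run_arr (a := 10) (by decide)]
        by_cases hij : i = j
        · subst hij; rw [Function.update_self]; exact hall
        · rw [Function.update_of_ne hij]; exact hI i (by omega)
      · intro a ha b hb q hq15 hq16 hqr hqa
        rw [hSt.reg6] at ha hb
        have hSq : Stage G A C L z k m s q := hSt.of_code
          (c := .allPairs 15 16 6 14 fitsTerm) rfl
          (fun y hy => hqr y (fun e => hy (by subst e; decide)) (fun e => hy (by subst e; decide))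
            (fun e => hy (by subst e; decide))) (fun a _ => by rw [hqa])
        have h13 : q.reg 13 = j := by
          rw [hqr 13 (by norm_num) (by norm_num) (by norm_num), ht13]
        have h4 : q.reg 4 = F := by
          rw [hqr 4 (by norm_num) (by norm_num) (by norm_num), ht4]
        rw [eval_fitsTerm hSq hk ha hb (by rw [h13, h4]; exact hj) hq15 hq16, h13]
  obtain ⟨j1, -, j3⟩ := insertCode_spec (r := 4) (fl := 9) (rw := 11) (F := F) (R := F)
    (by norm_num) (by norm_num) (by norm_num) (by norm_num) h42 h42 le_rfl
    (fun p hp hf => absurd (hfl p hp) hf) hτ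
  refine ⟨j1, ?_⟩
  rw [j3, hbot, bot_sup_eq, Submodule.map_span, Set.image_singleton, hvec,
    coords_fitsDigits (by rw [← hF]; exact h.pow_le hm), extSpan_empty]

end Stage

/-! ### Attaching the boundary edges and projecting to the cover -/

section Stage

variable {n : ℕ} {G : SimpleGraph (Fin n)} {A C : Finset (Fin n)}
  {L : List (Finset (Sym2 (Fin n)))} {z : ℕ → Fin n} {k m : ℕ} {s : Finset (Sym2 (Fin n))}
  {σ τ : State}

/-- An entry of the vector obtained by the insertion of an edge between the boundary positions in
registers 19 and 20. -/
def shiftTerm : Tm :=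
  .ite (.and (.eq (.side (.reg 19) (.reg 13)) (.side (.reg 20) (.reg 13)))
      (.and (.degree (.reg 19) (.reg 13)) (.degree (.reg 20) (.reg 13))))
    (.get 11 (.add (.mul (.reg 21) (.reg 4))
      (.sub (.reg 13) (.add (.get 6 (.reg 19)) (.get 6 (.reg 20)))))) (.const 0)

/-- All rows are extended by the edge between the positions in registers 19 and 20. -/
def shiftCode : Code :=
  .seq (.tab 21 4 12 (.reg 21) (.assign 14 (.get 9 (.reg 21))) 14)
    (spreadCode 12 4 9 11 (.tab 13 4 10 (.reg 13) (.assign 14 shiftTerm) 14))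

open Classical in
theorem eval_shiftTerm (h : Stage G A C L z k m s σ) (hk : 0 < k) {a b p : ℕ} (ha : a < 3 * k)
    (hb : b < 3 * k) (h13 : σ.reg 13 < σ.reg 4) (h19 : σ.reg 19 = a) (h20 : σ.reg 20 = b)
    (h21 : σ.reg 21 = p) (hp : p < σ.reg 4) :
    shiftTerm.eval σ = if LowerDigits a b (σ.reg 13) then
      σ.arr 11 (p * σ.reg 4 + (σ.reg 13 - (6 ^ a + 6 ^ b))) else 0 := by
  have e19 : (Tm.reg 19).eval σ = a := h19
  have e20 : (Tm.reg 20).eval σ = b := h20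
  have e13 : (Tm.reg 13).eval σ = σ.reg 13 := rfl
  have h6a : σ.arr 6 ((Tm.reg 19).eval σ) = 6 ^ (Tm.reg 19).eval σ := by
    rw [e19]; exact h.arr6 a (by omega)
  have h6b : σ.arr 6 ((Tm.reg 20).eval σ) = 6 ^ (Tm.reg 20).eval σ := by
    rw [e20]; exact h.arr6 b (by omega)
  have hu : (Tm.reg 13).eval σ ≤ σ.reg 4 := h13.le
  have h4 := h.six_le hk
  have hcond : (Tm.and (.eq (.side (.reg 19) (.reg 13)) (.side (.reg 20) (.reg 13)))
      (.and (.degree (.reg 19) (.reg 13)) (.degree (.reg 20) (.reg 13)))).eval σ ≠ 0 ↔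
      LowerDigits a b (σ.reg 13) := by
    rw [Tm.eval_and_ne_zero, Tm.eval_and_ne_zero, Tm.eval_eq_ne_zero, Tm.eval_side h6a hu h4,
      Tm.eval_side h6b hu h4, Tm.eval_degree h6a hu h4, Tm.eval_degree h6b hu h4, e19, e20, e13,
      LowerDigits]
  rw [shiftTerm, Tm.eval_ite]
  have hcong : ∀ x y : ℕ, (if (Tm.and (.eq (.side (.reg 19) (.reg 13)) (.side (.reg 20) (.reg 13)))
      (.and (.degree (.reg 19) (.reg 13)) (.degree (.reg 20) (.reg 13)))).eval σ ≠ 0 then x else y)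
      = if LowerDigits a b (σ.reg 13) then x else y := by
    intro x y
    by_cases hl : LowerDigits a b (σ.reg 13)
    · rw [if_pos hl, if_pos (hcond.2 hl)]
    · rw [if_neg hl, if_neg fun h' => hl (hcond.1 h')]
  rw [hcong, Tm.eval_get, Tm.eval_add, Tm.eval_mul (by rw [Tm.eval_reg, h21]; exact hp.le),
    Tm.eval_sub, Tm.eval_add, Tm.eval_get, Tm.eval_get, h6a, h6b, e19, e20, e13, Tm.eval_reg,
    Tm.eval_reg, h21, Tm.eval_const]

/-- Array 12 keeps the flags from before the pass, so exactly the rows present at its start are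
shifted. -/
theorem shiftCode_spec (h : Stage G A C L z k m s σ) (hk : 0 < k) {a b F : ℕ} (ha : a < 3 * k)
    (hb : b < 3 * k) (h19 : σ.reg 19 = a) (h20 : σ.reg 20 = b) (hF : σ.reg 4 = F)
    (hech : Echelon F F (σ.arr 9) (σ.arr 11)) (hτ : τ = shiftCode.run σ) :
    Echelon F F (τ.arr 9) (τ.arr 11) ∧ rowSpan F F (τ.arr 9) (τ.arr 11) =
      rowSpan F F (σ.arr 9) (σ.arr 11) ⊔ (rowSpan F F (σ.arr 9) (σ.arr 11)).map (shift F a b) := by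
  classical
  rw [shiftCode, Code.run] at hτ
  set s1 := Code.run (.tab 21 4 12 (.reg 21) (.assign 14 (.get 9 (.reg 21))) 14) σ with hs1
  have hS1 : Stage G A C L z k m s s1 := h.run rfl
  have h41 : s1.reg 4 = F := by rw [hs1, Code.run_reg (by decide), hF]
  have h19' : s1.reg 19 = a := by rw [hs1, Code.run_reg (by decide), h19]
  have h20' : s1.reg 20 = b := by rw [hs1, Code.run_reg (by decide), h20]
  have h9 : s1.arr 9 = σ.arr 9 := Code.run_arr (by decide) σ
  have h11 : s1.arr 11 = σ.arr 11 := Code.run_arr (by decide) σ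
  have h12 : s1.arr 12 = fun i => if i < F then σ.arr 9 i else σ.arr 12 i := by
    rw [hs1, Code.run_tab (off := 0) (fun j => σ.arr 9 j) σ (by simp [Code.arrs]), hF]
    · simp
    · intro j hj s' h1' _ h3' _
      simp [Code.run, Tm.eval, State.setReg_reg, h1', h3' 9 (by decide)]
  have key := spreadCode_spec (fs := 12) (r := 4) (fl := 9) (rw := 11) (F := F) (R := F)
    (V := .tab 13 4 10 (.reg 13) (.assign 14 shiftTerm) 14) (shift F a b) (σ := s1) (by norm_num)
    (by norm_num) (by norm_num) (by norm_num) (by norm_num) (by norm_num) (by norm_num)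
    (by norm_num) (by decide) (by decide) h41 h41 le_rfl (by rw [h9, h11]; exact hech)
    (Or.inr ⟨rfl, rfl, fun p hp hf => by
      rw [h12] at hf
      simp only [hp, if_true] at hf
      rwa [h9]⟩) ?_ hτ
  · obtain ⟨j1, -, j3⟩ := key
    have hsnap : rowSpan F F (s1.arr 12) (s1.arr 11) = rowSpan F F (σ.arr 9) (σ.arr 11) := by
      rw [rowSpan, rowSpan, h11]
      congr 1
      ext v
      refine exists_congr fun p => and_congr_right fun hp => ?_
      rw [h12]
      simp only [hp, if_true]
    rw [hsnap, h9, h11] at j3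
    exact ⟨j1, j3⟩
  · intro p hp q hq21 hqr hqa hq11
    have hSq : Stage G A C L z k m s q := hS1.of_code
      (c := spreadCode 12 4 9 11 (.tab 13 4 10 (.reg 13) (.assign 14 shiftTerm) 14)) rfl hqr
      (fun c hc => hqa c (fun e => hc (by subst e; decide)) (fun e => hc (by subst e; decide))
        (fun e => hc (by subst e; decide)))
    have hq4 : q.reg 4 = F := by rw [hqr 4 (by decide), h41]
    rw [Code.run_tab (off := 0) (fun j => if LowerDigits a b j then
      q.arr 11 (p * F + (j - (6 ^ a + 6 ^ b))) else 0) q (by simp [Code.arrs]), hq4]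
    · funext j
      simp only [vecAt, shift, LinearMap.coe_mk, AddHom.coe_mk, zero_add, Nat.zero_le, true_and,
        Nat.sub_zero]
      by_cases hj : j < F
      · have hj' : j - (6 ^ a + 6 ^ b) < F := (Nat.sub_le _ _).trans_lt hj
        simp only [hj, hj', if_true, true_and]
        by_cases hl : LowerDigits a b j
        · rw [if_pos hl, if_pos hl, hq11 _ hj']
        · rw [if_neg hl, if_neg hl, bit_zero]
      · simp [hj]
    · intro j hj t ht13 htr hta _
      rw [hq4] at hj
      have hSt : Stage G A C L z k m s t := hSq.of_code
        (c := .tab 13 4 10 (.reg 13) (.assign 14 shiftTerm) 14) rfl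
        (fun y hy => htr y (by simpa [Code.regs, Code.tab] using hy))
        (fun c hc => hta c (by simpa [Code.arrs, Code.tab] using hc))
      have ht4 : t.reg 4 = F := by rw [htr 4 (by decide), hq4]
      refine ⟨by simp [Code.run, Tm.eval, State.setReg_reg, ht13], ?_⟩
      rw [Code.run, State.setReg_reg_self, eval_shiftTerm hSt hk ha hb (by omega)
        (by rw [htr 19 (by decide), hqr 19 (by decide), h19'])
        (by rw [htr 20 (by decide), hqr 20 (by decide), h20'])
        (by rw [htr 21 (by decide), hq21]) (by omega), ht13, ht4, hta 11 (by decide)]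

/-- Positions `i` and `j` are joined by an edge that may complete the certificate. -/
def BoundaryEdge {n : ℕ} (G : SimpleGraph (Fin n)) (A : Finset (Fin n)) (z : ℕ → Fin n)
    (k m i j : ℕ) : Prop := k ≤ i ∧ i < m ∧ j < k ∧ G.Adj (z i) (z j) ∧ z j ∉ A

open Classical in
/-- The edges between positions up to the pair `(a, b)`, in lexicographic order. -/
noncomputable def edgesBelow {n : ℕ} (G : SimpleGraph (Fin n)) (A : Finset (Fin n))
    (z : ℕ → Fin n) (k m a b : ℕ) : Finset (Sym2 (Fin n)) :=
  Finset.univ.filter fun e => ∃ i j, BoundaryEdge G A z k m i j ∧ (i < a ∨ i = a ∧ j < b) ∧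
    e = s(z i, z j)

/-- All edges of the boundary are attached. -/
def attachCode : Code :=
  .bdd 19 6 (.bdd 20 6 (.ite
    (.and (.not (.lt (.reg 19) (.reg 3))) (.and (.lt (.reg 19) (.reg 18))
      (.and (.lt (.reg 20) (.reg 3)) (.and (.get 0 (.pair (.get 5 (.reg 19)) (.get 5 (.reg 20))))
        (.not (.get 1 (.get 5 (.reg 20))))))))
    shiftCode .skip))

/-- After the pairs of positions below `(a, b)` the rows span the extensions by the edges at those
pairs, and `extSpan_insert` provides the step. The loops run to `3 * k`, but only pairs of positions
below `m` are edges. -/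
theorem attachCode_spec (h : Stage G A C L z k m s σ) (hk : 0 < k) (hkm : k ≤ m) (hm : m ≤ 3 * k)
    (hz : ∀ i < m, ∀ j < m, z i = z j → i = j) (hs : ∀ u v, s(u, v) ∈ s → v ∈ A) {F : ℕ}
    (hF : σ.reg 4 = F) (hech : Echelon F F (σ.arr 9) (σ.arr 11))
    (hsp : (rowSpan F F (σ.arr 9) (σ.arr 11)).map (coords m) = extSpan z m s ∅)
    (hτ : τ = attachCode.run σ) :
    Echelon F F (τ.arr 9) (τ.arr 11) ∧
      (rowSpan F F (τ.arr 9) (τ.arr 11)).map (coords m) =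
        extSpan z m s (edgesBelow G A z k m m 0) := by
  classical
  let I : ℕ → ℕ → State → Prop := fun a b t => Echelon F F (t.arr 9) (t.arr 11) ∧
    (rowSpan F F (t.arr 9) (t.arr 11)).map (coords m) = extSpan z m s (edgesBelow G A z k m a b)
  have hFm : 6 ^ m ≤ F := by rw [← hF]; exact h.pow_le hm
  have key := Code.run_bdd_induct (x := 19) (r := 6) (σ := σ)
    (P := .bdd 20 6 (.ite
      (.and (.not (.lt (.reg 19) (.reg 3))) (.and (.lt (.reg 19) (.reg 18))
      (.and (.lt (.reg 20) (.reg 3)) (.and (.get 0 (.pair (.get 5 (.reg 19)) (.get 5 (.reg 20))))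
        (.not (.get 1 (.get 5 (.reg 20))))))))
      shiftCode .skip)) (I := fun a t => I a 0 t) ?_ ?_
  · rw [h.reg6] at key
    rw [attachCode] at hτ
    rw [← hτ] at key
    have he : edgesBelow G A z k m m 0 = edgesBelow G A z k m (3 * k) 0 := by
      unfold edgesBelow
      ext e
      simp only [Finset.mem_filter, Finset.mem_univ, true_and]
      refine exists_congr fun i => exists_congr fun j => and_congr_right fun hl => ?_
      have := hl.2.1
      refine and_congr_left fun _ => ?_
      omega
    rw [he]
    exact key
  · have he : edgesBelow G A z k m 0 0 = ∅ := by
      unfold edgesBelow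
      ext e
      simp
    simp only [I, he]
    exact ⟨hech, hsp⟩
  · intro a ha t ht19 htr hta hI
    rw [h.reg6] at ha
    have hSt : Stage G A C L z k m s t := h.of_code (c := attachCode) rfl htr hta
    have ht4 : t.reg 4 = F := by rw [htr 4 (by decide), hF]
    have key2 := Code.run_bdd_induct (x := 20) (r := 6) (σ := t)
      (P := .ite
        (.and (.not (.lt (.reg 19) (.reg 3))) (.and (.lt (.reg 19) (.reg 18))
        (.and (.lt (.reg 20) (.reg 3)) (.and (.get 0 (.pair (.get 5 (.reg 19)) (.get 5 (.reg 20))))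
          (.not (.get 1 (.get 5 (.reg 20))))))))
        shiftCode .skip) (I := fun b t => I a b t) hI ?_
    · rw [hSt.reg6] at key2
      have he : edgesBelow G A z k m (a + 1) 0 = edgesBelow G A z k m a (3 * k) := by
        unfold edgesBelow
        ext e
        simp only [Finset.mem_filter, Finset.mem_univ, true_and]
        refine exists_congr fun i => exists_congr fun j => and_congr_right fun hl => ?_
        have := hl.2.2.1
        refine and_congr_left fun _ => ?_
        omega
      simp only [I, he]
      exact key2
    · intro b hb q hq20 hqr hqa hIq
      rw [hSt.reg6] at hb
      have hSq : Stage G A C L z k m s q := hSt.of_code (c := attachCode) rfl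
        (fun y hy => hqr y (fun hm => hy (List.mem_cons_of_mem _ hm))) hqa
      have hq4 : q.reg 4 = F := by rw [hqr 4 (by decide), ht4]
      have hq19 : q.reg 19 = a := by rw [hqr 19 (by decide), ht19]
      have e19 : (Tm.reg 19).eval q = a := hq19
      have e20 : (Tm.reg 20).eval q = b := hq20
      have e18 : (Tm.reg 18).eval q = m := hSq.reg18
      have e3 : (Tm.reg 3).eval q = k := hSq.reg3
      have hcond : (Tm.and (.not (.lt (.reg 19) (.reg 3))) (.and (.lt (.reg 19) (.reg 18))
          (.and (.lt (.reg 20) (.reg 3))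
          (.and (.get 0 (.pair (.get 5 (.reg 19)) (.get 5 (.reg 20))))
          (.not (.get 1 (.get 5 (.reg 20)))))))).eval q ≠ 0 ↔ BoundaryEdge G A z k m a b := by
        rw [Tm.eval_and_ne_zero, Tm.eval_not_ne_zero, Tm.eval_lt_ne_zero, Tm.eval_and_ne_zero,
          Tm.eval_lt_ne_zero, Tm.eval_and_ne_zero, Tm.eval_lt_ne_zero, Tm.eval_and_ne_zero,
          Tm.eval_not_ne_zero, e19, e20, e18, e3, BoundaryEdge, not_lt]
        refine and_congr_right fun _ => and_congr_right fun h2 => and_congr_right fun h3 => ?_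
        have e5a : (Tm.get 5 (.reg 19)).eval q = z a := by rw [Tm.eval_get, e19, hSq.list a h2]
        have e5b : (Tm.get 5 (.reg 20)).eval q = z b := by
          rw [Tm.eval_get, e20, hSq.list b (by omega)]
        rw [Tm.eval_get q 0, Tm.eval_get q 1, e5b,
          Tm.eval_pair (by rw [e5a]; have := (z a).2; have := hSq.le_reg4; omega), e5a, e5b,
          hSq.reg0, hSq.arr0, hSq.arr1, graphArray_ne_zero_iff, vertexSetArray_ne_zero_iff]
      by_cases hl : BoundaryEdge G A z k m a b
      · rw [Code.run, if_pos (hcond.2 hl)]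
        obtain ⟨j1, j2⟩ := shiftCode_spec hSq hk ha hb hq19 hq20 hq4 hIq.1 rfl
        obtain ⟨l1, l2, l3, l4, l5⟩ := hl
        have hab : (⟨a, l2⟩ : Fin m) ≠ ⟨b, by omega⟩ := by
          intro h'
          rw [Fin.mk.injEq] at h'
          omega
        have he : edgesBelow G A z k m a (b + 1) =
            insert s(z a, z b) (edgesBelow G A z k m a b) := by
          unfold edgesBelow
          ext e
          simp only [Finset.mem_filter, Finset.mem_univ, true_and, Finset.mem_insert]
          constructor
          · rintro ⟨i, j, h1, h2, h3⟩
            by_cases hij : i = a ∧ j = b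
            · rw [hij.1, hij.2] at h3; exact Or.inl h3
            · exact Or.inr ⟨i, j, h1, by omega, h3⟩
          · rintro (rfl | ⟨i, j, h1, h2, h3⟩)
            · exact ⟨a, b, ⟨l1, l2, l3, l4, l5⟩, by omega, rfl⟩
            · exact ⟨i, j, h1, by omega, h3⟩
        -- Positions are injective and an edge joins a position from `k` on to one below `k`, so
        -- each edge is met only once.
        have hnot : s(z a, z b) ∉ edgesBelow G A z k m a b := by
          unfold edgesBelow
          simp only [Finset.mem_filter, Finset.mem_univ, true_and]
          rintro ⟨i, j, ⟨h1, h2, h3, -, -⟩, h4, h5⟩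
          rcases Sym2.eq_iff.1 h5 with ⟨h6, h7⟩ | ⟨h6, h7⟩
          · have := hz a l2 i h2 h6
            have := hz b (by omega) j (by omega) h7
            omega
          · have := hz a l2 j (by omega) h6
            omega
        refine ⟨j1, ?_⟩
        change Submodule.map _ (rowSpan F F ((shiftCode.run q).arr 9)
          ((shiftCode.run q).arr 11)) = _
        rw [j2, he, Submodule.map_sup, hIq.2]
        have hcomm : ((rowSpan F F (q.arr 9) (q.arr 11)).map (shift F a b)).map (coords m) =
            ((rowSpan F F (q.arr 9) (q.arr 11)).map (coords m)).map
              (attach (⟨a, l2⟩ : Fin m) ⟨b, by omega⟩) := by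
          rw [← Submodule.map_comp, ← Submodule.map_comp]
          congr 1
          apply LinearMap.ext
          intro f
          exact coords_shift hFm hab f
        rw [hcomm, hIq.2]
        -- The edge is not in `s`, because `s` lies inside `A` and `z b ∉ A`.
        exact (extSpan_insert hz hab (fun h' => l5 (hs _ _ h')) hnot).symm
      · rw [Code.run, if_neg fun h' => hl (hcond.1 h'), Code.run]
        have he : edgesBelow G A z k m a (b + 1) = edgesBelow G A z k m a b := by
          unfold edgesBelow
          ext e
          simp only [Finset.mem_filter, Finset.mem_univ, true_and]
          refine exists_congr fun i => exists_congr fun j => and_congr_right fun hij => ?_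
          refine and_congr_left fun _ => ?_
          have : ¬ (i = a ∧ j = b) := by rintro ⟨rfl, rfl⟩; exact hl hij
          omega
        simp only [I, he]
        exact hIq

/-- The condition under which an entry contributes to the projection. -/
def foldTerm : Tm :=
  .ite (.lt (.reg 15) (.reg 3)) (.eq (.digit (.reg 15) (.reg 25)) (.digit (.reg 15) (.reg 13)))
    (.imp (.lt (.reg 15) (.reg 18)) (.eq (.degree (.reg 15) (.reg 25)) (.const 2)))

/-- One entry of the projection of a row, to register 23. -/
def foldEntry : Code :=
  .seq (.assign 23 (.const 0)) (.bdd 25 4 (.seq (.all 15 6 14 foldTerm)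
    (.ite (.and (.reg 14) (.lt (.reg 25) (.get 6 (.reg 18))))
      (.assign 23 (.xor (.reg 23) (.get 11 (.add (.mul (.reg 21) (.reg 4)) (.reg 25))))) .skip)))

/-- The projections of the rows are inserted into the global family. -/
def foldCode : Code :=
  .seq (.assign 22 (.const 0)) (spreadCode 9 5 13 14 (.tab 13 5 10 (.reg 13) foldEntry 23))

theorem eval_foldTerm (h : Stage G A C L z k m s σ) (hk : 0 < k) {a : ℕ} (ha : a < 3 * k)
    (h13 : σ.reg 13 ≤ σ.reg 4) (h25 : σ.reg 25 ≤ σ.reg 4) (h15 : σ.reg 15 = a) :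
    foldTerm.eval σ ≠ 0 ↔ if a < k then digitAt a (σ.reg 25) = digitAt a (σ.reg 13) else
      (a < m → digitAt a (σ.reg 25) % 3 = 2) := by
  have e15 : (Tm.reg 15).eval σ = a := h15
  have e3 : (Tm.reg 3).eval σ = k := h.reg3
  have e18 : (Tm.reg 18).eval σ = m := h.reg18
  have e25 : (Tm.reg 25).eval σ = σ.reg 25 := rfl
  have e13 : (Tm.reg 13).eval σ = σ.reg 13 := rfl
  have h6 : σ.arr 6 ((Tm.reg 15).eval σ) = 6 ^ (Tm.reg 15).eval σ := by
    rw [e15]; exact h.arr6 a (by omega)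
  have hlt : (Tm.lt (.reg 15) (.reg 3)).eval σ ≠ 0 ↔ a < k := by
    rw [Tm.eval_lt_ne_zero, e15, e3]
  rw [foldTerm, Tm.eval_ite]
  by_cases hak : a < k
  · rw [if_pos (hlt.2 hak), if_pos hak, Tm.eval_eq_ne_zero, Tm.eval_digit h6 (by rw [e25]; exact h25),
      Tm.eval_digit h6 (by rw [e13]; exact h13), e15, e13, e25]
  · rw [if_neg fun h' => hak (hlt.1 h'), if_neg hak, Tm.eval_imp_ne_zero, Tm.eval_lt_ne_zero,
      Tm.eval_eq_ne_zero, Tm.eval_degree h6 (by rw [e25]; exact h25) (h.six_le hk), e15, e18, e25,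
      Tm.eval_const]

open Classical in
theorem foldEntry_spec (h : Stage G A C L z k m s σ) (hk : 0 < k) (hm : m ≤ 3 * k) {p j F : ℕ}
    (hF : σ.reg 4 = F) (hp : p < F) (hj : j < F) (h21 : σ.reg 21 = p) (h13 : σ.reg 13 = j) :
    bit ((foldEntry.run σ).reg 23) = ∑ q ∈ Finset.range (6 ^ m) with ExtendsDigits k m j q,
      vecAt (σ.arr 11) (p * F) F q := by
  rw [foldEntry, Code.run]
  set s1 := Code.run (.assign 23 (.const 0)) σ with hs1
  have hS1 : Stage G A C L z k m s s1 := h.run rfl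
  have h41 : s1.reg 4 = F := by rw [hs1, Code.run_reg (by decide), hF]
  have h231 : s1.reg 23 = 0 := by simp [hs1, Code.run, Tm.eval]
  have hFm : 6 ^ m ≤ F := by rw [← hF]; exact h.pow_le hm
  have key := Code.run_bdd_induct (x := 25) (r := 4) (σ := s1)
    (P := .seq (.all 15 6 14 foldTerm)
      (.ite (.and (.reg 14) (.lt (.reg 25) (.get 6 (.reg 18))))
      (.assign 23 (.xor (.reg 23) (.get 11 (.add (.mul (.reg 21) (.reg 4)) (.reg 25))))) .skip))
    (I := fun x t => bit (t.reg 23) = ∑ q ∈ Finset.range x,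
      if q < 6 ^ m ∧ ExtendsDigits k m j q then vecAt (σ.arr 11) (p * F) F q else 0) ?_ ?_
  · rw [key, h41, ← Finset.sum_filter]
    apply Finset.sum_congr _ fun _ _ => rfl
    ext q
    simp only [Finset.mem_filter, Finset.mem_range]
    constructor
    · rintro ⟨_, h2⟩; exact h2
    · rintro ⟨h1, h2⟩; exact ⟨by omega, h1, h2⟩
  · rw [State.setReg_reg, if_neg (by norm_num), h231, Finset.sum_range_zero, bit_zero]
  · intro x hx t ht25 htr hta hI
    rw [h41] at hx
    have hSt : Stage G A C L z k m s t := hS1.of_code (c := foldEntry) rfl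
      (fun y hy => htr y (fun hm => hy (List.mem_cons_of_mem _ hm))) hta
    have ht4 : t.reg 4 = F := by rw [htr 4 (by decide), h41]
    have ht13 : t.reg 13 = j := by
      rw [htr 13 (by decide), hs1, Code.run_reg (by decide), h13]
    have ht21 : t.reg 21 = p := by
      rw [htr 21 (by decide), hs1, Code.run_reg (by decide), h21]
    have ht11 : t.arr 11 = σ.arr 11 := by
      rw [hta 11 (by decide), hs1, Code.run_arr (by decide)]
    have hall := Code.run_all (x := 15) (r := 6) (acc := 14) (t := foldTerm)
      (by norm_num) (by norm_num) (fun a => if a < k then digitAt a x = digitAt a j else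
      (a < m → digitAt a x % 3 = 2)) t ?_
    · have hiff : (∀ a < t.reg 6, if a < k then digitAt a x = digitAt a j else
          (a < m → digitAt a x % 3 = 2)) ↔ ExtendsDigits k m j x := by
        rw [hSt.reg6]
        constructor
        · intro h'
          refine ⟨fun a ha => ?_, fun a ha ham => ?_⟩
          · have := h' a (by omega)
            rwa [if_pos ha] at this
          · have := h' a (by omega)
            rw [if_neg (by omega)] at this
            exact this ham
        · rintro ⟨h1, h2⟩ a _
          split_ifs with ha
          · exact h1 a ha
          · exact h2 a (by omega)
      rw [hiff] at hall
      rw [Code.run, State.setReg_reg, if_neg (by norm_num), Finset.sum_range_succ, ← hI]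
      set t1 := (Code.all 15 6 14 foldTerm).run t with ht1
      have hSt1 : Stage G A C L z k m s t1 := hSt.run rfl
      have e25 : t1.reg 25 = x := by rw [ht1, Code.run_reg (by decide), ht25]
      have e23 : t1.reg 23 = t.reg 23 := by rw [ht1, Code.run_reg (by decide)]
      have e4 : t1.reg 4 = F := by rw [ht1, Code.run_reg (by decide), ht4]
      have e21 : t1.reg 21 = p := by rw [ht1, Code.run_reg (by decide), ht21]
      have e11 : t1.arr 11 = σ.arr 11 := by rw [ht1, Code.run_arr (by decide), ht11]
      have hcond : (Tm.and (.reg 14) (.lt (.reg 25) (.get 6 (.reg 18)))).eval t1 ≠ 0 ↔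
          x < 6 ^ m ∧ ExtendsDigits k m j x := by
        rw [Tm.eval_and_ne_zero, Tm.eval_lt_ne_zero, Tm.eval_get, Tm.eval_reg, Tm.eval_reg,
          Tm.eval_reg, hall, e25, hSt1.reg18, hSt1.arr6 m hm, and_comm]
      by_cases hc : x < 6 ^ m ∧ ExtendsDigits k m j x
      · rw [Code.run, if_pos (hcond.2 hc), if_pos hc, Code.run, State.setReg_reg_self, bit_xor,
          Tm.eval_get, Tm.eval_add, Tm.eval_mul (by rw [Tm.eval_reg, e21, e4]; exact hp.le),
          Tm.eval_reg, Tm.eval_reg, Tm.eval_reg, Tm.eval_reg, e23, e21, e4, e25, e11, vecAt,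
          if_pos hx]
      · rw [Code.run, if_neg fun h' => hc (hcond.1 h'), if_neg hc, Code.run, e23, add_zero]
    · intro a ha q hq15 hqr hqa
      rw [hSt.reg6] at ha
      have hSq : Stage G A C L z k m s q := hSt.of_code (c := .all 15 6 14 foldTerm) rfl
        (fun y hy => hqr y (fun e => hy (by subst e; decide)) (fun e => hy (by subst e; decide)))
        (fun a _ => by rw [hqa])
      have q13 : q.reg 13 = j := by rw [hqr 13 (by norm_num) (by norm_num), ht13]
      have q25 : q.reg 25 = x := by rw [hqr 25 (by norm_num) (by norm_num), ht25]
      have q4 : q.reg 4 = F := by rw [hqr 4 (by norm_num) (by norm_num), ht4]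
      rw [eval_foldTerm hSq hk ha (by omega) (by omega) hq15, q13, q25]

/-- Register 22 is reset first, so at the end it tells whether this certificate enlarged the global
span. -/
theorem foldCode_spec (h : Stage G A C L z k m s σ) (hk : 0 < k) (hm : m ≤ 3 * k) {F : ℕ}
    (hF : σ.reg 4 = F) (hech : Echelon F (6 ^ k) (σ.arr 13) (σ.arr 14))
    (hτ : τ = foldCode.run σ) :
    Echelon F (6 ^ k) (τ.arr 13) (τ.arr 14) ∧
      Inserted F (6 ^ k) (σ.arr 13) (σ.arr 14) (τ.arr 13) (τ.arr 14) 0 (τ.reg 22) ∧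
      rowSpan F (6 ^ k) (τ.arr 13) (τ.arr 14) = rowSpan F (6 ^ k) (σ.arr 13) (σ.arr 14) ⊔
        (rowSpan F F (σ.arr 9) (σ.arr 11)).map (foldMap k m) := by
  classical
  rw [foldCode, Code.run] at hτ
  set s1 := Code.run (.assign 22 (.const 0)) σ with hs1
  have hS1 : Stage G A C L z k m s s1 := h.run rfl
  have h41 : s1.reg 4 = F := by rw [hs1, Code.run_reg (by decide), hF]
  have ha1 : s1.arr = σ.arr := rfl
  have h22 : s1.reg 22 = 0 := by simp [hs1, Code.run, Tm.eval]
  have hkF : 6 ^ k ≤ F := by rw [← hF]; exact h.pow_le (by omega)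
  have := spreadCode_spec (fs := 9) (r := 5) (fl := 13) (rw := 14) (F := F) (R := 6 ^ k)
    (V := .tab 13 5 10 (.reg 13) foldEntry 23) (foldMap k m) (σ := s1) (by norm_num)
    (by norm_num) (by norm_num) (by norm_num) (by norm_num) (by norm_num) (by norm_num)
    (by norm_num) (by decide) (by decide) h41 hS1.reg5 hkF hech (Or.inl (by norm_num)) ?_ hτ
  · rwa [h22, ha1] at this
  · intro p hp q hq21 hqr hqa hq11
    have hSq : Stage G A C L z k m s q := hS1.of_code
      (c := spreadCode 9 5 13 14 (.tab 13 5 10 (.reg 13) foldEntry 23)) rfl hqr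
      (fun c hc => hqa c (fun e => hc (by subst e; decide)) (fun e => hc (by subst e; decide))
        (fun e => hc (by subst e; decide)))
    have hq4 : q.reg 4 = F := by rw [hqr 4 (by decide), h41]
    have hvq : vecAt (q.arr 11) (p * F) F = vecAt (σ.arr 11) (p * F) F := by
      funext j
      unfold vecAt
      split_ifs with hj
      · rw [hq11 j hj, ha1]
      · rfl
    rw [ha1, ← hvq]
    have key := Code.run_bdd_induct (x := 13) (r := 5) (σ := q)
      (P := .seq foldEntry (.store 10 (.reg 13) (.reg 23)))
      (I := fun j t => ∀ i < j, bit (t.arr 10 i) =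
        ∑ l ∈ Finset.range (6 ^ m) with ExtendsDigits k m i l, vecAt (q.arr 11) (p * F) F l)
      (by simp) ?_
    · rw [hSq.reg5] at key
      funext j
      simp only [vecAt, foldMap, LinearMap.coe_mk, AddHom.coe_mk, zero_add]
      by_cases hj : j < 6 ^ k
      · rw [if_pos hj, if_pos hj]
        exact key j hj
      · rw [if_neg hj, if_neg hj]
    · intro j hj t ht13 htr hta hI i hi
      rw [hSq.reg5] at hj
      have hSt : Stage G A C L z k m s t := hSq.of_code
        (c := .tab 13 5 10 (.reg 13) foldEntry 23) rfl htr hta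
      have hent := foldEntry_spec hSt hk hm (p := p) (j := j) (F := F)
        (by rw [htr 4 (by decide), hq4]) hp (by omega) (by rw [htr 21 (by decide), hq21]) ht13
      rw [State.setReg_arr, Code.run, Code.run, State.setArr_arr, if_pos rfl, Tm.eval_reg,
        Tm.eval_reg, Code.run_reg (y := 13) (by decide), ht13,
        Code.run_arr (a := 10) (by decide)]
      by_cases hij : i = j
      · subst hij
        rw [Function.update_self, hent, hta 11 (by decide)]
      · rw [Function.update_of_ne hij]; exact hI i (by omega)

end Stage

end RAM

/-! ### The main loop: certificates kept and certificates dropped -/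

theorem coverSpan_congr {V : Type*} [Fintype V] [DecidableEq V] {G : SimpleGraph V}
    {A C : Finset V} {z z' : ℕ → V} {k : ℕ} (h : ∀ i < k, z' i = z i) (s : Finset (Sym2 V)) :
    coverSpan G A C z' k s = coverSpan G A C z k s := by
  classical
  have : ∀ F : Finset (Sym2 V), stateVec z' k F = stateVec z k F := by
    intro F
    ext g
    have h' : ∀ i : Fin k, z' i = z i := fun i => h i i.2
    have hfits : Fits z' k F g ↔ Fits z k F g := by simp only [Fits, h']
    simp only [stateVec]
    rw [if_congr hfits rfl rfl]
  simp only [coverSpan, this]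

theorem exists_matrix_index {n l j : ℕ} (hj : j < l * (n * n)) :
    ∃ i < l, ∃ u v : Fin n, j = i * (n * n) + (u * n + v) := by
  have hn : 0 < n := by
    rcases Nat.eq_zero_or_pos n with rfl | h
    · simp at hj
    · exact h
  refine ⟨j / (n * n), ?_, ⟨j % (n * n) / n, ?_⟩, ⟨j % (n * n) % n, Nat.mod_lt _ hn⟩, ?_⟩
  · rwa [Nat.div_lt_iff_lt_mul (by positivity)]
  · rw [Nat.div_lt_iff_lt_mul hn]; exact Nat.mod_lt _ (by positivity)
  · simp only
    rw [mul_comm (j % (n * n) / n), Nat.div_add_mod, mul_comm (j / (n * n)), Nat.div_add_mod]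

namespace RAM

section Stage

variable {n : ℕ} {G : SimpleGraph (Fin n)} {A C : Finset (Fin n)}
  {L : List (Finset (Sym2 (Fin n)))} {z : ℕ → Fin n} {k m : ℕ} {s : Finset (Sym2 (Fin n))}
  {σ τ : State}

/-- The space of the current certificate is added to the global family of rows. -/
def spanCode : Code := .seq startCode (.seq attachCode foldCode)

theorem spanCode_spec (h : Stage G A C L z k m s σ) (hk : 0 < k) (hkm : k ≤ m) (hm : m ≤ 3 * k)
    (hz : ∀ i < m, ∀ j < m, z i = z j → i = j) (hE : Enumerates z k C)
    (hs : s ∈ cert G (A : Set (Fin n)))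
    (hD : ∀ u, u ∈ deficient A C s ↔ ∃ i, k ≤ i ∧ i < m ∧ z i = u) {F : ℕ} (hF : σ.reg 4 = F)
    (hech : Echelon F (6 ^ k) (σ.arr 13) (σ.arr 14)) (hτ : τ = spanCode.run σ) :
    Echelon F (6 ^ k) (τ.arr 13) (τ.arr 14) ∧
      Inserted F (6 ^ k) (σ.arr 13) (σ.arr 14) (τ.arr 13) (τ.arr 14) 0 (τ.reg 22) ∧
      (rowSpan F (6 ^ k) (τ.arr 13) (τ.arr 14)).map (coords k) =
        (rowSpan F (6 ^ k) (σ.arr 13) (σ.arr 14)).map (coords k) ⊔ coverSpan G A C z k s := by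
  rw [spanCode, Code.run, Code.run] at hτ
  set s1 := startCode.run σ with hs1
  set s2 := attachCode.run s1 with hs2
  have hS1 : Stage G A C L z k m s s1 := h.run rfl
  have hS2 : Stage G A C L z k m s s2 := hS1.run rfl
  have h41 : s1.reg 4 = F := by rw [hs1, Code.run_reg (by decide), hF]
  have h42 : s2.reg 4 = F := by rw [hs2, Code.run_reg (by decide), h41]
  have h13 : s2.arr 13 = σ.arr 13 := by
    rw [hs2, Code.run_arr (by decide), hs1, Code.run_arr (by decide)]
  have h14 : s2.arr 14 = σ.arr 14 := by
    rw [hs2, Code.run_arr (by decide), hs1, Code.run_arr (by decide)]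
  obtain ⟨i1, i2⟩ := startCode_spec h hk hm hF hs1
  obtain ⟨-, j2⟩ := attachCode_spec hS1 hk hkm hm hz
    (fun u v huv => (not_mem_left_of_mem_cert hs huv).2.1) h41 i1 i2 hs2
  obtain ⟨l1, l2, l3⟩ := foldCode_spec hS2 hk hm h42 (by rw [h13, h14]; exact hech) hτ
  rw [h13, h14] at l2 l3
  refine ⟨l1, l2, ?_⟩
  rw [l3, Submodule.map_sup]
  congr 1
  -- Passing to coordinates intertwines `foldMap` with `project`, so the projected rows span the
  -- image computed by `map_project_extSpan`.
  have hcomm : ((rowSpan F F (s2.arr 9) (s2.arr 11)).map (foldMap k m)).map (coords k) =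
      ((rowSpan F F (s2.arr 9) (s2.arr 11)).map (coords m)).map (project hkm) := by
    rw [← Submodule.map_comp, ← Submodule.map_comp]
    congr 1
    apply LinearMap.ext
    intro f
    exact coords_foldMap hkm f
  rw [hcomm, j2]
  refine map_project_extSpan hk hkm hE hs hD fun e => ?_
  simp only [edgesBelow, Finset.mem_filter, Finset.mem_univ, true_and]
  constructor
  · rintro ⟨i, j, ⟨h1, h2, h3, h4, h5⟩, -, rfl⟩
    exact ⟨z i, z j, rfl, (hD _).2 ⟨i, h1, h2, rfl⟩, (hE.mem_iff _).2 ⟨j, h3, rfl⟩, h5, h4⟩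
  · rintro ⟨u, y, rfl, hu, hy, hyA, hadj⟩
    obtain ⟨i, h1, h2, rfl⟩ := (hD u).1 hu
    obtain ⟨j, h3, rfl⟩ := (hE.mem_iff y).1 hy
    exact ⟨i, j, ⟨h1, h2, h3, hadj, hyA⟩, Or.inl h2, rfl⟩

/-- The current certificate is appended to the output. -/
def copyCode : Code :=
  .seq (.bdd 13 0 (.tab 15 0 4 (.add (.reg 24) (.pair (.reg 13) (.reg 15)))
      (.assign 14 (.get 3 (.add (.reg 12) (.pair (.reg 13) (.reg 15))))) 14))
    (.seq (.assign 24 (.add (.reg 24) (.mul (.reg 0) (.reg 0))))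
      (.assign 2 (.add (.reg 2) (.const 1))))

/-- The treatment of one certificate in the main loop. -/
def bodyCode : Code :=
  .seq degCode (.seq linkCode (.seq (.assign 18 (.reg 3)) (.seq
    (.collect 13 18 (.and (.get 1 (.reg 13)) (.and (.not (.get 2 (.reg 13)))
      (.not (.eq (.get 7 (.reg 13)) (.const 2))))))
    (.seq (.ite (.lt (.reg 18) (.add (.reg 6) (.const 1)))
        (.seq spanCode (.ite (.reg 22) copyCode .skip)) .skip)
      (.assign 12 (.add (.reg 12) (.mul (.reg 0) (.reg 0))))))))

/-- The memory before round `i` of the main loop, after the certificates in `K` have been put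
out. -/
structure Progress {n : ℕ} (G : SimpleGraph (Fin n)) (A C : Finset (Fin n))
    (L : List (Finset (Sym2 (Fin n)))) (z : ℕ → Fin n) (k i : ℕ)
    (K : List (Finset (Sym2 (Fin n)))) (σ : State) : Prop extends Base G A C L z k σ where
  reg12 : σ.reg 12 = i * (n * n)
  reg2 : σ.reg 2 = K.length
  reg24 : σ.reg 24 = K.length * (n * n)
  out : ∀ j < K.length * (n * n), σ.arr 4 j = familyArray K j
  sub : K.Sublist (L.take i)
  ech : Echelon (216 ^ k + n) (6 ^ k) (σ.arr 13) (σ.arr 14)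
  count : K.length ≤ ((Finset.range (6 ^ k)).filter fun p => σ.arr 13 p ≠ 0).card
  span : (rowSpan (216 ^ k + n) (6 ^ k) (σ.arr 13) (σ.arr 14)).map (coords k) =
    ⨆ s ∈ K, coverSpan G A C z k s
  cover : ∀ s ∈ L.take i, (deficient A C s).card ≤ 2 * k →
    coverSpan G A C z k s ≤ ⨆ s ∈ K, coverSpan G A C z k s

theorem copyCode_spec (h : Base G A C L z k σ) {i : ℕ} (hi : i < L.length)
    (h12 : σ.reg 12 = i * (n * n)) {K : List (Finset (Sym2 (Fin n)))}
    (h2 : σ.reg 2 = K.length) (h24 : σ.reg 24 = K.length * (n * n))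
    (hout : ∀ j < K.length * (n * n), σ.arr 4 j = familyArray K j) (hτ : τ = copyCode.run σ) :
    τ.reg 2 = (K ++ [L[i]]).length ∧ τ.reg 24 = (K ++ [L[i]]).length * (n * n) ∧
      ∀ j < (K ++ [L[i]]).length * (n * n), τ.arr 4 j = familyArray (K ++ [L[i]]) j := by
  classical
  rw [copyCode, Code.run, Code.run] at hτ
  set s1 := Code.run (.bdd 13 0 (.tab 15 0 4 (.add (.reg 24) (.pair (.reg 13) (.reg 15)))
      (.assign 14 (.get 3 (.add (.reg 12) (.pair (.reg 13) (.reg 15))))) 14)) σ with hs1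
  have hB1 : Base G A C L z k s1 := h.run rfl rfl
  have h241 : s1.reg 24 = K.length * (n * n) := by rw [hs1, Code.run_reg (by decide), h24]
  have h21 : s1.reg 2 = K.length := by rw [hs1, Code.run_reg (by decide), h2]
  have h4 : s1.arr 4 = fun j => if K.length * (n * n) ≤ j ∧ j < K.length * (n * n) + n * n then
      familyArray L (i * (n * n) + (j - K.length * (n * n))) else σ.arr 4 j := by
    rw [hs1, Code.run_tab_tab (off := K.length * (n * n)) (n := n)
      (fun j => familyArray L (i * (n * n) + j)) σ h.reg0 (by norm_num) (by norm_num)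
      (by norm_num) (by norm_num) (by norm_num)]
    intro a ha b hb q hq13 hq15 hqr hqa
    have q0 : q.reg 0 = n := by rw [hqr 0 (by norm_num) (by norm_num) (by norm_num), h.reg0]
    have q4 : n ≤ q.reg 4 := by
      rw [hqr 4 (by norm_num) (by norm_num) (by norm_num)]; exact h.le_reg4
    have q12 : q.reg 12 = i * (n * n) := by
      rw [hqr 12 (by norm_num) (by norm_num) (by norm_num), h12]
    have q24 : q.reg 24 = K.length * (n * n) := by
      rw [hqr 24 (by norm_num) (by norm_num) (by norm_num), h24]
    refine ⟨?_, ?_⟩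
    · rw [Tm.eval_add, Tm.eval_pair]
      · simp [Tm.eval_reg, State.setReg_reg, hq13, hq15, q0, q24]
      · simp [Tm.eval_reg, State.setReg_reg, hq13]; omega
    · rw [Tm.eval_get, Tm.eval_add, Tm.eval_pair (by rw [Tm.eval_reg, hq13]; omega), Tm.eval_reg,
        Tm.eval_reg, Tm.eval_reg, hq13, hq15, q0, q12, hqa 3 (by norm_num), h.arr3]
  have hmul : (Tm.mul (.reg 0) (.reg 0)).eval s1 = n * n := by
    rw [Tm.eval_mul (by rw [Tm.eval_reg, hB1.reg0]; exact hB1.le_reg4), Tm.eval_reg, hB1.reg0]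
  have hlen : (K ++ [L[i]]).length = K.length + 1 := by simp
  rw [hlen]
  refine ⟨?_, ?_, ?_⟩
  · rw [hτ]
    simp [Code.run, State.setReg_reg, Tm.eval_add, Tm.eval_reg, Tm.eval_const, h21]
  · rw [hτ]
    simp [Code.run, State.setReg_reg, Tm.eval_add, Tm.eval_reg, h241, hmul]
    ring
  · intro j hj
    have hτ4 : τ.arr 4 = s1.arr 4 := by rw [hτ]; rfl
    obtain ⟨a, ha, u, v, rfl⟩ := exists_matrix_index hj
    rw [familyArray_eq_ite (by rw [hlen]; exact ha), hτ4, h4]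
    have huv : (u : ℕ) * n + v < n * n := by
      have := u.2; have := v.2
      calc (u : ℕ) * n + v < u * n + n := by omega
        _ = (u + 1) * n := by ring
        _ ≤ n * n := Nat.mul_le_mul_right _ (by omega)
    by_cases haK : a = K.length
    · subst haK
      simp only
      rw [if_pos ⟨by omega, by omega⟩, Nat.add_sub_cancel_left, familyArray_eq_ite hi]
      simp
    · have haK' : a < K.length := by omega
      have hlt : a * (n * n) + (u * n + v) < K.length * (n * n) := by
        calc a * (n * n) + (u * n + v) < a * (n * n) + n * n := by omega
          _ = (a + 1) * (n * n) := by ring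
          _ ≤ _ := Nat.mul_le_mul_right _ haK'
      simp only
      rw [if_neg (by omega), hout _ hlt, familyArray_eq_ite haK', List.getElem_append_left haK']

/-- A certificate is kept exactly when its space produces a new row. Every kept certificate sets at
least one further flag among `6 ^ k`, which bounds their number; a dropped one either lies in the
span already or has more than `2 * k` deficient vertices. -/
theorem bodyCode_spec {i : ℕ} {K : List (Finset (Sym2 (Fin n)))} (h : Progress G A C L z k i K σ)
    (hi : i < L.length) (hk : 0 < k) (hE : Enumerates z k C)
    (hL : ∀ s ∈ L, s ∈ cert G (A : Set (Fin n))) :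
    ∃ K', Progress G A C L z k (i + 1) K' (bodyCode.run σ) := by
  classical
  obtain ⟨s1, hs1⟩ : ∃ s1, s1 = degCode.run σ := ⟨_, rfl⟩
  obtain ⟨s2, hs2⟩ : ∃ s2, s2 = linkCode.run s1 := ⟨_, rfl⟩
  obtain ⟨s3, hs3⟩ : ∃ s3, s3 = Code.run (.assign 18 (.reg 3)) s2 := ⟨_, rfl⟩
  obtain ⟨s4, hs4⟩ : ∃ s4, s4 = Code.run (.collect 13 18 (.and (.get 1 (.reg 13))
    (.and (.not (.get 2 (.reg 13))) (.not (.eq (.get 7 (.reg 13)) (.const 2)))))) s3 := ⟨_, rfl⟩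
  obtain ⟨s5, hs5⟩ : ∃ s5, s5 = Code.run (.ite (.lt (.reg 18) (.add (.reg 6) (.const 1)))
    (.seq spanCode (.ite (.reg 22) copyCode .skip)) .skip) s4 := ⟨_, rfl⟩
  have hrun : bodyCode.run σ = Code.run (.assign 12 (.add (.reg 12) (.mul (.reg 0) (.reg 0)))) s5 := by
    rw [hs5, hs4, hs3, hs2, hs1]; rfl
  set s := L[i] with hsdef
  have hsL : s ∈ cert G (A : Set (Fin n)) := hL _ (List.getElem_mem hi)
  have hB1 : Base G A C L z k s1 := hs1 ▸ h.toBase.run rfl rfl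
  have h121 : s1.reg 12 = i * (n * n) := by rw [hs1, Code.run_reg (by decide), h.reg12]
  have hB2 : Base G A C L z k s2 := hs2 ▸ hB1.run rfl rfl
  have hB3 : Base G A C L z k s3 := hs3 ▸ hB2.run rfl rfl
  have hdeg : ∀ v : Fin n, s3.arr 7 v = edgeDeg s v := by
    intro v
    rw [hs3, Code.run_arr (by decide), hs2, Code.run_arr (by decide), hs1,
      degCode_spec h.toBase hi h.reg12]
  have hconn : ∀ u w : Fin n, s3.arr 8 (u * n + w) ≠ 0 ↔
      (SimpleGraph.fromEdgeSet (s : Set (Sym2 (Fin n)))).Reachable u w := by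
    intro u w
    rw [hs3, Code.run_arr (by decide), hs2]
    exact linkCode_spec hB1 hi h121 u w
  have h183 : s3.reg 18 = k := by
    rw [hs3]; simp [Code.run, Tm.eval_reg, hB2.reg3]
  obtain ⟨l, hl1, hl2, hl3, hl4, hl5⟩ := Code.run_collect (x := 13) (r := 18) (c := .and
    (.get 1 (.reg 13)) (.and (.not (.get 2 (.reg 13))) (.not (.eq (.get 7 (.reg 13)) (.const 2)))))
    (by norm_num) (fun v => ∃ hv : v < n, (⟨v, hv⟩ : Fin n) ∈ deficient A C s) s3 (by
      intro v hv q hq13 hqr hqa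
      rw [hB3.reg0] at hv
      have e13 : (Tm.reg 13).eval q = v := hq13
      rw [Tm.eval_and_ne_zero, Tm.eval_and_ne_zero, Tm.eval_not_ne_zero, Tm.eval_not_ne_zero,
        Tm.eval_eq_ne_zero, Tm.eval_get, Tm.eval_get, Tm.eval_get, e13, Tm.eval_const,
        hqa 1 (by norm_num), hqa 2 (by norm_num), hqa 7 (by norm_num), hB3.arr1, hB3.arr2]
      have e1 := vertexSetArray_ne_zero_iff (X := A) (v := ⟨v, hv⟩)
      have e2 := vertexSetArray_ne_zero_iff (X := C) (v := ⟨v, hv⟩)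
      have e3 := hdeg ⟨v, hv⟩
      simp only at e1 e2 e3
      rw [e1, e2, e3]
      simp [deficient, hv])
  rw [← hs4, h183] at hl3 hl4 hl5
  rw [hB3.reg0] at hl2
  have hln : ∀ v ∈ l, v < n := fun v hv => ((hl2 v).1 hv).1
  set m := k + l.length with hmdef
  -- The enumeration of the cover is continued by the deficient vertices of the current certificate;
  -- only the first `k` values are shared between rounds.
  let z' : ℕ → Fin n := fun j => if hj : k ≤ j ∧ j - k < l.length then
    ⟨l[j - k]'hj.2, hln _ (List.getElem_mem _)⟩ else z j
  have hz'lt : ∀ j < k, z' j = z j := fun j hj => dif_neg (by omega)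
  have hz'ge : ∀ j (hj : j < l.length), (z' (k + j) : ℕ) = l[j] := by
    intro j hj
    have hc : k ≤ k + j ∧ k + j - k < l.length := by omega
    simp only [z', dif_pos hc, Nat.add_sub_cancel_left]
  have hD : ∀ u, u ∈ deficient A C s ↔ ∃ j, k ≤ j ∧ j < m ∧ z' j = u := by
    intro u
    constructor
    · intro hu
      have : (u : ℕ) ∈ l := (hl2 u).2 ⟨u.2, u.2, hu⟩
      obtain ⟨j, hj, he⟩ := List.getElem_of_mem this
      exact ⟨k + j, by omega, by omega, Fin.ext (by rw [hz'ge j hj, he])⟩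
    · rintro ⟨j, h1, h2, rfl⟩
      obtain ⟨j', rfl⟩ := Nat.exists_eq_add_of_le h1
      have hj' : j' < l.length := by omega
      obtain ⟨-, hv, hmem⟩ := (hl2 _).1 (List.getElem_mem hj')
      have : z' (k + j') = ⟨l[j'], hv⟩ := Fin.ext (hz'ge j' hj')
      rw [this]; exact hmem
  have hE' : Enumerates z' k C := by
    refine ⟨fun a ha b hb hab => ?_, fun v => ?_⟩
    · rw [hz'lt a ha, hz'lt b hb] at hab; exact hE.inj a ha b hb hab
    · rw [hE.mem_iff]
      refine exists_congr fun j => and_congr_right fun hj => ?_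
      rw [hz'lt j hj]
  have hnotC : ∀ j, k ≤ j → j < m → z' j ∉ C := by
    intro j h1 h2
    have := (hD (z' j)).2 ⟨j, h1, h2, rfl⟩
    simp only [deficient, Finset.mem_filter] at this
    exact this.2.1
  have hzinj : ∀ a < m, ∀ b < m, z' a = z' b → a = b := by
    intro a ha b hb hab
    by_cases hak : a < k <;> by_cases hbk : b < k
    · exact hE'.inj a hak b hbk hab
    · exact absurd (hab ▸ (hE'.mem_iff _).2 ⟨a, hak, rfl⟩) (hnotC b (by omega) hb)
    · exact absurd (hab ▸ (hE'.mem_iff _).2 ⟨b, hbk, rfl⟩) (hnotC a (by omega) ha)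
    · obtain ⟨a', rfl⟩ := Nat.exists_eq_add_of_le (not_lt.1 hak)
      obtain ⟨b', rfl⟩ := Nat.exists_eq_add_of_le (not_lt.1 hbk)
      have := congrArg Fin.val hab
      rw [hz'ge a' (by omega), hz'ge b' (by omega), hl1.getElem_inj_iff] at this
      omega
  have hcard : (deficient A C s).card = l.length := by
    rw [← List.toFinset_card_of_nodup hl1, ← Finset.card_map Fin.valEmbedding]
    congr 1
    ext v
    simp only [Finset.mem_map, Fin.valEmbedding_apply, List.mem_toFinset, hl2]
    constructor
    · rintro ⟨a, ha, rfl⟩; exact ⟨a.2, a.2, ha⟩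
    · rintro ⟨_, hv, ha⟩; exact ⟨_, ha, rfl⟩
  have hB4 : Base G A C L z k s4 := by
    refine hB3.of_code (c := .collect 13 18 (.and (.get 1 (.reg 13))
      (.and (.not (.get 2 (.reg 13))) (.not (.eq (.get 7 (.reg 13)) (.const 2)))))) rfl
      (fun y hy => ?_) (fun a ha => ?_) hl5
    · rw [hs4, Code.run_reg hy]
    · rw [hs4, Code.run_arr ha]
  have hS4 : Stage G A C L z' k m s s4 := by
    refine ⟨⟨hB4.reg0, hB4.reg3, hB4.reg4, hB4.reg5, hB4.reg6, hB4.arr0, hB4.arr1, hB4.arr2,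
      hB4.arr3, hB4.arr6, fun j hj => by rw [hB4.arr5 j hj, hz'lt j hj]⟩, hl3, fun j hj => ?_,
      fun v => ?_, fun u w => ?_⟩
    · by_cases hjk : j < k
      · rw [hB4.arr5 j hjk, hz'lt j hjk]
      · obtain ⟨j', rfl⟩ := Nat.exists_eq_add_of_le (not_lt.1 hjk)
        rw [hl4 j' (by omega), hz'ge j' (by omega)]
    · rw [hs4, Code.run_arr (by decide), hdeg]
    · rw [hs4, Code.run_arr (by decide), hconn]
  have hreg : ∀ y, y = 2 ∨ y = 12 ∨ y = 24 → s4.reg y = σ.reg y := by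
    rintro y (rfl | rfl | rfl) <;>
    rw [hs4, Code.run_reg (by decide), hs3, Code.run_reg (by decide), hs2,
      Code.run_reg (by decide), hs1, Code.run_reg (by decide)]
  have harr : ∀ a, a = 4 ∨ a = 13 ∨ a = 14 → s4.arr a = σ.arr a := by
    rintro a (rfl | rfl | rfl) <;>
    rw [hs4, Code.run_arr (by decide), hs3, Code.run_arr (by decide), hs2,
      Code.run_arr (by decide), hs1, Code.run_arr (by decide)]
  have htake : L.take (i + 1) = L.take i ++ [s] := by rw [List.take_succ_eq_append_getElem hi]
  suffices hmain : ∃ K', Base G A C L z k s5 ∧ s5.reg 12 = i * (n * n) ∧ s5.reg 2 = K'.length ∧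
      s5.reg 24 = K'.length * (n * n) ∧
      (∀ j < K'.length * (n * n), s5.arr 4 j = familyArray K' j) ∧
      (K' = K ∨ K' = K ++ [s]) ∧
      Echelon (216 ^ k + n) (6 ^ k) (s5.arr 13) (s5.arr 14) ∧
      K'.length ≤ ((Finset.range (6 ^ k)).filter fun p => s5.arr 13 p ≠ 0).card ∧
      (rowSpan (216 ^ k + n) (6 ^ k) (s5.arr 13) (s5.arr 14)).map (coords k) =
        ⨆ s ∈ K', coverSpan G A C z k s ∧
      ((deficient A C s).card ≤ 2 * k →
        coverSpan G A C z k s ≤ ⨆ s ∈ K', coverSpan G A C z k s) by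
    obtain ⟨K', hB5, h12, h2, h24, hout, hK, hech, hcount, hspan, hcover⟩ := hmain
    have hsupK : (⨆ s ∈ K, coverSpan G A C z k s) ≤ ⨆ s ∈ K', coverSpan G A C z k s := by
      refine biSup_mono fun t ht => ?_
      rcases hK with rfl | rfl
      · exact ht
      · exact List.mem_append_left _ ht
    have hmul : (Tm.mul (.reg 0) (.reg 0)).eval s5 = n * n := by
      rw [Tm.eval_mul (by rw [Tm.eval_reg, hB5.reg0]; exact hB5.le_reg4), Tm.eval_reg, hB5.reg0]
    have hB6 : Base G A C L z k (bodyCode.run σ) := by rw [hrun]; exact hB5.run rfl rfl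
    have hr6 : ∀ y, y ≠ 12 → (bodyCode.run σ).reg y = s5.reg y := fun y hy => by
      rw [hrun, Code.run_reg (by simpa [Code.regs] using hy)]
    have ha6 : (bodyCode.run σ).arr = s5.arr := by rw [hrun]; rfl
    refine ⟨K', hB6, ?_, ?_, ?_, ?_, ?_, ?_, ?_, ?_, ?_⟩
    · rw [hrun, Code.run, State.setReg_reg_self, Tm.eval_add, Tm.eval_reg, h12, hmul]; ring
    · rw [hr6 2 (by norm_num), h2]
    · rw [hr6 24 (by norm_num), h24]
    · rw [ha6]; exact hout
    · rw [htake]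
      rcases hK with rfl | rfl
      · exact h.sub.trans (List.sublist_append_left _ _)
      · exact h.sub.append (List.Sublist.refl _)
    · rw [ha6]; exact hech
    · rw [ha6]; exact hcount
    · rw [ha6]; exact hspan
    · intro t ht hd
      rw [htake, List.mem_append, List.mem_singleton] at ht
      rcases ht with ht | rfl
      · exact (h.cover t ht hd).trans hsupK
      · exact hcover hd
  have hcond : (Tm.lt (.reg 18) (.add (.reg 6) (.const 1))).eval s4 ≠ 0 ↔ m ≤ 3 * k := by
    rw [Tm.eval_lt_ne_zero, Tm.eval_add, Tm.eval_reg, Tm.eval_reg, Tm.eval_const, hS4.reg18,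
      hS4.reg6]
    omega
  by_cases hm : m ≤ 3 * k
  · rw [Code.run, if_pos (hcond.2 hm), Code.run] at hs5
    obtain ⟨t, ht⟩ : ∃ t, t = spanCode.run s4 := ⟨_, rfl⟩
    rw [← ht] at hs5
    obtain ⟨i1, i2, i3⟩ := spanCode_spec hS4 hk (by omega) hm hzinj hE' hsL hD hS4.reg4
      (by rw [harr 13 (by simp), harr 14 (by simp)]; exact h.ech) ht
    rw [harr 13 (by simp), harr 14 (by simp)] at i2 i3
    -- The space on the cover does not depend on the continuation of the enumeration, so it can be
    -- compared across rounds.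
    rw [coverSpan_congr hz'lt, h.span] at i3
    have hBt : Base G A C L z k t := ht ▸ hB4.run rfl rfl
    have htr : ∀ y, y = 2 ∨ y = 12 ∨ y = 24 → t.reg y = σ.reg y := by
      intro y hy
      rw [ht, Code.run_reg, hreg y hy]
      rcases hy with rfl | rfl | rfl <;> decide
    have ht4 : t.arr 4 = σ.arr 4 := by rw [ht, Code.run_arr (by decide), harr 4 (by simp)]
    rcases i2.change with ⟨e1, e2⟩ | ⟨e1, p, hp, hp0, hp1⟩
    · have hs5' : s5 = t := by
        rw [hs5, Code.run, if_neg (by rw [Tm.eval_reg, e1]; simp), Code.run]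
      have hsame : rowSpan (216 ^ k + n) (6 ^ k) (t.arr 13) (t.arr 14) =
          rowSpan (216 ^ k + n) (6 ^ k) (σ.arr 13) (σ.arr 14) := by
        rw [e2]
        exact rowSpan_congr i2.row_eq
      refine ⟨K, ?_⟩
      rw [hs5']
      refine ⟨hBt, by rw [htr 12 (by simp), h.reg12], by rw [htr 2 (by simp), h.reg2],
        by rw [htr 24 (by simp), h.reg24], by rw [ht4]; exact h.out, Or.inl rfl, i1,
        by rw [e2]; exact h.count, by rw [hsame, h.span], fun _ => ?_⟩
      rw [hsame, h.span] at i3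
      rw [i3]
      exact le_sup_right
    · have hs5' : s5 = copyCode.run t := by
        rw [hs5, Code.run, if_pos (by rw [Tm.eval_reg, e1]; norm_num)]
      obtain ⟨c1, c2, c3⟩ := copyCode_spec hBt hi (by rw [htr 12 (by simp), h.reg12])
        (by rw [htr 2 (by simp), h.reg2]) (by rw [htr 24 (by simp), h.reg24])
        (by rw [ht4]; exact h.out) hs5'
      have h13 : s5.arr 13 = t.arr 13 := by rw [hs5', Code.run_arr (by decide)]
      have h14 : s5.arr 14 = t.arr 14 := by rw [hs5', Code.run_arr (by decide)]
      have hsup : (⨆ s' ∈ K ++ [s], coverSpan G A C z k s') =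
          (⨆ s' ∈ K, coverSpan G A C z k s') ⊔ coverSpan G A C z k s := by
        simp only [List.mem_append, List.mem_singleton, iSup_or, iSup_sup_eq, iSup_iSup_eq_left]
      refine ⟨K ++ [s], hs5' ▸ hBt.run rfl rfl, ?_, c1, c2, c3, Or.inr rfl, ?_, ?_, ?_, ?_⟩
      · rw [hs5', Code.run_reg (by decide), htr 12 (by simp), h.reg12]
      · rw [h13, h14]; exact i1
      · rw [h13, List.length_append, List.length_singleton]
        -- Flags are never cleared, and position `p` is new.
        have hlt : ((Finset.range (6 ^ k)).filter fun p => σ.arr 13 p ≠ 0).card <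
            ((Finset.range (6 ^ k)).filter fun p => t.arr 13 p ≠ 0).card := by
          apply Finset.card_lt_card
          rw [Finset.ssubset_iff_of_subset]
          · exact ⟨p, by simp [hp, hp1], by simp [hp0]⟩
          · intro q hq
            simp only [Finset.mem_filter] at hq ⊢
            exact ⟨hq.1, i2.flag_mono q hq.2⟩
        have := h.count
        omega
      · rw [h13, h14, i3, hsup]
      · intro _
        rw [hsup]
        exact le_sup_right
  · rw [Code.run, if_neg fun h' => hm (hcond.1 h'), Code.run] at hs5
    subst hs5
    refine ⟨K, hB4, by rw [hreg 12 (by simp), h.reg12], by rw [hreg 2 (by simp), h.reg2],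
      by rw [hreg 24 (by simp), h.reg24], by rw [harr 4 (by simp)]; exact h.out, Or.inl rfl, ?_, ?_,
      ?_, fun hd => ?_⟩
    · rw [harr 13 (by simp), harr 14 (by simp)]; exact h.ech
    · rw [harr 13 (by simp)]; exact h.count
    · rw [harr 13 (by simp), harr 14 (by simp)]; exact h.span
    -- Here `m > 3 * k`, so there are more than `2 * k` deficient vertices and the claim is vacuous.
    · omega

end Stage

/-! ### Setup, correctness of the whole program and running time -/

/-- The cover is listed in array 5; registers 3, 5, 6, 7 get `k`, `6 ^ k`, `3 * k`, `216 ^ k`. -/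
def setupCode : Code :=
  .seq (.collect 10 3 (.get 2 (.reg 10))) (.seq (.assign 5 (.const 1)) (.seq (.assign 7 (.const 1))
    (.seq (.bdd 10 0 (.ite (.lt (.reg 10) (.reg 3))
      (.seq (.assign 5 (.six (.reg 5))) (.assign 7 (.six (.six (.six (.reg 7)))))) .skip))
      (.assign 6 (.add (.reg 3) (.add (.reg 3) (.reg 3)))))))

/-- Powers of six, to array 6. -/
def powCode : Code :=
  .seq (.store 6 (.const 0) (.const 1))
    (.bdd 10 6 (.store 6 (.add (.reg 10) (.const 1)) (.six (.get 6 (.reg 10)))))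

/-- The main part of the program. -/
def mainCode : Code := .seq powCode (.bdd 11 1 bodyCode)

/-- A program that computes a small preserving subfamily. -/
def shrinkProgram : Program :=
  .seq setupCode.compile (.seq (.assign 4 (.add (.reg 7) (.reg 0))) mainCode.compile)

variable {n : ℕ} {G : SimpleGraph (Fin n)} {A C : Finset (Fin n)}
  {L : List (Finset (Sym2 (Fin n)))} {k : ℕ}

/-- This phase runs before register 4 is set, when products and quotients are not available;
multiplication by six is done by additions. The powers are computed in `n` rounds of which only the
first `k ≤ n` act, since `k` is itself being written and cannot limit a loop. -/
theorem setupCode_spec (hC : C.card = k) (hk : 0 < k) {σ : State}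
    (hσ : σ = setupCode.run (inputState G A C L)) :
    ∃ z : ℕ → Fin n, Enumerates z k C ∧ σ.reg 3 = k ∧ σ.reg 5 = 6 ^ k ∧ σ.reg 6 = 3 * k ∧
      σ.reg 7 = 216 ^ k ∧ ∀ i < k, σ.arr 5 i = z i := by
  have hkn : k ≤ n := by
    have := Finset.card_le_univ C
    rwa [hC, Fintype.card_fin] at this
  set σ0 := inputState G A C L with hσ0
  obtain ⟨l, hl1, hl2, hl3, hl4, -⟩ := Code.run_collect (x := 10) (r := 3) (c := .get 2 (.reg 10))
    (by norm_num) (fun v => ∃ hv : v < n, (⟨v, hv⟩ : Fin n) ∈ C) σ0 (by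
      intro v hv q hq10 _ hqa
      have hv' : v < n := hv
      rw [Tm.eval_get, Tm.eval_reg, hq10, hqa 2 (by norm_num)]
      have : σ0.arr 2 = vertexSetArray C := rfl
      rw [this]
      have e := vertexSetArray_ne_zero_iff (X := C) (v := ⟨v, hv'⟩)
      simp only at e
      rw [e]
      simp [hv'])
  have h00 : σ0.reg 0 = n := rfl
  have h03 : σ0.reg 3 = 0 := rfl
  rw [h00] at hl2
  rw [h03] at hl3 hl4
  rw [setupCode] at hσ
  set s1 := Code.run (.collect 10 3 (.get 2 (.reg 10))) σ0 with hs1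
  set s2 := Code.run (.assign 7 (.const 1)) (Code.run (.assign 5 (.const 1)) s1) with hs2
  set s3 := Code.run (.bdd 10 0 (.ite (.lt (.reg 10) (.reg 3))
      (.seq (.assign 5 (.six (.reg 5))) (.assign 7 (.six (.six (.six (.reg 7)))))) .skip)) s2 with hs3
  change σ = Code.run (.assign 6 (.add (.reg 3) (.add (.reg 3) (.reg 3)))) s3 at hσ
  have hlen : l.length = k := by
    rw [← hC, ← List.toFinset_card_of_nodup hl1, ← Finset.card_map Fin.valEmbedding]
    congr 1
    ext v
    simp only [Finset.mem_map, Fin.valEmbedding_apply, List.mem_toFinset, hl2]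
    constructor
    · rintro ⟨_, hv, ha⟩; exact ⟨_, ha, rfl⟩
    · rintro ⟨a, ha, rfl⟩; exact ⟨a.2, a.2, ha⟩
  have h31 : s1.reg 3 = k := by rw [hl3, zero_add, hlen]
  have h32 : s2.reg 3 = k := by simp [hs2, Code.run, State.setReg_reg, h31]
  have h02 : s2.reg 0 = n := by
    simp only [hs2, Code.run, State.setReg_reg]
    rw [if_neg (by norm_num), if_neg (by norm_num), hs1, Code.run_reg (by decide), h00]
  have h33 : s3.reg 3 = k := by rw [hs3, Code.run_reg (by decide), h32]
  have key := Code.run_bdd_induct (x := 10) (r := 0) (σ := s2)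
    (P := .ite (.lt (.reg 10) (.reg 3))
      (.seq (.assign 5 (.six (.reg 5))) (.assign 7 (.six (.six (.six (.reg 7)))))) .skip)
    (I := fun j t => t.reg 5 = 6 ^ min j k ∧ t.reg 7 = 216 ^ min j k) ?_ ?_
  · rw [← hs3, h02, min_eq_right hkn] at key
    have h5 : σ.arr 5 = s1.arr 5 := by
      rw [hσ, Code.run_arr (by decide), hs3, Code.run_arr (by decide), hs2,
        Code.run_arr (by decide), Code.run_arr (by decide)]
    have hln : ∀ v ∈ l, v < n := fun v hv => ((hl2 v).1 hv).1
    -- The remainder only makes the values elements of `Fin n`; the first `k` entries are vertices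
    -- and remain unchanged.
    refine ⟨fun i => ⟨σ.arr 5 i % n, Nat.mod_lt _ (by omega)⟩, ⟨?_, ?_⟩, ?_, ?_, ?_, ?_, ?_⟩
    · intro i hi j hj hij
      have e := congrArg Fin.val hij
      have hi4 := hl4 i (by omega)
      have hj4 := hl4 j (by omega)
      rw [zero_add] at hi4 hj4
      simp only [h5] at e
      rw [hi4, hj4, Nat.mod_eq_of_lt (hln _ (List.getElem_mem _)),
        Nat.mod_eq_of_lt (hln _ (List.getElem_mem _)), hl1.getElem_inj_iff] at e
      exact e
    · intro v
      constructor
      · intro hv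
        have : (v : ℕ) ∈ l := (hl2 v).2 ⟨v.2, v.2, hv⟩
        obtain ⟨i, hi, he⟩ := List.getElem_of_mem this
        refine ⟨i, by omega, Fin.ext ?_⟩
        have hi4 := hl4 i hi
        rw [zero_add] at hi4
        simp only [h5]
        rw [hi4, he, Nat.mod_eq_of_lt v.2]
      · rintro ⟨i, hi, rfl⟩
        have hi4 := hl4 i (by omega)
        rw [zero_add] at hi4
        obtain ⟨-, hlt, hm⟩ := (hl2 _).1 (List.getElem_mem (show i < l.length by omega))
        have e : (⟨σ.arr 5 i % n, Nat.mod_lt _ (by omega)⟩ : Fin n) =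
            ⟨l[i]'(by omega), hlt⟩ := by
          apply Fin.ext
          simp only [h5]
          rw [hi4, Nat.mod_eq_of_lt hlt]
        rw [e]; exact hm
    · rw [hσ, Code.run_reg (by decide), h33]
    · rw [hσ, Code.run_reg (by decide), key.1]
    · rw [hσ]
      simp only [Code.run, State.setReg_reg_self, Tm.eval_add, Tm.eval_reg, h33]
      ring
    · rw [hσ, Code.run_reg (by decide), key.2]
    · intro i hi
      have hi4 := hl4 i (by omega)
      rw [zero_add] at hi4
      simp only [h5]
      rw [hi4, Nat.mod_eq_of_lt (hln _ (List.getElem_mem _))]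
  · simp [hs2, Code.run, State.setReg_reg, Tm.eval_const]
  · intro j hj t ht10 htr _ ⟨i1, i2⟩
    have ht3 : t.reg 3 = k := by rw [htr 3 (by decide), h32]
    have hcond : (Tm.lt (.reg 10) (.reg 3)).eval t ≠ 0 ↔ j < k := by
      rw [Tm.eval_lt_ne_zero, Tm.eval_reg, Tm.eval_reg, ht10, ht3]
    rw [State.setReg_reg, State.setReg_reg, if_neg (by norm_num), if_neg (by norm_num)]
    by_cases hjk : j < k
    · rw [Code.run, if_pos (hcond.2 hjk)]
      simp only [Code.run, State.setReg_reg, Tm.eval_six, Tm.eval_reg, if_true]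
      norm_num only [if_neg, ite_false]
      rw [i1, i2, min_eq_left hjk.le, min_eq_left (show j + 1 ≤ k by omega)]
      constructor <;> ring
    · rw [Code.run, if_neg fun h' => hjk (hcond.1 h'), Code.run, i1, i2, min_eq_right (by omega),
        min_eq_right (by omega)]
      exact ⟨rfl, rfl⟩

theorem powCode_spec {σ τ : State} (h6 : σ.reg 6 = 3 * k) (hτ : τ = powCode.run σ) :
    ∀ i ≤ 3 * k, τ.arr 6 i = 6 ^ i := by
  rw [powCode, Code.run] at hτ
  have key := Code.run_bdd_induct (x := 10) (r := 6)
    (P := .store 6 (.add (.reg 10) (.const 1)) (.six (.get 6 (.reg 10))))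
    (σ := Code.run (.store 6 (.const 0) (.const 1)) σ)
    (I := fun j t => ∀ i ≤ j, t.arr 6 i = 6 ^ i) ?_ ?_
  · rw [← hτ] at key
    simp only [Code.run, State.setArr_reg, h6] at key
    exact key
  · intro i hi
    rw [Nat.le_zero.1 hi]
    simp [Code.run, State.setArr_arr, Tm.eval_const]
  · intro j _ t ht10 _ _ hI i hi
    simp only [Code.run, State.setReg_arr, State.setArr_arr, if_true, Tm.eval_add, Tm.eval_reg,
      Tm.eval_const, Tm.eval_six, Tm.eval_get, ht10]
    by_cases hij : i = j + 1
    · subst hij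
      rw [Function.update_self, hI j le_rfl]; ring
    · rw [Function.update_of_ne hij]; exact hI i (by omega)

theorem mainCode_spec (hC : C.card = k) (hk : 0 < k)
    (hL : ∀ s ∈ L, s ∈ cert G (A : Set (Fin n))) {σ τ : State}
    (hσ : σ = (setupCode.run (inputState G A C L)).setReg 4 (216 ^ k + n))
    (hτ : τ = mainCode.run σ) :
    ∃ (z : ℕ → Fin n) (K : List (Finset (Sym2 (Fin n)))), Enumerates z k C ∧
      Progress G A C L z k L.length K τ := by
  obtain ⟨s0, hs0⟩ : ∃ s0, s0 = setupCode.run (inputState G A C L) := ⟨_, rfl⟩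
  rw [← hs0] at hσ
  obtain ⟨z, hE, h3, h5, h6, h7, hz⟩ := setupCode_spec hC hk hs0
  rw [mainCode, Code.run] at hτ
  obtain ⟨s1, hs1⟩ : ∃ s1, s1 = powCode.run σ := ⟨_, rfl⟩
  rw [← hs1] at hτ
  have hr : ∀ y, y ∉ powCode.regs → y ≠ 4 → s1.reg y = s0.reg y := by
    intro y hy hy4
    rw [hs1, Code.run_reg hy, hσ, State.setReg_reg, if_neg hy4]
  have ha : ∀ a, a ∉ powCode.arrs → s1.arr a = s0.arr a := by
    intro a ha
    rw [hs1, Code.run_arr ha, hσ, State.setReg_arr]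
  have hr0 : ∀ y, y ∉ powCode.regs → y ≠ 4 → y ∉ setupCode.regs →
      s1.reg y = (inputState G A C L).reg y := by
    intro y h1 h2 h3
    rw [hr y h1 h2, hs0, Code.run_reg h3]
  have ha0 : ∀ a, a ∉ powCode.arrs → a ∉ setupCode.arrs →
      s1.arr a = (inputState G A C L).arr a := by
    intro a h1 h2
    rw [ha a h1, hs0, Code.run_arr h2]
  have hB : Base G A C L z k s1 := by
    refine ⟨?_, ?_, ?_, ?_, ?_, ?_, ?_, ?_, ?_, ?_, ?_⟩
    · exact hr0 0 (by decide) (by decide) (by decide)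
    · rw [hr 3 (by decide) (by decide), h3]
    · rw [hs1, Code.run_reg (by decide), hσ, State.setReg_reg_self]
    · rw [hr 5 (by decide) (by decide), h5]
    · rw [hr 6 (by decide) (by decide), h6]
    · exact ha0 0 (by decide) (by decide)
    · exact ha0 1 (by decide) (by decide)
    · exact ha0 2 (by decide) (by decide)
    · exact ha0 3 (by decide) (by decide)
    · exact powCode_spec (by rw [hσ, State.setReg_reg, if_neg (by norm_num), h6]) hs1
    · rw [ha 5 (by decide)]; exact hz
  have h13 : s1.arr 13 = fun _ => 0 := ha0 13 (by decide) (by decide)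
  have h1 : s1.reg 1 = L.length := hr0 1 (by decide) (by decide) (by decide)
  have hP0 : Progress G A C L z k 0 [] (s1.setReg 11 0) := by
    have e2 : (s1.setReg 11 0).reg 2 = 0 := hr0 2 (by decide) (by decide) (by decide)
    have e12 : (s1.setReg 11 0).reg 12 = 0 := hr0 12 (by decide) (by decide) (by decide)
    have e24 : (s1.setReg 11 0).reg 24 = 0 := hr0 24 (by decide) (by decide) (by decide)
    refine ⟨hB.run (c := .assign 11 (.const 0)) rfl rfl, by rw [e12, zero_mul], by rw [e2]; rfl,
      by rw [e24]; simp, by simp, by simp, ?_, by simp, ?_, by simp⟩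
    · intro p _ hf
      rw [State.setReg_arr, h13] at hf
      exact absurd rfl hf
    · have : rowSpan (216 ^ k + n) (6 ^ k) ((s1.setReg 11 0).arr 13) ((s1.setReg 11 0).arr 14) =
          ⊥ := by
        rw [rowSpan, Submodule.span_eq_bot]
        rintro _ ⟨p, _, hf, -⟩
        rw [State.setReg_arr, h13] at hf
        exact absurd rfl hf
      rw [this]
      simp
  have key := Code.run_bdd_induct (x := 11) (r := 1) (P := bodyCode) (σ := s1)
    (I := fun i t => ∃ K, Progress G A C L z k i K t) ⟨[], hP0⟩ ?_
  · rw [← hτ, h1] at key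
    obtain ⟨K, hK⟩ := key
    exact ⟨z, K, hE, hK⟩
  · rintro i hi t - - - ⟨K, hK⟩
    rw [h1] at hi
    obtain ⟨K', hK'⟩ := bodyCode_spec hK hi hk hE hL
    have hr11 : ∀ y, y ≠ 11 → ((bodyCode.run t).setReg 11 (i + 1)).reg y = (bodyCode.run t).reg y :=
      fun y hy => by rw [State.setReg_reg, if_neg hy]
    refine ⟨K', hK'.toBase.of_frame ?_ (fun _ _ => rfl) (fun _ _ => rfl), ?_, ?_, ?_, hK'.out,
      hK'.sub, hK'.ech, hK'.count, hK'.span, hK'.cover⟩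
    · rintro y (rfl | rfl | rfl | rfl | rfl) <;> exact hr11 _ (by norm_num)
    · rw [hr11 12 (by norm_num), hK'.reg12]
    · rw [hr11 2 (by norm_num), hK'.reg2]
    · rw [hr11 24 (by norm_num), hK'.reg24]

/-- The constant in the time bound. -/
def shrinkSize : ℕ := setupCode.size + powCode.size + bodyCode.size + 18

/-- The exponent in the time bound. -/
def shrinkDepth : ℕ := setupCode.depth + powCode.depth + bodyCode.depth

/-- Since `n ≥ 3`, constant factors are absorbed into powers of `n`. The number `l` of certificates
limits only the outer loop and enters linearly. -/
theorem time_bound (hn : 3 ≤ n) (l : ℕ) {X : ℕ} (hX : X = 30 * (216 ^ k + n) + 30)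
    {t₁ t₂ t₃ : ℕ} (h1 : t₁ ≤ setupCode.size * X ^ setupCode.depth)
    (h2 : t₂ ≤ powCode.size * X ^ powCode.depth) (h3 : t₃ ≤ bodyCode.size * X ^ bodyCode.depth) :
    t₁ + (4 + (t₂ + (l * (t₃ + 8) + 6))) ≤
      n ^ (shrinkSize + 6 * shrinkDepth) * (max 1 l * 2 ^ (8 * shrinkDepth * k)) := by
  have hX1 : 1 ≤ X := by omega
  have hpow : ∀ {d}, d ≤ shrinkDepth → X ^ d ≤ X ^ shrinkDepth := fun h =>
    Nat.pow_le_pow_right hX1 h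
  have hD1 : 1 ≤ X ^ shrinkDepth := Nat.one_le_pow _ _ hX1
  have e1 : t₁ ≤ setupCode.size * X ^ shrinkDepth :=
    h1.trans (Nat.mul_le_mul_left _ (hpow (by unfold shrinkDepth; omega)))
  have e2 : t₂ ≤ powCode.size * X ^ shrinkDepth :=
    h2.trans (Nat.mul_le_mul_left _ (hpow (by unfold shrinkDepth; omega)))
  have e3 : t₃ ≤ bodyCode.size * X ^ shrinkDepth :=
    h3.trans (Nat.mul_le_mul_left _ (hpow (by unfold shrinkDepth; omega)))
  have hM1 : 1 ≤ max 1 l := le_max_left _ _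
  have hMl : l ≤ max 1 l := le_max_right _ _
  have hsum : t₁ + (4 + (t₂ + (l * (t₃ + 8) + 6))) ≤
      max 1 l * (shrinkSize * X ^ shrinkDepth) := by
    generalize max 1 l = M at *
    have f1 : l * (t₃ + 8) ≤ M * ((bodyCode.size + 8) * X ^ shrinkDepth) := by
      apply Nat.mul_le_mul hMl
      rw [add_mul]
      omega
    have f2 : t₁ + t₂ + 10 ≤ M * ((setupCode.size + powCode.size + 10) * X ^ shrinkDepth) := by
      calc t₁ + t₂ + 10 ≤ (setupCode.size + powCode.size + 10) * X ^ shrinkDepth := by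
            rw [add_mul, add_mul]; omega
        _ ≤ _ := Nat.le_mul_of_pos_left _ hM1
    calc t₁ + (4 + (t₂ + (l * (t₃ + 8) + 6))) = t₁ + t₂ + 10 + l * (t₃ + 8) := by ring
      _ ≤ _ := Nat.add_le_add f2 f1
      _ = _ := by unfold shrinkSize; ring
  -- From `216 ≤ 2 ^ 8` one gets `X ≤ 90 * n * 2 ^ (8 * k)`, and `90 ≤ 3 ^ 5 ≤ n ^ 5`.
  have hXle : X ≤ n ^ 6 * 2 ^ (8 * k) := by
    have g1 : 216 ^ k ≤ 2 ^ (8 * k) := by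
      rw [pow_mul]; exact Nat.pow_le_pow_left (by norm_num) k
    have g2 : 1 ≤ 2 ^ (8 * k) := Nat.one_le_two_pow
    have g3 : 243 ≤ n ^ 5 := by
      calc 243 = 3 ^ 5 := by norm_num
        _ ≤ n ^ 5 := Nat.pow_le_pow_left hn 5
    generalize 2 ^ (8 * k) = Y at *
    calc X ≤ 90 * (n * Y) := by nlinarith
      _ ≤ n ^ 5 * (n * Y) := Nat.mul_le_mul_right _ (by omega)
      _ = _ := by ring
  have hsize : shrinkSize ≤ n ^ shrinkSize :=
    (Nat.lt_pow_self (by omega : 1 < n)).le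
  calc _ ≤ max 1 l * (shrinkSize * X ^ shrinkDepth) := hsum
    _ ≤ max 1 l * (n ^ shrinkSize * (n ^ 6 * 2 ^ (8 * k)) ^ shrinkDepth) :=
      Nat.mul_le_mul_left _ (Nat.mul_le_mul hsize (Nat.pow_le_pow_left hXle _))
    _ = _ := by
      rw [mul_pow, ← pow_mul, ← pow_mul, pow_add]
      ring

theorem shrinkProgram_exec (hC : C.card = k) (hk : 3 ≤ k) {σ : State}
    (hσ : σ = (setupCode.run (inputState G A C L)).setReg 4 (216 ^ k + n)) :
    ∃ τ t, Exec shrinkProgram (inputState G A C L) τ t ∧ Agree 100 (mainCode.run σ) τ ∧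
      t ≤ n ^ (shrinkSize + 6 * shrinkDepth) *
        (max 1 L.length * 2 ^ (8 * shrinkDepth * k)) := by
  have hkn : k ≤ n := by
    have := Finset.card_le_univ C
    rwa [hC, Fintype.card_fin] at this
  obtain ⟨s0, hs0⟩ : ∃ s0, s0 = setupCode.run (inputState G A C L) := ⟨_, rfl⟩
  rw [← hs0] at hσ
  obtain ⟨z, -, -, h5, h6, h7, -⟩ := setupCode_spec hC (by omega) hs0
  set X := 30 * (216 ^ k + n) + 30 with hX
  have hpow6 : 6 ^ k ≤ 216 ^ k := Nat.pow_le_pow_left (by norm_num) k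
  -- Register 6 is a loop limit, so `3 * k` must obey the common bound `216 ^ k + n`.
  have hk3 : 3 * k ≤ 216 ^ k := by
    have h1 : k < 3 ^ k := Nat.lt_pow_self (by norm_num)
    have h2 : 3 * 3 ^ k ≤ 72 ^ k * 3 ^ k := by
      apply Nat.mul_le_mul_right
      calc 3 ≤ 72 ^ 1 := by norm_num
        _ ≤ 72 ^ k := Nat.pow_le_pow_right (by norm_num) (by omega)
    rw [← mul_pow] at h2
    norm_num at h2
    omega
  have h00 : s0.reg 0 = n := by rw [hs0, Code.run_reg (by decide)]; rfl
  have h01 : s0.reg 1 = L.length := by rw [hs0, Code.run_reg (by decide)]; rfl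
  obtain ⟨τ₁, t₁, hx1, ht1, ha1⟩ := Code.compile_exec (fun _ => 216 ^ k + n) setupCode
    (inputState G A C L) (inputState G A C L) (Agree.refl _ _) (by decide) (by
      have hl : ∀ r ∈ 4 :: setupCode.limits, r ∉ setupCode.regs ∧ (r = 4 ∨ r = 0) := by decide
      intro r hr
      refine ⟨(hl r hr).1, ?_⟩
      rcases (hl r hr).2 with rfl | rfl
      · exact Nat.zero_le _
      · exact Nat.le_add_left _ _)
  rw [← hs0] at ha1
  have hval : (Expr.add (.reg 7) (.reg 0)).eval τ₁ = 216 ^ k + n := by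
    simp only [Expr.eval]
    rw [← ha1.1 7 (by norm_num), ← ha1.1 0 (by norm_num), h7, h00]
  have hx2 := Exec.assign 4 (.add (.reg 7) (.reg 0)) τ₁
  rw [hval] at hx2
  have ha2 : Agree 100 σ (τ₁.setReg 4 (216 ^ k + n)) := by
    rw [hσ]; exact ha1.setReg_setReg 4 _
  have hlim : ∀ r, r = 4 ∨ r = 0 ∨ r = 5 ∨ r = 6 → σ.reg r ≤ 216 ^ k + n := by
    rintro r (rfl | rfl | rfl | rfl)
    · rw [hσ, State.setReg_reg_self]
    · rw [hσ, State.setReg_reg, if_neg (by norm_num), h00]; omega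
    · rw [hσ, State.setReg_reg, if_neg (by norm_num), h5]; omega
    · rw [hσ, State.setReg_reg, if_neg (by norm_num), h6]; omega
  obtain ⟨τ₂, t₂, hx3, ht2, ha3⟩ := Code.compile_exec
    (fun r => if r = 1 then L.length else 216 ^ k + n) mainCode σ _ ha2 (by decide) (by
      have hl : ∀ r ∈ 4 :: mainCode.limits, r ∉ mainCode.regs ∧
        (r = 1 ∨ r = 4 ∨ r = 0 ∨ r = 5 ∨ r = 6) := by decide
      intro r hr
      refine ⟨(hl r hr).1, ?_⟩
      rcases (hl r hr).2 with rfl | h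
      · rw [hσ, State.setReg_reg, if_neg (by norm_num), h01]; simp
      · rw [if_neg (by omega)]; exact hlim r h)
  refine ⟨τ₂, _, Exec.seq hx1 (Exec.seq hx2 hx3), ha3, ?_⟩
  have b1 : t₁ ≤ setupCode.size * X ^ setupCode.depth :=
    ht1.trans (Code.time_le setupCode fun _ _ => le_rfl)
  have b2 : powCode.time (fun r => if r = 1 then L.length else 216 ^ k + n) ≤
      powCode.size * X ^ powCode.depth := by
    refine Code.time_le powCode fun r hr => ?_
    -- Register 1, the number of certificates, limits no loop here nor in `bodyCode`, so these
    -- bounds do not involve `L.length`.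
    have hl : ∀ r ∈ 4 :: powCode.limits, r ≠ 1 := by decide
    rw [if_neg (hl r hr)]
  have b3 : bodyCode.time (fun r => if r = 1 then L.length else 216 ^ k + n) ≤
      bodyCode.size * X ^ bodyCode.depth := by
    refine Code.time_le bodyCode fun r hr => ?_
    have hl : ∀ r ∈ 4 :: bodyCode.limits, r ≠ 1 := by decide
    rw [if_neg (hl r hr)]
  refine le_trans ?_ (time_bound (by omega) L.length hX b1 b2 b3)
  rw [mainCode, Code.time, Code.time, if_pos rfl] at ht2
  simp only [Expr.cost]
  omega

end RAM

/-! ### The kept certificates form a small preserving subfamily -/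

theorem mainTheorem6 :
    ∃ (P : RAM.Program) (c d : ℕ),
      ∀ (n k : ℕ) (G : SimpleGraph (Fin n)) (A C : Finset (Fin n))
        (S : Finset (Finset (Sym2 (Fin n)))) (L : List (Finset (Sym2 (Fin n)))),
        (S : Set (Finset (Sym2 (Fin n)))) ⊆ cert G (A : Set (Fin n)) →
        (G.between (A : Set (Fin n)) (A : Set (Fin n))ᶜ).IsVertexCover (C : Set (Fin n)) →
        C.card = k → 3 ≤ k →
        L.Nodup → L.toFinset = S →
        ∃ (S' : Finset (Finset (Sym2 (Fin n)))) (τ : RAM.State) (t : ℕ),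
          RAM.Exec P (inputState G A C L) τ t ∧
          OutputsFamily τ S' ∧
          t ≤ n ^ c * (max 1 S.card * 2 ^ (d * k)) ∧
          S' ⊆ S ∧
          S'.card ≤ 6 ^ k ∧
          Preserves G (A : Set (Fin n)) (S' : Set (Finset (Sym2 (Fin n))))
            (S : Set (Finset (Sym2 (Fin n)))) := by
  refine ⟨RAM.shrinkProgram, RAM.shrinkSize + 6 * RAM.shrinkDepth, 8 * RAM.shrinkDepth, ?_⟩
  intro n k G A C S L hS hcov hC hk hL hLS
  have hmem : ∀ s, s ∈ L ↔ s ∈ S := fun s => by rw [← hLS, List.mem_toFinset]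
  obtain ⟨τ, t, hexec, hagree, ht⟩ := RAM.shrinkProgram_exec (G := G) (A := A) (L := L) hC hk rfl
  obtain ⟨z, K, hE, hK⟩ := RAM.mainCode_spec (G := G) (A := A) (L := L) hC (by omega)
    (fun s hs => hS ((hmem s).1 hs)) rfl rfl
  have hsub : K.Sublist L := by
    have := hK.sub
    rwa [List.take_length] at this
  have hnodup : K.Nodup := hL.sublist hsub
  have hcardK : K.toFinset.card = K.length := List.toFinset_card_of_nodup hnodup
  have hcardS : S.card = L.length := by rw [← hLS, List.toFinset_card_of_nodup hL]
  have hsubS : K.toFinset ⊆ S := fun s hs =>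
    (hmem s).1 (hsub.subset (List.mem_toFinset.1 hs))
  refine ⟨K.toFinset, τ, t, hexec, ⟨K, hnodup, rfl, ?_, ?_⟩, ?_, hsubS, ?_, ?_⟩
  · rw [← hagree.1 2 (by norm_num), hK.reg2, hcardK]
  · intro j hj
    rw [hcardK, mul_assoc] at hj
    rw [← hagree.2]
    exact hK.out j hj
  · rw [hcardS]; exact ht
  · rw [hcardK]
    -- The kept certificates are at most as many as the flagged rows, whose positions are below `6 ^
    -- k`.
    refine hK.count.trans ((Finset.card_filter_le _ _).trans ?_)
    rw [Finset.card_range]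
  · refine preserves_of_coverSpan_le hE (by omega) hcov hS (by exact_mod_cast hsubS) ?_
    intro s hs hd
    have := hK.cover s (by rw [List.take_length]; exact (hmem s).2 hs) hd
    simpa only [Finset.mem_coe, List.mem_toFinset] using this
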